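/- Let $n\in\mathbb N$, $A>0$, $B\in\mathbb R$, and let $V,F:[0,1]\times\mathbb R^n\to\mathbb C$ be Lebesgue measurable. Let $u\in L^\infty([0,1],L^2(\mathbb R^n))\cap L^2([0,1],H^1(\mathbb R^n))$ be a weak solution of $$\partial_t u=(A+iB)\bigl(\Delta u+V(x,t)u+F(x,t)\bigr)\quad\text{in }\mathbb R^n\times(0,1],$$ that is: $u(t)\in L^2(\mathbb R^n)$ for every $t\in[0,1]$, $Vu+F$ is locally integrable on $[0,1]\times\mathbb R^n$, and for every $\varphi\in C_c^\infty(\mathbb R^n)$ and every $t\in[0,1]$ $$\int_{\mathbb R^n}u(t)\varphi\,dx-\int_{\mathbb R^n}u(0)\varphi\,dx=(A+iB)\int_0^t\int_{\mathbb R^n}\bigl(u\,\Delta\varphi+(Vu+F)\varphi\bigr)\,dx\,ds .$$ Then for every $\gamma\ge 0$ and every $0\le T\le 1$, $$e^{-M_T}\Bigl\|e^{\frac{\gamma A|x|^2}{A+4\gamma(A^2+B^2)T}}u(T)\Bigr\|_{L^2(\mathbb R^n)}\le\bigl\|e^{\gamma|x|^2}u(0)\bigr\|_{L^2(\mathbb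 R^n)}+\sqrt{A^2+B^2}\int_0^T\Bigl\|e^{\frac{\gamma A|x|^2}{A+4\gamma(A^2+B^2)t}}F(t)\Bigr\|_{L^2(\mathbb R^n)}dt,$$ where, with $f^+=\max\{f,0\}$, $$M_T=\bigl\|A(\operatorname{Re}V)^+-B\operatorname{Im}V\bigr\|_{L^1([0,T],L^\infty(\mathbb R^n))}=\int_0^T\bigl\|A(\operatorname{Re}V(t))^+-B\operatorname{Im}V(t)\bigr\|_{L^\infty(\mathbb R^n)}\,dt .$$ All norms take values in $[0,\infty]$, with the conventions $e^{-\infty}=0$ and $0\cdot\infty=0$; in particular, if $M_T$ and the right-hand side are finite, then so is the weighted norm of $u(T)$. -/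

import Mathlib

open MeasureTheory Set
open scoped ENNReal ContDiff Laplacian

/-- Euclidean space `ℝⁿ`. -/
abbrev Rn (n : ℕ) : Type := EuclideanSpace ℝ (Fin n)

/-- Lebesgue measure on the space-time slab `[0,1] × ℝⁿ`. -/
noncomputable def slabMeasure (n : ℕ) : Measure (ℝ × Rn n) :=
  (volume : Measure (ℝ × Rn n)).restrict (Icc (0 : ℝ) 1 ×ˢ univ)

/-- `φ` is a test function, i.e. an element of `C_c^∞(ℝⁿ)`. -/
def IsTestFunction {n : ℕ} (φ : Rn n → ℝ) : Prop :=
  ContDiff ℝ ∞ φ ∧ HasCompactSupport φ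

/-- `g` is the weak (distributional) gradient of `f` on `ℝⁿ`. -/
def HasWeakGradient {n : ℕ} (f : Rn n → ℂ) (g : Rn n → EuclideanSpace ℂ (Fin n)) : Prop :=
  LocallyIntegrable f ∧ LocallyIntegrable g ∧
    ∀ φ : Rn n → ℝ, IsTestFunction φ → ∀ i : Fin n,
      ∫ x, fderiv ℝ φ x (EuclideanSpace.single i 1) • f x = -∫ x, φ x • g x i

/-- `u ∈ L^∞([0,1], L²(ℝⁿ))`. -/
def MemLinftyL2 {n : ℕ} (u : ℝ → Rn n → ℂ) : Prop :=
  AEStronglyMeasurable (fun p : ℝ × Rn n => u p.1 p.2) (slabMeasure n) ∧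
    ∃ C : ℝ≥0∞, C < ⊤ ∧
      ∀ᵐ t ∂(volume.restrict (Icc (0 : ℝ) 1)), eLpNorm (u t) 2 volume ≤ C

/-- `u ∈ L²([0,1], H¹(ℝⁿ))`: both `u` and its weak spatial gradient are square integrable over
`[0,1] × ℝⁿ`. -/
def MemL2H1 {n : ℕ} (u : ℝ → Rn n → ℂ) : Prop :=
  MemLp (fun p : ℝ × Rn n => u p.1 p.2) 2 (slabMeasure n) ∧
    ∃ G : ℝ → Rn n → EuclideanSpace ℂ (Fin n),
      MemLp (fun p : ℝ × Rn n => G p.1 p.2) 2 (slabMeasure n) ∧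
        ∀ᵐ t ∂(volume.restrict (Icc (0 : ℝ) 1)), HasWeakGradient (u t) (G t)

/-- `u` is a weak solution of `∂ₜu = (A + iB)(Δu + V u + F)` on `ℝⁿ × (0,1]`, with values
`u t ∈ L²(ℝⁿ)` at every time `t ∈ [0,1]`: the zero order term `V u + F` is locally integrable on
`[0,1] × ℝⁿ`, and the equation, integrated in time from `0` to `t`, holds in the sense of
distributions on `ℝⁿ`.  In particular `t ↦ ∫ φ u(t)` is absolutely continuous on `[0,1]` for each
test function `φ`, which is what gives `u 0` and `u T` their meaning. -/
structure IsWeakSolution {n : ℕ} (A B : ℝ) (V F u : ℝ → Rn n → ℂ) : Prop where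
  memLp : ∀ t ∈ Icc (0 : ℝ) 1, MemLp (u t) 2 volume
  locallyIntegrableOn :
    LocallyIntegrableOn (fun p : ℝ × Rn n => V p.1 p.2 * u p.1 p.2 + F p.1 p.2)
      (Icc (0 : ℝ) 1 ×ˢ univ) volume
  equation : ∀ φ : Rn n → ℝ, IsTestFunction φ → ∀ t ∈ Icc (0 : ℝ) 1,
    (∫ x, φ x • u t x) - ∫ x, φ x • u 0 x =
      ((A : ℂ) + (B : ℂ) * Complex.I) *
        ∫ s in (0 : ℝ)..t, ∫ x, (Δ φ x • u s x + φ x • (V s x * u s x + F s x))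

/-- `M_T = ‖A (Re V)⁺ - B Im V‖_{L¹([0,T], L^∞(ℝⁿ))}`. -/
noncomputable def potentialNorm {n : ℕ} (A B : ℝ) (V : ℝ → Rn n → ℂ) (T : ℝ) : ℝ≥0∞ :=
  ∫⁻ t in Icc (0 : ℝ) T,
    eLpNorm (fun x => A * max (V t x).re 0 - B * (V t x).im) ⊤ volume

/-- `‖e^{c |x|²} f‖_{L²(ℝⁿ)}`, as an extended nonnegative real. -/
noncomputable def gaussianNorm {n : ℕ} (c : ℝ) (f : Rn n → ℂ) : ℝ≥0∞ :=
  eLpNorm (fun x => Real.exp (c * ‖x‖ ^ 2) • f x) 2 volume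

/-- The exponent `γ A / (A + 4 γ (A² + B²) t)`. -/
noncomputable def decayRate (A B γ t : ℝ) : ℝ :=
  γ * A / (A + 4 * γ * (A ^ 2 + B ^ 2) * t)

open Filter Topology

/-! Write `c = A + iB` and let `a` be the decay rate, which solves the Riccati equation `a' =
-4|c|²a²/A` with `a 0 = γ`. Formally, differentiate `y(t) = ∫ e^{2a|x|²}|u|²`. Integrating the
Laplacian by parts yields the good term `-2A ∫ e^{2a|x|²}|∇u|²` and a cross term containing `∇|x|²`.
Completing the square absorbs the cross term into the good one at the cost of `8|c|²a²/A ∫ |x|²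
e^{2a|x|²}|u|²`, because `|∇|x|²|² = 4|x|²`. The derivative of the weight contributes exactly the
negative of this cost. What remains is `y' ≤ 2m y + 2|c| √y ‖e^{a|x|²}F‖`, where `m(t)` is the sup
norm whose integral is `M_T`, since `Re(cV) ≤ A(Re V)⁺ - B Im V`. Gronwall's inequality for `√y`
finishes the argument (`sqrt_le_of_le_integral`).

The obstacle is rigour: the weight is unbounded, and `Vu + F` is only locally integrable, so
`e^{2a|x|²}u` is not an admissible test function. Four regularizations deal with this. The quadratic
`|x|²` is replaced by a bounded `q` with `|∇q|² ≤ 4q`, the only structural property the cancellation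
needs. A spatial cutoff `ζ` localizes. The density `|u|²` is replaced by `k log(1 + |u|²/k)`, whose
gradient in `u` is bounded, so that it pairs with an integrable source. Finally everything is
mollified in `x`, so that the equation holds pointwise as an integral equation in time and the chain
rule and integration by parts apply classically.

The regularizations are removed in the reverse order. The mollification goes by dominated
convergence with varying dominating functions (`tendsto_integral_comp_mollify`), giving `energy_le`.
Cutoff and logarithm go together as their common parameter tends to infinity, the errors being
controlled by `u, ∇u ∈ L²` of the slab (`tendsto_integral_energyError`), giving
`weighted_energy_le`. After Gronwall, `q` increases to `|x|²` and Fatou's lemma applies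
(`gaussianNorm_le_of_boundedQuadratic`). The pointwise algebra behind the cancellation is
`energy_density_coord_le`. -/

/-! ### Calculus in time: chain rule along primitives and Gronwall's inequality. -/

theorem AbsolutelyContinuousOnInterval.of_dist_le {X Y : Type*} [PseudoMetricSpace X]
    [PseudoMetricSpace Y] {F : ℝ → X} {Φ : ℝ → Y} {a b K : ℝ}
    (hΦ : AbsolutelyContinuousOnInterval Φ a b)
    (h : ∀ x ∈ uIcc a b, ∀ y ∈ uIcc a b, dist (F x) (F y) ≤ K * dist (Φ x) (Φ y)) :
    AbsolutelyContinuousOnInterval F a b := by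
  unfold AbsolutelyContinuousOnInterval at hΦ ⊢
  refine squeeze_zero' (Eventually.of_forall fun _ => Finset.sum_nonneg fun i _ => dist_nonneg) ?_
    (by simpa using hΦ.const_mul K)
  rw [eventually_inf_principal]
  filter_upwards with E hE
  rw [Finset.mul_sum]
  exact Finset.sum_le_sum fun i hi => h _ (hE.1 i hi).1 _ (hE.1 i hi).2

/-- Chain rule for a primitive `X` of an integrable function, composed with a Lipschitz function
that is differentiable along `X`. -/
theorem sub_eq_integral_of_comp_primitive {E : Type*} [NormedAddCommGroup E] [NormedSpace ℝ E]
    [CompleteSpace E] {f : E → ℝ} {f' : E → E →L[ℝ] ℝ} {S : Set E} {K : NNReal}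
    (hLip : LipschitzOnWith K f S) {a b : ℝ} {h X : ℝ → E}
    (hh : IntervalIntegrable h volume a b)
    (hX : ∀ t ∈ uIcc a b, X t = X a + ∫ s in a..t, h s)
    (hXS : ∀ t ∈ uIcc a b, X t ∈ S) (hf : ∀ t ∈ uIcc a b, HasFDerivAt f (f' (X t)) (X t)) :
    f (X b) - f (X a) = ∫ s in a..b, f' (X s) (h s) := by
  set Y : ℝ → E := fun t => X a + ∫ s in a..t, h s with hY
  have hXY : ∀ t ∈ uIcc a b, X t = Y t := hX
  have hint : ∀ x ∈ uIcc a b, ∀ y ∈ uIcc a b, IntervalIntegrable h volume x y := fun x hx y hy =>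
    hh.mono_set (uIcc_subset_uIcc hx hy)
  -- Increments of `f ∘ Y` are at most `K` times those of the primitive of `‖h‖`, which is
  -- absolutely continuous. The fundamental theorem for absolutely continuous functions then needs
  -- only the a.e. derivative, supplied by Lebesgue differentiation.
  have hAC : AbsolutelyContinuousOnInterval (f ∘ Y) a b := by
    refine (hh.norm.absolutelyContinuousOnInterval_intervalIntegral (c := a)
      left_mem_uIcc).of_dist_le (K := K) fun x hx y hy => ?_
    have hYx := hXY x hx ▸ hXS x hx
    have hYy := hXY y hy ▸ hXS y hy
    refine (hLip.dist_le_mul _ hYx _ hYy).trans (mul_le_mul_of_nonneg_left ?_ K.2)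
    rw [dist_eq_norm, dist_eq_norm]
    have h1 : Y x - Y y = ∫ s in y..x, h s := by
      rw [hY]
      simp only [add_sub_add_left_eq_sub]
      exact intervalIntegral.integral_interval_sub_left (hint _ left_mem_uIcc _ hx)
        (hint _ left_mem_uIcc _ hy)
    have h2 : (∫ s in a..x, ‖h s‖) - ∫ s in a..y, ‖h s‖ = ∫ s in y..x, ‖h s‖ :=
      intervalIntegral.integral_interval_sub_left (hint _ left_mem_uIcc _ hx).norm
        (hint _ left_mem_uIcc _ hy).norm
    rw [h1, h2, Real.norm_eq_abs]
    exact intervalIntegral.norm_integral_le_abs_integral_norm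
  have h0 := hAC.integral_deriv_eq_sub
  simp only [Function.comp] at h0
  rw [← hXY b right_mem_uIcc, ← hXY a left_mem_uIcc] at h0
  rw [← h0]
  apply intervalIntegral.integral_congr_ae
  filter_upwards [hh.ae_hasDerivAt_integral] with t ht htm
  have htm' := uIoc_subset_uIcc htm
  have hd : HasDerivAt Y (h t) t := (ht htm' a left_mem_uIcc).const_add _
  have hfd := hf t htm'
  rw [hXY t htm'] at hfd ⊢
  exact (hfd.comp_hasDerivAt t hd).deriv

/-- An integral Gronwall inequality: `y' ≤ 2 m y + 2 C f √y` controls `√y`. -/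
theorem sqrt_le_of_le_integral {m f y : ℝ → ℝ} {y₀ C T : ℝ} (hT : 0 ≤ T) (hC : 0 ≤ C)
    (hy₀ : 0 ≤ y₀) (hm : ∀ t, 0 ≤ m t) (hf : ∀ t, 0 ≤ f t) (hy : ∀ t, 0 ≤ y t)
    (hmi : IntervalIntegrable m volume 0 T) (hfi : IntervalIntegrable f volume 0 T)
    (hr : IntervalIntegrable (fun t => 2 * m t * y t + 2 * C * (√(y t) * f t)) volume 0 T)
    (hle : ∀ t ∈ Icc 0 T, y t ≤ y₀ + ∫ s in (0 : ℝ)..t, 2 * m s * y s + 2 * C * (√(y s) * f s)) :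
    Real.exp (-∫ s in (0 : ℝ)..T, m s) * √(y T) ≤ √y₀ + C * ∫ s in (0 : ℝ)..T, f s := by
  set r : ℝ → ℝ := fun t => 2 * m t * y t + 2 * C * (√(y t) * f t) with hrdef
  have hr0 : ∀ t, 0 ≤ r t := fun t => by
    have := hm t; have := hf t; have := hy t; positivity
  -- The shift by `η` keeps the argument of the square root away from zero, where it is not
  -- Lipschitz.
  suffices H : ∀ η > 0, Real.exp (-∫ s in (0 : ℝ)..T, m s) * √(y T) ≤
      √(y₀ + η) + C * ∫ s in (0 : ℝ)..T, f s by
    have hlim : Tendsto (fun η : ℝ => √(y₀ + η) + C * ∫ s in (0 : ℝ)..T, f s) (𝓝[>] 0)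
        (𝓝 (√(y₀ + 0) + C * ∫ s in (0 : ℝ)..T, f s)) := by
      apply Tendsto.mono_left _ nhdsWithin_le_nhds
      apply Continuous.tendsto
      fun_prop
    rw [add_zero] at hlim
    exact ge_of_tendsto hlim (by filter_upwards [self_mem_nhdsWithin] with η hη using H η hη)
  intro η hη
  set M : ℝ → ℝ := fun t => ∫ s in (0 : ℝ)..t, m s
  -- No continuity of `y` is assumed, so the differentiation is carried out on the majorant `Φ`,
  -- which is a primitive, and `y ≤ Φ` is used only pointwise.
  set Φ : ℝ → ℝ := fun t => y₀ + η + ∫ s in (0 : ℝ)..t, r s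
  set X : ℝ → ℝ × ℝ := fun t => (M t, Φ t)
  have hu : uIcc 0 T = Icc 0 T := uIcc_of_le hT
  have hsub : ∀ t ∈ Icc 0 T, ∀ g : ℝ → ℝ, IntervalIntegrable g volume 0 T →
      IntervalIntegrable g volume 0 t := fun t ht g hg =>
    hg.mono_set (uIcc_subset_uIcc left_mem_uIcc (hu ▸ ht))
  have hmono : ∀ t ∈ Icc 0 T, ∀ g : ℝ → ℝ, (∀ s, 0 ≤ g s) → IntervalIntegrable g volume 0 T →
      ∫ s in (0 : ℝ)..t, g s ≤ ∫ s in (0 : ℝ)..T, g s := fun t ht g hg hgi =>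
    intervalIntegral.integral_mono_interval le_rfl ht.1 ht.2 (Eventually.of_forall hg) hgi
  have hnn : ∀ t ∈ Icc 0 T, ∀ g : ℝ → ℝ, (∀ s, 0 ≤ g s) → 0 ≤ ∫ s in (0 : ℝ)..t, g s :=
    fun t ht g hg => intervalIntegral.integral_nonneg ht.1 fun s _ => hg s
  have hΦη : ∀ t ∈ Icc 0 T, η ≤ Φ t := fun t ht => by
    have := hnn t ht r hr0; simp only [Φ]; linarith
  have hyΦ : ∀ t ∈ Icc 0 T, y t ≤ Φ t := fun t ht => by
    have := hle t ht; simp only [Φ]; linarith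
  set S : Set (ℝ × ℝ) := Icc 0 (M T) ×ˢ Icc η (Φ T)
  set F : ℝ × ℝ → ℝ := fun p => Real.exp (-p.1) * √p.2
  have hScpt : IsCompact S := isCompact_Icc.prod isCompact_Icc
  have hSconv : Convex ℝ S := (convex_Icc _ _).prod (convex_Icc _ _)
  have hFC : ContDiffOn ℝ 1 F S := by
    intro p hp
    have : p.2 ≠ 0 := (lt_of_lt_of_le hη hp.2.1).ne'
    apply ContDiffAt.contDiffWithinAt
    exact (Real.contDiff_exp.contDiffAt.comp p contDiffAt_fst.neg).mul
      (contDiffAt_snd.sqrt this)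
  obtain ⟨K, hK⟩ := hFC.exists_lipschitzOnWith (by decide) hSconv hScpt
  set F' : ℝ × ℝ → (ℝ × ℝ) →L[ℝ] ℝ := fun p =>
    Real.exp (-p.1) • ((1 / (2 * √p.2)) • ContinuousLinearMap.snd ℝ ℝ ℝ) +
      √p.2 • (Real.exp (-p.1) • -ContinuousLinearMap.fst ℝ ℝ ℝ)
  have key := sub_eq_integral_of_comp_primitive (f' := F') hK (a := 0) (b := T)
    (h := fun t => (m t, r t)) (X := X) ?_ ?_ ?_ ?_
  · have hle2 : F (X T) - F (X 0) ≤ C * ∫ s in (0 : ℝ)..T, f s := by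
      have hmm : IntervalIntegrable (fun s => F' (X s) (m s, r s)) volume 0 T := by
        have : (fun s => F' (X s) (m s, r s)) = fun s =>
            (Real.exp (-M s) * (1 / (2 * √(Φ s)))) * r s - (√(Φ s) * Real.exp (-M s)) * m s := by
          ext s; simp [F', X]; ring
        rw [this]
        have hMc : ContinuousOn M (uIcc 0 T) :=
          intervalIntegral.continuousOn_primitive_interval' hmi left_mem_uIcc
        have hΦc : ContinuousOn Φ (uIcc 0 T) :=
          continuousOn_const.add
            (intervalIntegral.continuousOn_primitive_interval' hr left_mem_uIcc)
        refine (hr.continuousOn_mul ?_).sub (hmi.continuousOn_mul ?_)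
        · refine hMc.neg.rexp.mul (continuousOn_const.div
            (continuousOn_const.mul hΦc.sqrt) fun s hs => ?_)
          have := Real.sqrt_pos.2 (hη.trans_le (hΦη s (hu ▸ hs)))
          positivity
        · exact hΦc.sqrt.mul hMc.neg.rexp
      rw [key, ← intervalIntegral.integral_const_mul]
      refine intervalIntegral.integral_mono_on hT hmm (hfi.const_mul C) fun s hs => ?_
      have hpos := hη.trans_le (hΦη s hs)
      have hsq := Real.sqrt_pos.2 hpos
      -- This is `Φ' ≤ 2√Φ (m√Φ + C f)`. The term with `m` is then cancelled by the derivative of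
      -- the factor `exp(-M)`.
      have h1 : r s ≤ 2 * √(Φ s) * (m s * √(Φ s) + C * f s) := by
        have e1 : m s * y s ≤ m s * Φ s := mul_le_mul_of_nonneg_left (hyΦ s hs) (hm s)
        have e2 : √(y s) * f s ≤ √(Φ s) * f s :=
          mul_le_mul_of_nonneg_right (Real.sqrt_le_sqrt (hyΦ s hs)) (hf s)
        have e3 : C * (√(y s) * f s) ≤ C * (√(Φ s) * f s) := mul_le_mul_of_nonneg_left e2 hC
        have e4 : √(Φ s) * √(Φ s) = Φ s := Real.mul_self_sqrt hpos.le
        have : 2 * √(Φ s) * (m s * √(Φ s) + C * f s) =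
          2 * m s * (√(Φ s) * √(Φ s)) + 2 * (C * (√(Φ s) * f s)) := by ring
        rw [this, e4]; simp only [hrdef]; linarith
      have h2 : 1 / (2 * √(Φ s)) * r s ≤ m s * √(Φ s) + C * f s := by
        rw [one_div, inv_mul_le_iff₀ (by positivity)]; exact h1
      have h3 : F' (X s) (m s, r s) =
          Real.exp (-M s) * (1 / (2 * √(Φ s)) * r s - m s * √(Φ s)) := by
        simp [F', X]; ring
      rw [h3]
      have h4 : Real.exp (-M s) ≤ 1 := by
        rw [Real.exp_le_one_iff]; have := hnn s hs m hm; simp only [M]; linarith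
      have h5 : 0 ≤ C * f s := mul_nonneg hC (hf s)
      calc _ ≤ Real.exp (-M s) * (C * f s) :=
            mul_le_mul_of_nonneg_left (by linarith) (Real.exp_pos _).le
        _ ≤ 1 * (C * f s) := mul_le_mul_of_nonneg_right h4 h5
        _ = _ := one_mul _
    have e0 : F (X 0) = √(y₀ + η) := by simp [F, X, M, Φ]
    have e1 : Real.exp (-M T) * √(y T) ≤ F (X T) :=
      mul_le_mul_of_nonneg_left (Real.sqrt_le_sqrt (hyΦ T ⟨hT, le_rfl⟩)) (Real.exp_pos _).le
    linarith
  · exact ⟨hmi.1.prodMk hr.1, hmi.2.prodMk hr.2⟩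
  · intro t ht
    rw [hu] at ht
    have h1 := hsub t ht m hmi
    have h2 := hsub t ht r hr
    have : ∫ s in (0 : ℝ)..t, (m s, r s) = (∫ s in (0 : ℝ)..t, m s, ∫ s in (0 : ℝ)..t, r s) := by
      rw [intervalIntegral.integral_of_le ht.1, intervalIntegral.integral_of_le ht.1,
        intervalIntegral.integral_of_le ht.1]
      exact integral_pair h1.1 h2.1
    rw [this]
    simp [X, M, Φ]
  · intro t ht
    rw [hu] at ht
    exact ⟨⟨hnn t ht m hm, hmono t ht m hm hmi⟩, hΦη t ht,
      by have := hmono t ht r hr0 hr; simp only [X, Φ]; linarith⟩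
  · intro t ht
    rw [hu] at ht
    have hpos := hη.trans_le (hΦη t ht)
    have h1 : HasFDerivAt (fun p : ℝ × ℝ => Real.exp (-p.1))
        (Real.exp (-(X t).1) • -ContinuousLinearMap.fst ℝ ℝ ℝ) (X t) :=
      (hasFDerivAt_fst.neg).exp
    have h2 : HasFDerivAt (fun p : ℝ × ℝ => √p.2)
        ((1 / (2 * √(X t).2)) • ContinuousLinearMap.snd ℝ ℝ ℝ) (X t) :=
      hasFDerivAt_snd.sqrt hpos.ne'
    exact h1.mul h2

/-! ### Dominated convergence with moving majorants. -/

/-- Dominated convergence with varying dominating functions. -/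
theorem tendsto_integral_of_varying_dominated {α : Type*} [MeasurableSpace α] {μ : Measure α}
    {f g : ℕ → α → ℝ} {f₀ g₀ : α → ℝ} (hf : ∀ j, AEStronglyMeasurable (f j) μ)
    (hg : ∀ j, Integrable (g j) μ) (hg₀ : Integrable g₀ μ) (hpos : ∀ x, 0 ≤ g₀ x)
    (hgpos : ∀ j x, 0 ≤ g j x)
    (hfg : ∀ j, ∀ᵐ x ∂μ, |f j x| ≤ g j x)
    (hflim : ∀ᵐ x ∂μ, Tendsto (fun j => f j x) atTop (𝓝 (f₀ x)))
    (hglim : ∀ᵐ x ∂μ, Tendsto (fun j => g j x) atTop (𝓝 (g₀ x)))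
    (hint : Tendsto (fun j => ∫ x, g j x ∂μ) atTop (𝓝 (∫ x, g₀ x ∂μ))) :
    Tendsto (fun j => ∫ x, f j x ∂μ) atTop (𝓝 (∫ x, f₀ x ∂μ)) := by
  have hfi : ∀ j, Integrable (f j) μ := fun j => (hg j).mono' (hf j) (hfg j)
  have hlim_le : ∀ᵐ x ∂μ, |f₀ x| ≤ g₀ x := by
    filter_upwards [hflim, hglim, ae_all_iff.2 hfg] with x h1 h2 h3
    exact le_of_tendsto_of_tendsto' h1.abs h2 h3
  -- Clipping `f j` to `[-g₀, g₀]` reduces the claim to ordinary dominated convergence. The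
  -- clipped-off part is at most `g j - min (g j) g₀`, whose integral tends to zero because `∫ g j →
  -- ∫ g₀`.
  set cl : ℕ → α → ℝ := fun j x => max (-g₀ x) (min (g₀ x) (f j x)) with hcl
  have hclm : ∀ j, AEStronglyMeasurable (cl j) μ := fun j =>
    hg₀.1.neg.sup (hg₀.1.inf (hf j))
  have hclb : ∀ j x, |cl j x| ≤ g₀ x := fun j x => by
    rw [abs_le]
    refine ⟨le_max_left _ _, max_le ?_ (min_le_left _ _)⟩
    linarith [hpos x]
  have hcli : ∀ j, Integrable (cl j) μ := fun j =>
    hg₀.mono' (hclm j) (Eventually.of_forall (hclb j))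
  have h1 : Tendsto (fun j => ∫ x, cl j x ∂μ) atTop (𝓝 (∫ x, f₀ x ∂μ)) := by
    refine tendsto_integral_of_dominated_convergence g₀ hclm hg₀
      (fun j => Eventually.of_forall (hclb j)) ?_
    filter_upwards [hflim, hlim_le] with x hx hle
    have : max (-g₀ x) (min (g₀ x) (f₀ x)) = f₀ x := by
      rw [min_eq_right (le_of_abs_le hle), max_eq_right (neg_le_of_abs_le hle)]
    rw [← this]
    exact tendsto_const_nhds.max (tendsto_const_nhds.min hx)
  have hmi : ∀ j, Integrable (fun x => min (g j x) (g₀ x)) μ := fun j => (hg j).inf hg₀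
  have h2 : Tendsto (fun j => ∫ x, min (g j x) (g₀ x) ∂μ) atTop (𝓝 (∫ x, g₀ x ∂μ)) := by
    refine tendsto_integral_of_dominated_convergence g₀ (fun j => (hmi j).1) hg₀
      (fun j => Eventually.of_forall fun x => ?_) ?_
    · rw [Real.norm_of_nonneg (le_min (hgpos j x) (hpos x))]
      exact min_le_right _ _
    · filter_upwards [hglim] with x hx
      simpa using hx.min (tendsto_const_nhds (x := g₀ x))
  have h3 : Tendsto (fun j => ∫ x, (f j x - cl j x) ∂μ) atTop (𝓝 0) := by
    refine squeeze_zero_norm (a := fun j => ∫ x, (g j x - min (g j x) (g₀ x)) ∂μ) (fun j => ?_) ?_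
    · refine norm_integral_le_of_norm_le ((hg j).sub (hmi j)) ?_
      filter_upwards [hfg j] with x hx
      rw [Real.norm_eq_abs, abs_le]
      have := hpos x
      have hx' := abs_le.1 hx
      simp only [hcl]
      constructor <;> rcases min_cases (g j x) (g₀ x) with h | h <;>
        rcases min_cases (g₀ x) (f j x) with h' | h' <;>
        rcases max_cases (-g₀ x) (min (g₀ x) (f j x)) with h'' | h'' <;> linarith
    · have := hint.sub h2
      rw [sub_self] at this
      refine this.congr fun j => (integral_sub (hg j) (hmi j)).symm
  have := h3.add h1
  rw [zero_add] at this
  refine this.congr fun j => ?_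
  rw [integral_sub (hfi j) (hcli j)]
  ring

theorem integral_add_three {n : ℕ} {f₁ f₂ f₃ : Rn n → ℝ} (h₁ : Integrable f₁) (h₂ : Integrable f₂)
    (h₃ : Integrable f₃) : ∫ x, (f₁ x + f₂ x + f₃ x) = (∫ x, f₁ x) + (∫ x, f₂ x) + ∫ x, f₃ x := by
  rw [← integral_add h₁ h₂]
  exact integral_add (h₁.add h₂) h₃

/-! ### Mollification in space. -/

/-- A bump function of radius `1 / (j + 1)`. -/
noncomputable def shrinkingBump (n j : ℕ) : ContDiffBump (0 : Rn n) where
  rIn := 1 / 2 / (j + 1)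
  rOut := 1 / (j + 1)
  rIn_pos := by positivity
  rIn_lt_rOut := by gcongr; norm_num

/-- A mollifier supported in the ball of radius `1 / (j + 1)`. -/
noncomputable def mollifier (n j : ℕ) : Rn n → ℝ := (shrinkingBump n j).normed volume

/-- The convolution of `f` with `mollifier n j`. -/
noncomputable def mollify {n : ℕ} (j : ℕ) {E : Type*} [NormedAddCommGroup E] [NormedSpace ℝ E]
    (f : Rn n → E) (x : Rn n) : E := ∫ y, mollifier n j (x - y) • f y

section mollify

variable {n : ℕ} {E : Type*} [NormedAddCommGroup E] [NormedSpace ℝ E]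

theorem mollify_eq_convolution (j : ℕ) (f : Rn n → E) :
    mollify j f = convolution (mollifier n j) f (ContinuousLinearMap.lsmul ℝ ℝ) volume := by
  ext x
  rw [convolution_lsmul_swap]
  rfl

theorem mollifier_nonneg (n j : ℕ) (x : Rn n) : 0 ≤ mollifier n j x :=
  (shrinkingBump n j).nonneg_normed x

theorem contDiff_mollifier (n j : ℕ) : ContDiff ℝ ∞ (mollifier n j) :=
  (shrinkingBump n j).contDiff_normed

theorem hasCompactSupport_mollifier (n j : ℕ) : HasCompactSupport (mollifier n j) :=
  (shrinkingBump n j).hasCompactSupport_normed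

theorem integral_mollifier (n j : ℕ) : ∫ x, mollifier n j x = 1 :=
  (shrinkingBump n j).integral_normed

theorem integrable_mollifier (n j : ℕ) : Integrable (mollifier n j) :=
  (contDiff_mollifier n j).continuous.integrable_of_hasCompactSupport
    (hasCompactSupport_mollifier n j)

theorem mollifier_eq_zero {j : ℕ} {x : Rn n} (hx : 1 ≤ ‖x‖) : mollifier n j x = 0 := by
  have h : x ∉ Function.support (mollifier n j) := by
    rw [mollifier, (shrinkingBump n j).support_normed_eq]
    simp only [Metric.mem_ball, dist_zero_right, not_lt]
    refine le_trans ?_ hx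
    change (1 : ℝ) / (j + 1) ≤ 1
    rw [div_le_one (by positivity)]
    simp
  simpa using h

theorem hasCompactSupport_mollifier_sub (j : ℕ) (x : Rn n) :
    HasCompactSupport fun y => mollifier n j (x - y) :=
  (hasCompactSupport_mollifier n j).comp_homeomorph (Homeomorph.subLeft x)

theorem contDiff_mollifier_sub (j : ℕ) (x : Rn n) :
    ContDiff ℝ ∞ fun y => mollifier n j (x - y) :=
  (contDiff_mollifier n j).comp (contDiff_const.sub contDiff_id)

theorem integral_mollifier_sub (j : ℕ) (x : Rn n) : ∫ y, mollifier n j (x - y) = 1 := by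
  rw [integral_sub_left_eq_self (mollifier n j) volume x, integral_mollifier]

theorem MeasureTheory.LocallyIntegrable.integrable_mollifier_smul {f : Rn n → E} (hf :
    LocallyIntegrable f)
    (j : ℕ) (x : Rn n) : Integrable fun y => mollifier n j (x - y) • f y :=
  hf.integrable_smul_left_of_hasCompactSupport (contDiff_mollifier_sub j x).continuous
    (hasCompactSupport_mollifier_sub j x)

/-- Lebesgue differentiation applies because the ratio of outer to inner radius of the bumps stays
equal to `2`. -/
theorem ae_tendsto_mollify [CompleteSpace E] {f : Rn n → E} (hf : LocallyIntegrable f) :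
    ∀ᵐ x, Tendsto (fun j => mollify j f x) atTop (𝓝 (f x)) := by
  simp_rw [mollify_eq_convolution]
  refine ContDiffBump.ae_convolution_tendsto_right_of_locallyIntegrable (K := 2) ?_ ?_ hf
  · exact tendsto_one_div_add_atTop_nhds_zero_nat
  · refine Eventually.of_forall fun j => le_of_eq ?_
    change (1 : ℝ) / (j + 1) = 2 * (1 / 2 / (j + 1))
    ring

theorem norm_mollify_le (j : ℕ) (f : Rn n → E) (x : Rn n) :
    ‖mollify j f x‖ ≤ mollify j (fun y => ‖f y‖) x := by
  refine (norm_integral_le_integral_norm _).trans_eq (integral_congr_ae ?_)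
  filter_upwards with y
  rw [norm_smul, Real.norm_of_nonneg (mollifier_nonneg _ _ _), smul_eq_mul]

/-- Jensen's inequality for the probability density `y ↦ mollifier n j (x - y)`, obtained from
nonnegativity of the variance of `‖f‖`. -/
theorem norm_mollify_sq_le (j : ℕ) {f : Rn n → E} (hf : LocallyIntegrable f)
    (hf2 : LocallyIntegrable fun y => ‖f y‖ ^ 2) (x : Rn n) :
    ‖mollify j f x‖ ^ 2 ≤ mollify j (fun y => ‖f y‖ ^ 2) x := by
  set m := mollify j (fun y => ‖f y‖) x with hm
  have h1 : ‖mollify j f x‖ ^ 2 ≤ m ^ 2 :=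
    pow_le_pow_left₀ (norm_nonneg _) (norm_mollify_le j f x) 2
  refine h1.trans ?_
  have hfn : LocallyIntegrable fun y => ‖f y‖ := fun z =>
    let ⟨s, hs, h⟩ := hf z
    ⟨s, hs, h.norm⟩
  have i1 := LocallyIntegrable.integrable_mollifier_smul hfn j x
  have i2 := LocallyIntegrable.integrable_mollifier_smul hf2 j x
  have i3 : Integrable fun y => mollifier n j (x - y) :=
    (integrable_mollifier n j).comp_sub_left x
  have h2 : 0 ≤ ∫ y, mollifier n j (x - y) * (‖f y‖ - m) ^ 2 :=
    integral_nonneg fun y => mul_nonneg (mollifier_nonneg _ _ _) (sq_nonneg _)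
  have h3 : ∫ y, mollifier n j (x - y) * (‖f y‖ - m) ^ 2 =
      mollify j (fun y => ‖f y‖ ^ 2) x - 2 * m * m + m ^ 2 * 1 := by
    have : (fun y => mollifier n j (x - y) * (‖f y‖ - m) ^ 2) = fun y =>
        mollifier n j (x - y) • ‖f y‖ ^ 2 + (-(2 * m)) * (mollifier n j (x - y) • ‖f y‖) +
          m ^ 2 * mollifier n j (x - y) := by
      ext y; simp only [smul_eq_mul]; ring
    rw [this, integral_add_three i2 (i1.const_mul _) (i3.const_mul _),
      integral_const_mul, integral_const_mul, integral_mollifier_sub]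
    change mollify j (fun y => ‖f y‖ ^ 2) x + (-(2 * m)) * m + m ^ 2 * 1 = _
    ring
  nlinarith

theorem MeasureTheory.Integrable.mollify {f : Rn n → E} (hf : Integrable f) (j : ℕ) :
    Integrable (mollify j f) := by
  rw [mollify_eq_convolution]
  exact (integrable_mollifier n j).integrable_convolution _ hf

theorem integral_mollify [CompleteSpace E] {f : Rn n → E} (hf : Integrable f) (j : ℕ) :
    ∫ x, mollify j f x = ∫ x, f x := by
  rw [mollify_eq_convolution, integral_convolution _ (integrable_mollifier n j) hf,
    integral_mollifier]
  simp

theorem contDiff_mollify {f : Rn n → E} (hf : LocallyIntegrable f) (j : ℕ) :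
    ContDiff ℝ ∞ (mollify j f) := by
  rw [mollify_eq_convolution]
  exact (hasCompactSupport_mollifier n j).contDiff_convolution_left _ (contDiff_mollifier n j) hf

end mollify

/-! ### Removing the mollification from integrals of nonlinear expressions. -/

section limit

variable {n : ℕ} {E₁ E₂ E₃ : Type*} [NormedAddCommGroup E₁]
  [NormedAddCommGroup E₂] [NormedAddCommGroup E₃]
  {Ψ : Rn n → E₁ × E₂ × E₃ → ℝ} {C : ℝ} {u : Rn n → E₁} {g : Rn n → E₂} {h : Rn n → E₃}

theorem MeasureTheory.MemLp.integrable_norm_sq {E : Type*} [NormedAddCommGroup E] {f : Rn n → E}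
    (hf : MemLp f 2) : Integrable fun x => ‖f x‖ ^ 2 :=
  (memLp_two_iff_integrable_sq_norm hf.1).1 hf

theorem integrable_dominating (C : ℝ) (hu : MemLp u 2) (hg : MemLp g 2) (hh : Integrable h)
    (j : ℕ) : Integrable fun x => C * (mollify j (fun y => ‖u y‖ ^ 2) x +
      mollify j (fun y => ‖g y‖ ^ 2) x + mollify j (fun y => ‖h y‖) x) :=
  ((((MemLp.integrable_norm_sq hu).mollify j).add ((MemLp.integrable_norm_sq hg).mollify j)).add
    (hh.norm.mollify j)).const_mul C

/-- Mollification preserves integrals, so the majorants all have the same integral as their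
pointwise limit. This is the hypothesis that moving dominated convergence requires, and it also
gives a bound uniform in `j`. -/
theorem integral_dominating (C : ℝ) (hu : MemLp u 2) (hg : MemLp g 2) (hh : Integrable h)
    (j : ℕ) : ∫ x, C * (mollify j (fun y => ‖u y‖ ^ 2) x +
      mollify j (fun y => ‖g y‖ ^ 2) x + mollify j (fun y => ‖h y‖) x) =
      C * ((∫ x, ‖u x‖ ^ 2) + (∫ x, ‖g x‖ ^ 2) + ∫ x, ‖h x‖) := by
  have i1 := MemLp.integrable_norm_sq hu
  have i2 := MemLp.integrable_norm_sq hg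
  have i3 := hh.norm
  rw [integral_const_mul, integral_add_three (i1.mollify j) (i2.mollify j) (i3.mollify j),
      integral_mollify i1, integral_mollify i2,
    integral_mollify i3]

variable [NormedSpace ℝ E₁] [NormedSpace ℝ E₂] [NormedSpace ℝ E₃]

theorem abs_mollify_le_dominating
    (hΨb : ∀ x p, |Ψ x p| ≤ C * (‖p.1‖ ^ 2 + ‖p.2.1‖ ^ 2 + ‖p.2.2‖)) (hC : 0 ≤ C)
    (hu : MemLp u 2) (hg : MemLp g 2) (j : ℕ) (x : Rn n) :
    |Ψ x (mollify j u x, mollify j g x, mollify j h x)| ≤ C * (mollify j (fun y => ‖u y‖ ^ 2) x +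
      mollify j (fun y => ‖g y‖ ^ 2) x + mollify j (fun y => ‖h y‖) x) := by
  refine (hΨb _ _).trans (mul_le_mul_of_nonneg_left (add_le_add (add_le_add ?_ ?_) ?_) hC)
  · exact norm_mollify_sq_le j (hu.locallyIntegrable (by norm_num))
      (hu.integrable_norm_sq).locallyIntegrable x
  · exact norm_mollify_sq_le j (hg.locallyIntegrable (by norm_num))
      (hg.integrable_norm_sq).locallyIntegrable x
  · exact norm_mollify_le j h x

theorem integrable_comp_mollify (hΨ : Continuous fun q : Rn n × (E₁ × E₂ × E₃) => Ψ q.1 q.2)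
    (hΨb : ∀ x p, |Ψ x p| ≤ C * (‖p.1‖ ^ 2 + ‖p.2.1‖ ^ 2 + ‖p.2.2‖)) (hC : 0 ≤ C)
    (hu : MemLp u 2) (hg : MemLp g 2) (hh : Integrable h) (j : ℕ) :
    Integrable fun x => Ψ x (mollify j u x, mollify j g x, mollify j h x) := by
  refine (integrable_dominating C hu hg hh j).mono' ?_
    (Eventually.of_forall fun x => abs_mollify_le_dominating hΨb hC hu hg (h := h) j x)
  have c1 := (contDiff_mollify (hu.locallyIntegrable (by norm_num)) j).continuous
  have c2 := (contDiff_mollify (hg.locallyIntegrable (by norm_num)) j).continuous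
  have c3 := (contDiff_mollify hh.locallyIntegrable j).continuous
  exact (hΨ.comp (continuous_id.prodMk (c1.prodMk (c2.prodMk c3)))).aestronglyMeasurable

theorem abs_integral_comp_mollify_le
    (hΨb : ∀ x p, |Ψ x p| ≤ C * (‖p.1‖ ^ 2 + ‖p.2.1‖ ^ 2 + ‖p.2.2‖)) (hC : 0 ≤ C)
    (hu : MemLp u 2) (hg : MemLp g 2) (hh : Integrable h) (j : ℕ) :
    |∫ x, Ψ x (mollify j u x, mollify j g x, mollify j h x)| ≤
      C * ((∫ x, ‖u x‖ ^ 2) + (∫ x, ‖g x‖ ^ 2) + ∫ x, ‖h x‖) := by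
  rw [← integral_dominating C hu hg hh j]
  exact norm_integral_le_of_norm_le
    (f := fun x => Ψ x (mollify j u x, mollify j g x, mollify j h x))
    (integrable_dominating C hu hg hh j)
    (Eventually.of_forall fun x => abs_mollify_le_dominating hΨb hC hu hg (h := h) j x)

/-- The growth of `Ψ`, quadratic in the two `L²` slots and linear in the `L¹` slot, is what Jensen's
inequality turns into a majorant built from mollified integrable functions. No fixed majorant is
available when `h` is merely integrable. -/
theorem tendsto_integral_comp_mollify [CompleteSpace E₁] [CompleteSpace E₂] [CompleteSpace E₃]
    (hΨ : Continuous fun q : Rn n × (E₁ × E₂ × E₃) => Ψ q.1 q.2)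
    (hΨb : ∀ x p, |Ψ x p| ≤ C * (‖p.1‖ ^ 2 + ‖p.2.1‖ ^ 2 + ‖p.2.2‖)) (hC : 0 ≤ C)
    (hu : MemLp u 2) (hg : MemLp g 2) (hh : Integrable h) :
    Tendsto (fun j => ∫ x, Ψ x (mollify j u x, mollify j g x, mollify j h x)) atTop
      (𝓝 (∫ x, Ψ x (u x, g x, h x))) := by
  have i1 := MemLp.integrable_norm_sq hu
  have i2 := MemLp.integrable_norm_sq hg
  refine tendsto_integral_of_varying_dominated
    (fun j => (integrable_comp_mollify hΨ hΨb hC hu hg hh j).1)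
    (integrable_dominating C hu hg hh)
    (g₀ := fun x => C * (‖u x‖ ^ 2 + ‖g x‖ ^ 2 + ‖h x‖))
    (((i1.add i2).add hh.norm).const_mul C) (fun x => by positivity)
    (fun j x => (abs_nonneg _).trans (abs_mollify_le_dominating hΨb hC hu hg j x))
    (fun j => Eventually.of_forall fun x => abs_mollify_le_dominating hΨb hC hu hg j x) ?_ ?_ ?_
  · filter_upwards [ae_tendsto_mollify (hu.locallyIntegrable (by norm_num)),
      ae_tendsto_mollify (hg.locallyIntegrable (by norm_num)),
      ae_tendsto_mollify hh.locallyIntegrable] with x h1 h2 h3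
    exact ((hΨ.comp (Continuous.prodMk_right x)).tendsto _).comp
      (h1.prodMk_nhds (h2.prodMk_nhds h3))
  · filter_upwards [ae_tendsto_mollify i1.locallyIntegrable,
      ae_tendsto_mollify i2.locallyIntegrable,
      ae_tendsto_mollify hh.norm.locallyIntegrable] with x h1 h2 h3
    exact ((h1.add h2).add h3).const_mul C
  · simp_rw [integral_dominating C hu hg hh]
    rw [integral_const_mul, integral_add_three i1 i2 hh.norm]
    exact tendsto_const_nhds

end limit

/-! ### Smooth kernels and weak gradients. -/

section kernel

variable {n : ℕ} {E : Type*} [NormedAddCommGroup E] [NormedSpace ℝ E]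

theorem hasFDerivAt_integral_kernel {k : Rn n → ℝ} (hk : ContDiff ℝ 1 k)
    (hks : HasCompactSupport k) {f : Rn n → E} (hf : LocallyIntegrable f) (x : Rn n) :
    ∃ L : Rn n →L[ℝ] E, HasFDerivAt (fun x => ∫ y, k (x - y) • f y) L x ∧
      ∀ v, L v = ∫ y, fderiv ℝ k (x - y) v • f y := by
  have h := hks.hasFDerivAt_convolution_left (ContinuousLinearMap.lsmul ℝ ℝ) hk hf x
  have e : (convolution k f (ContinuousLinearMap.lsmul ℝ ℝ) volume) =
      fun x => ∫ y, k (x - y) • f y := by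
    ext z; exact convolution_lsmul_swap
  rw [e] at h
  refine ⟨_, h, fun v => ?_⟩
  rw [convolution_eq_swap, ContinuousLinearMap.integral_apply]
  · rfl
  · have hi := (hks.fderiv ℝ).convolutionExists_left
      ((ContinuousLinearMap.lsmul ℝ ℝ : ℝ →L[ℝ] E →L[ℝ] E).precompL (Rn n))
      (hk.continuous_fderiv one_ne_zero) hf x
    exact (convolutionExistsAt_iff_integrable_swap).1 hi

/-- For `‖x‖ ≤ R` a kernel vanishing outside the unit ball sees only the values of `f` on the ball
of radius `R + 1`. Hence local integrability suffices. -/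
theorem norm_integral_kernel_le {k : Rn n → ℝ} {C R : ℝ} (hkb : ∀ x, |k x| ≤ C)
    (hk0 : ∀ x, 1 ≤ ‖x‖ → k x = 0) {f : Rn n → E}
    (hf : IntegrableOn f (Metric.closedBall 0 (R + 1))) {x : Rn n} (hx : ‖x‖ ≤ R) :
    ‖∫ y, k (x - y) • f y‖ ≤ C * ∫ y in Metric.closedBall 0 (R + 1), ‖f y‖ := by
  rw [← setIntegral_eq_integral_of_forall_compl_eq_zero
    (s := Metric.closedBall (0 : Rn n) (R + 1)), ← integral_const_mul]
  · refine norm_integral_le_of_norm_le (hf.norm.const_mul C) (Eventually.of_forall fun y => ?_)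
    rw [norm_smul]
    exact mul_le_mul_of_nonneg_right (hkb _) (norm_nonneg _)
  · intro y hy
    rw [Metric.mem_closedBall, dist_zero_right, not_le] at hy
    rw [hk0, zero_smul]
    have := norm_sub_norm_le y x
    rw [norm_sub_rev] at this
    linarith

theorem stronglyMeasurable_integral_kernel {k : Rn n → ℝ} (hk : Continuous k) {f : ℝ → Rn n → E}
    (hf : StronglyMeasurable fun p : ℝ × Rn n => f p.1 p.2) :
    StronglyMeasurable fun p : ℝ × Rn n => ∫ y, k (p.2 - y) • f p.1 y := by
  refine StronglyMeasurable.integral_prod_right (f := fun (p : ℝ × Rn n) y => k (p.2 - y) • f p.1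
      y) ?_
  have h1 : StronglyMeasurable fun q : (ℝ × Rn n) × Rn n => k (q.1.2 - q.2) :=
    (hk.comp (by fun_prop)).stronglyMeasurable
  have h2 : StronglyMeasurable fun q : (ℝ × Rn n) × Rn n => f q.1.1 q.2 :=
    hf.comp_measurable (by fun_prop : Measurable fun q : (ℝ × Rn n) × Rn n => (q.1.1, q.2))
  exact h1.smul h2

end kernel

section gradient

variable {n : ℕ}

/-- The divergence of the mollification of a vector field. -/
noncomputable def divMollify (j : ℕ) (g : Rn n → EuclideanSpace ℂ (Fin n)) (x : Rn n) : ℂ :=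
  ∑ i, ∫ y, fderiv ℝ (mollifier n j) (x - y) (EuclideanSpace.single i 1) • g y i

theorem MeasureTheory.LocallyIntegrable.euclidean_apply {g : Rn n → EuclideanSpace ℂ (Fin n)}
    (hg : LocallyIntegrable g) (i : Fin n) : LocallyIntegrable fun x => g x i := fun x =>
  let ⟨s, hs, h⟩ := hg x
  ⟨s, hs, (EuclideanSpace.proj (𝕜 := ℂ) i : EuclideanSpace ℂ (Fin n) →L[ℂ] ℂ).integrable_comp h⟩

theorem mollify_apply {g : Rn n → EuclideanSpace ℂ (Fin n)} (hg : LocallyIntegrable g) (j : ℕ)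
    (x : Rn n) (i : Fin n) : mollify j g x i = mollify j (fun y => g y i) x :=
  ((EuclideanSpace.proj (𝕜 := ℂ) i : EuclideanSpace ℂ (Fin n) →L[ℂ] ℂ).integral_comp_comm
    (hg.integrable_mollifier_smul j x)).symm

theorem isTestFunction_mollifier_sub (j : ℕ) (x : Rn n) :
    IsTestFunction fun y => mollifier n j (x - y) :=
  ⟨contDiff_mollifier_sub j x, hasCompactSupport_mollifier_sub j x⟩

theorem fderiv_mollifier_sub (j : ℕ) (x y v : Rn n) :
    fderiv ℝ (fun y => mollifier n j (x - y)) y v = -fderiv ℝ (mollifier n j) (x - y) v := by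
  have h := ((contDiff_mollifier n j).differentiable (by norm_num) (x - y)).hasFDerivAt
  have h2 : HasFDerivAt (fun y => x - y) (-ContinuousLinearMap.id ℝ (Rn n)) y :=
    (hasFDerivAt_id y).const_sub x
  have := (h.comp y h2).fderiv
  change fderiv ℝ (mollifier n j ∘ fun y => x - y) y v = _
  rw [this]
  simp

theorem IsTestFunction.fderiv_apply {φ : Rn n → ℝ} (hφ : IsTestFunction φ) (v : Rn n) :
    IsTestFunction fun y => fderiv ℝ φ y v :=
  ⟨(hφ.1.fderiv_right (m := ∞) (by norm_num)).clm_apply contDiff_const,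
    hφ.2.fderiv_apply ℝ v⟩

/-- The derivative falls on the kernel, and testing the weak gradient against the translated
mollifier moves it to `f`. The two signs, from the reflection and from the definition of weak
gradient, cancel. -/
theorem HasWeakGradient.hasFDerivAt_mollify {f : Rn n → ℂ} {g : Rn n → EuclideanSpace ℂ (Fin n)}
    (h : HasWeakGradient f g) (j : ℕ) (x : Rn n) :
    ∃ L : Rn n →L[ℝ] ℂ, HasFDerivAt (mollify j f) L x ∧
      ∀ i, L (EuclideanSpace.single i 1) = mollify j g x i := by
  obtain ⟨L, hL, hLv⟩ := hasFDerivAt_integral_kernel ((contDiff_mollifier n j).of_le (by norm_num))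
    (hasCompactSupport_mollifier n j) h.1 x
  refine ⟨L, hL, fun i => ?_⟩
  rw [hLv, mollify_apply h.2.1]
  have := h.2.2 _ (isTestFunction_mollifier_sub j x) i
  simp_rw [fderiv_mollifier_sub, neg_smul] at this
  rw [integral_neg, neg_inj] at this
  exact this

theorem hasFDerivAt_mollify_apply {g : Rn n → EuclideanSpace ℂ (Fin n)}
    (hg : LocallyIntegrable g) (j : ℕ) (x : Rn n) :
    ∃ L : Fin n → Rn n →L[ℝ] ℂ, (∀ i, HasFDerivAt (fun z => mollify j g z i) (L i) x) ∧
      ∑ i, L i (EuclideanSpace.single i 1) = divMollify j g x := by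
  choose L hL hLv using fun i : Fin n => hasFDerivAt_integral_kernel
    ((contDiff_mollifier n j).of_le (by norm_num))
    (hasCompactSupport_mollifier n j) (hg.euclidean_apply i) x
  refine ⟨L, fun i => ?_, ?_⟩
  · have : (fun z => mollify j g z i) = mollify j (fun y => g y i) := by
      ext z; exact mollify_apply hg j z i
    rw [this]
    exact hL i
  · simp_rw [hLv]
    rfl

theorem laplacian_eq_sum_fderiv {φ : Rn n → ℝ} (hφ : IsTestFunction φ) (y : Rn n) :
    Δ φ y = ∑ i : Fin n, fderiv ℝ (fun z => fderiv ℝ φ z (EuclideanSpace.single i 1)) y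
      (EuclideanSpace.single i 1) := by
  rw [InnerProductSpace.laplacian_eq_iteratedFDeriv_orthonormalBasis φ
    (EuclideanSpace.basisFun (Fin n) ℝ)]
  refine Finset.sum_congr rfl fun i _ => ?_
  rw [iteratedFDeriv_two_apply]
  have hd : DifferentiableAt ℝ (fderiv ℝ φ) y :=
    (hφ.1.fderiv_right (m := ∞) (by norm_num)).differentiable (by norm_num) y
  have h := hd.hasFDerivAt.clm_apply (hasFDerivAt_const (EuclideanSpace.single i (1 : ℝ)) y)
  rw [h.fderiv]
  simp

/-- Only one of the two derivatives is moved onto `f`, since `f` has just one weak derivative. The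
result is in divergence form, ready for integration by parts against the energy weight. -/
theorem HasWeakGradient.integral_laplacian {f : Rn n → ℂ} {g : Rn n → EuclideanSpace ℂ (Fin n)}
    (h : HasWeakGradient f g) (j : ℕ) (x : Rn n) :
    ∫ y, Δ (fun y => mollifier n j (x - y)) y • f y = divMollify j g x := by
  have hφ := isTestFunction_mollifier_sub j x
  simp_rw [laplacian_eq_sum_fderiv hφ, Finset.sum_smul]
  rw [integral_finsetSum]
  · refine Finset.sum_congr rfl fun i _ => ?_
    rw [h.2.2 _ (hφ.fderiv_apply _) i, ← integral_neg]
    refine integral_congr_ae (Eventually.of_forall fun y => ?_)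
    simp only [fderiv_mollifier_sub, neg_smul, neg_neg]
  · intro i _
    have := (hφ.fderiv_apply (EuclideanSpace.single i 1)).fderiv_apply (EuclideanSpace.single i 1)
    exact h.1.integrable_smul_left_of_hasCompactSupport this.1.continuous this.2

end gradient

/-! ### The logarithmic truncation and the pointwise energy inequality. -/

/-- The truncation `k log (1 + s / k)` of the identity on `[0, ∞)`. -/
noncomputable def truncLog (k s : ℝ) : ℝ := k * Real.log (1 + s / k)

theorem hasDerivAt_truncLog {k s : ℝ} (hk : 0 < k) (hs : 0 ≤ s) :
    HasDerivAt (truncLog k) (k / (k + s)) s := by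
  have h1 : HasDerivAt (fun s => 1 + s / k) (1 / k) s := ((hasDerivAt_id s).div_const k).const_add 1
  have h2 : 1 + s / k ≠ 0 := by positivity
  have := (h1.log h2).const_mul k
  convert! this using 1
  field_simp

theorem truncLog_le {k s : ℝ} (hk : 0 < k) (hs : 0 ≤ s) : truncLog k s ≤ s := by
  have h : 0 < 1 + s / k := by positivity
  have := Real.log_le_sub_one_of_pos h
  calc truncLog k s ≤ k * (1 + s / k - 1) := mul_le_mul_of_nonneg_left this hk.le
    _ = s := by field_simp; ring

/-- Concavity and vanishing at `0`. The time derivative of the weight produces `truncLog k s`, while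
integration by parts produces `s` times the derivative `k / (k + s)`. This ordering is what lets the
former absorb the latter. -/
theorem le_truncLog {k s : ℝ} (hk : 0 < k) (hs : 0 ≤ s) : k / (k + s) * s ≤ truncLog k s := by
  have h : 0 < 1 + s / k := by positivity
  have := Real.one_sub_inv_le_log_of_pos h
  calc k / (k + s) * s = k * (1 - (1 + s / k)⁻¹) := by field_simp; ring
    _ ≤ truncLog k s := mul_le_mul_of_nonneg_left this hk.le

theorem truncLog_nonneg {k s : ℝ} (hk : 0 < k) (hs : 0 ≤ s) : 0 ≤ truncLog k s :=
  le_trans (by positivity) (le_truncLog hk hs)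

theorem real_inner_mul_self (c z : ℂ) : inner ℝ z (c * z) = c.re * ‖z‖ ^ 2 := by
  rw [Complex.inner, ← Complex.normSq_eq_norm_sq, Complex.normSq_apply]
  simp only [Complex.mul_re, Complex.mul_im, Complex.conj_re, Complex.conj_im]
  ring

theorem abs_real_inner_mul_le (c w z : ℂ) : |inner ℝ w (c * z)| ≤ ‖c‖ * ‖w‖ * ‖z‖ := by
  refine (abs_real_inner_le_norm _ _).trans_eq ?_
  rw [norm_mul]; ring

/-- One coordinate of the integrated-by-parts density, where `w`, `z`, `p`, `r` stand for `u`,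
`∂ᵢu`, `∂ᵢζ`, `∂ᵢq`, and `ψ`, `b`, `b'` for the exponential weight, the truncation factor and its
derivative in `|w|²`. The three terms on the right come from the gradient hitting the cutoff, the
truncation factor and the exponential. The first two are errors to be removed in the limit, and the
third is what the Riccati equation must pay for. -/
theorem energy_density_coord_le {A b b' κ ζ ψ α P p r : ℝ} {c w z : ℂ} (hA : 0 < A)
    (hc : c.re = A) (hζ : 0 ≤ ζ) (hζ1 : ζ ≤ 1) (hψ : 0 ≤ ψ) (hb : 0 ≤ b) (hb1 : b ≤ 1)
    (hκ : |b'| * ‖w‖ ^ 2 ≤ κ) (hp : |p| ≤ P) :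
    -2 * ((p * ψ * b + ζ * (2 * α * r * ψ) * b + ζ * ψ * (b' * (2 * inner ℝ w z))) *
        inner ℝ w (c * z) + ζ * ψ * b * inner ℝ z (c * z)) ≤
      ‖c‖ * P * ψ * (‖w‖ ^ 2 + ‖z‖ ^ 2) + 4 * ‖c‖ * ψ * κ * ‖z‖ ^ 2 +
        2 * ζ * ψ * b * α ^ 2 * ‖c‖ ^ 2 * ‖w‖ ^ 2 / A * r ^ 2 := by
  rw [real_inner_mul_self, hc]
  set I := inner ℝ w (c * z) with hI
  have hI1 : |I| ≤ ‖c‖ * ‖w‖ * ‖z‖ := abs_real_inner_mul_le c w z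
  have hJ1 : |inner ℝ w z| ≤ ‖w‖ * ‖z‖ := abs_real_inner_le_norm w z
  set J := inner ℝ w z with hJ
  have hP : 0 ≤ P := (abs_nonneg p).trans hp
  have t1 : -2 * (p * ψ * b * I) ≤ ‖c‖ * P * ψ * (‖w‖ ^ 2 + ‖z‖ ^ 2) := by
    have h1 : |p * I| ≤ P * (‖c‖ * ‖w‖ * ‖z‖) := by
      rw [abs_mul]; exact mul_le_mul hp hI1 (abs_nonneg _) hP
    have h2 : -(p * I) ≤ P * (‖c‖ * ‖w‖ * ‖z‖) := (neg_le_abs _).trans h1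
    have h3 : ψ * b ≤ ψ := mul_le_of_le_one_right hψ hb1
    calc -2 * (p * ψ * b * I) = 2 * ((ψ * b) * -(p * I)) := by ring
      _ ≤ 2 * ((ψ * b) * (P * (‖c‖ * ‖w‖ * ‖z‖))) := by gcongr
      _ ≤ 2 * (ψ * (P * (‖c‖ * ‖w‖ * ‖z‖))) := by gcongr
      _ = ‖c‖ * P * ψ * (2 * ‖w‖ * ‖z‖) := by ring
      _ ≤ _ := by gcongr; exact two_mul_le_add_sq _ _
  have t2 : -2 * (ζ * ψ * (b' * (2 * J)) * I) ≤ 4 * ‖c‖ * ψ * κ * ‖z‖ ^ 2 := by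
    have h1 : |b' * J * I| ≤ κ * ‖c‖ * ‖z‖ ^ 2 := by
      rw [abs_mul, abs_mul]
      calc |b'| * |J| * |I| ≤ |b'| * (‖w‖ * ‖z‖) * (‖c‖ * ‖w‖ * ‖z‖) := by gcongr
        _ = (|b'| * ‖w‖ ^ 2) * ‖c‖ * ‖z‖ ^ 2 := by ring
        _ ≤ _ := by gcongr
    have h2 : -(b' * J * I) ≤ κ * ‖c‖ * ‖z‖ ^ 2 := (neg_le_abs _).trans h1
    have h3 : ζ * ψ ≤ ψ := mul_le_of_le_one_left hψ hζ1
    have hκ0 : 0 ≤ κ := le_trans (by positivity) hκ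
    calc -2 * (ζ * ψ * (b' * (2 * J)) * I) = 4 * ((ζ * ψ) * -(b' * J * I)) := by ring
      _ ≤ 4 * ((ζ * ψ) * (κ * ‖c‖ * ‖z‖ ^ 2)) := by gcongr
      _ ≤ 4 * (ψ * (κ * ‖c‖ * ‖z‖ ^ 2)) := by gcongr
      _ = _ := by ring
  have t3 : -2 * (ζ * (2 * α * r * ψ) * b * I + ζ * ψ * b * (A * ‖z‖ ^ 2)) ≤
      2 * ζ * ψ * b * α ^ 2 * ‖c‖ ^ 2 * ‖w‖ ^ 2 / A * r ^ 2 := by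
    have h1 : |α * r * I| ≤ |α * r| * (‖c‖ * ‖w‖ * ‖z‖) := by
      rw [abs_mul (α * r)]; gcongr
    have h2 : -(α * r * I) ≤ |α * r| * (‖c‖ * ‖w‖ * ‖z‖) := (neg_le_abs _).trans h1
    -- Completing the square in `‖z‖`, which uses up the whole dissipation `A‖z‖²`.
    have h3 : 2 * -(α * r * I) - A * ‖z‖ ^ 2 ≤ (α * r) ^ 2 * (‖c‖ * ‖w‖) ^ 2 / A := by
      rw [le_div_iff₀ hA, ← sq_abs (α * r)]
      have e := sq_nonneg (|α * r| * (‖c‖ * ‖w‖) - A * ‖z‖)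
      have := mul_le_mul_of_nonneg_right h2 hA.le
      nlinarith
    have h4 : 0 ≤ 2 * (ζ * ψ * b) := by positivity
    calc _ = 2 * (ζ * ψ * b) * (2 * -(α * r * I) - A * ‖z‖ ^ 2) := by ring
      _ ≤ 2 * (ζ * ψ * b) * ((α * r) ^ 2 * (‖c‖ * ‖w‖) ^ 2 / A) :=
        mul_le_mul_of_nonneg_left h3 h4
      _ = _ := by ring
  linarith

/-- Summing over coordinates turns `∑ r i ^ 2` into at most `4 q`, and the constant `8‖c‖²α²/A` then
matches the Riccati term exactly. The inequality `b‖w‖² ≤ β` lets the truncated density carry the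
cancellation. -/
theorem energy_density_le {n : ℕ} {A b b' β κ ζ ψ α P q : ℝ} {p r : Fin n → ℝ} {c w : ℂ}
    {z : EuclideanSpace ℂ (Fin n)} (hA : 0 < A)
    (hc : c.re = A) (hζ : 0 ≤ ζ) (hζ1 : ζ ≤ 1) (hψ : 0 ≤ ψ) (hb : 0 ≤ b) (hb1 : b ≤ 1)
    (hκ : |b'| * ‖w‖ ^ 2 ≤ κ) (hp : ∀ i, |p i| ≤ P) (hβ : b * ‖w‖ ^ 2 ≤ β)
    (hq : 0 ≤ q) (hr : ∑ i, r i ^ 2 ≤ 4 * q) :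
    2 * (-4 * ‖c‖ ^ 2 / A * α ^ 2) * q * ζ * ψ * β +
      ∑ i, -2 * ((p i * ψ * b + ζ * (2 * α * r i * ψ) * b + ζ * ψ * (b' * (2 * inner ℝ w (z i)))) *
        inner ℝ w (c * z i) + ζ * ψ * b * inner ℝ (z i) (c * z i)) ≤
      ‖c‖ * P * ψ * (n * ‖w‖ ^ 2 + ‖z‖ ^ 2) + 4 * ‖c‖ * ψ * κ * ‖z‖ ^ 2 := by
  have h1 := Finset.sum_le_sum fun i (_ : i ∈ Finset.univ) =>
    energy_density_coord_le (α := α) (r := r i) (z := z i) hA hc hζ hζ1 hψ hb hb1 hκ (hp i)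
  have h0 : ∑ i, (‖c‖ * P * ψ * (‖w‖ ^ 2 + ‖z i‖ ^ 2) + 4 * ‖c‖ * ψ * κ * ‖z i‖ ^ 2 +
        2 * ζ * ψ * b * α ^ 2 * ‖c‖ ^ 2 * ‖w‖ ^ 2 / A * r i ^ 2) =
      ‖c‖ * P * ψ * (n * ‖w‖ ^ 2 + ‖z‖ ^ 2) + 4 * ‖c‖ * ψ * κ * ‖z‖ ^ 2 +
        2 * ζ * ψ * b * α ^ 2 * ‖c‖ ^ 2 * ‖w‖ ^ 2 / A * ∑ i, r i ^ 2 := by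
    rw [Finset.sum_add_distrib, Finset.sum_add_distrib, ← Finset.mul_sum, ← Finset.mul_sum,
      ← Finset.mul_sum, Finset.sum_add_distrib, ← EuclideanSpace.norm_sq_eq, Finset.sum_const,
      Finset.card_univ, Fintype.card_fin, nsmul_eq_mul]
  rw [h0] at h1
  have h2 : 2 * ζ * ψ * b * α ^ 2 * ‖c‖ ^ 2 * ‖w‖ ^ 2 / A * ∑ i, r i ^ 2 ≤
      8 * ‖c‖ ^ 2 / A * α ^ 2 * q * ζ * ψ * β := by
    calc _ ≤ 2 * ζ * ψ * b * α ^ 2 * ‖c‖ ^ 2 * ‖w‖ ^ 2 / A * (4 * q) := by gcongr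
      _ = 8 * ‖c‖ ^ 2 / A * α ^ 2 * q * ζ * ψ * (b * ‖w‖ ^ 2) := by ring
      _ ≤ _ := by gcongr
  have h3 : 2 * (-4 * ‖c‖ ^ 2 / A * α ^ 2) * q * ζ * ψ * β =
    -(8 * ‖c‖ ^ 2 / A * α ^ 2 * q * ζ * ψ * β) := by ring
  linarith

/-! ### Integration by parts in space. -/

section parts

variable {n : ℕ} {k α : ℝ} {ζ q : Rn n → ℝ} {dζ dq : Fin n → Rn n → ℝ}
  {W : Rn n → ℂ} {Z : Rn n → EuclideanSpace ℂ (Fin n)} {dZ : Fin n → Rn n → ℂ}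

/-- The weight `ζ e^{2αq} k / (k + |W|²)` multiplying `W` in the energy identity. -/
noncomputable def energyWeight (k α : ℝ) (ζ q : Rn n → ℝ) (x : Rn n) (w : ℂ) : ℝ :=
  ζ x * Real.exp (2 * α * q x) * (k / (k + ‖w‖ ^ 2))

theorem continuous_energyWeight (hk : 0 < k) (hζ : Continuous ζ) (hq : Continuous q) :
    Continuous fun y : Rn n × ℂ => energyWeight k α ζ q y.1 y.2 := by
  unfold energyWeight
  have : ∀ y : Rn n × ℂ, k + ‖y.2‖ ^ 2 ≠ 0 := fun y => by positivity
  fun_prop (disch := assumption)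

theorem hasLineDerivAt_energyWeight (hk : 0 < k) {x v : Rn n} {ζ' q' : ℝ} {W' : ℂ}
    (hζ : HasLineDerivAt ℝ ζ ζ' x v) (hq : HasLineDerivAt ℝ q q' x v)
    (hW : HasLineDerivAt ℝ W W' x v) :
    HasLineDerivAt ℝ (fun x => energyWeight k α ζ q x (W x))
      (ζ' * Real.exp (2 * α * q x) * (k / (k + ‖W x‖ ^ 2)) +
        ζ x * (2 * α * q' * Real.exp (2 * α * q x)) * (k / (k + ‖W x‖ ^ 2)) +
        ζ x * Real.exp (2 * α * q x) *
          (-k / (k + ‖W x‖ ^ 2) ^ 2 * (2 * inner ℝ (W x) W'))) x v := by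
  unfold HasLineDerivAt at *
  have e0 : x + (0 : ℝ) • v = x := by simp
  have h1 := (hq.const_mul (2 * α)).exp
  have h2 := hW.norm_sq.const_add k
  have hne : k + ‖W (x + (0 : ℝ) • v)‖ ^ 2 ≠ 0 := by positivity
  have h3 := (hasDerivAt_const (0 : ℝ) k).fun_div h2 hne
  have h4 := (hζ.fun_mul h1).fun_mul h3
  rw [e0] at h4
  refine h4.congr_deriv ?_
  ring

/-- Integration by parts in direction `i`, with no boundary term because the cutoff has compact
support. `D` is the inner product of the derivative of `energyWeight • W` with `c * Z i`, expanded
by the product rule. -/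
theorem integral_energyWeight_inner_divergence (hk : 0 < k) (c : ℂ)
    (hζ : Continuous ζ) (hζs : HasCompactSupport ζ) (hq : Continuous q)
    (hdζ : ∀ i, Continuous (dζ i)) (hdq : ∀ i, Continuous (dq i))
    (hζd : ∀ i x, HasLineDerivAt ℝ ζ (dζ i x) x (EuclideanSpace.single i 1))
    (hqd : ∀ i x, HasLineDerivAt ℝ q (dq i x) x (EuclideanSpace.single i 1))
    (hW : Continuous W) (hZ : Continuous Z) (hdZ : ∀ i, Continuous (dZ i))
    (hWd : ∀ i x, HasLineDerivAt ℝ W (Z x i) x (EuclideanSpace.single i 1))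
    (hZd : ∀ i x, HasLineDerivAt ℝ (fun x => Z x i) (dZ i x) x (EuclideanSpace.single i 1))
    (i : Fin n) :
    let D : Rn n → ℝ := fun x =>
      (dζ i x * Real.exp (2 * α * q x) * (k / (k + ‖W x‖ ^ 2)) +
        ζ x * (2 * α * dq i x * Real.exp (2 * α * q x)) * (k / (k + ‖W x‖ ^ 2)) +
        ζ x * Real.exp (2 * α * q x) *
          (-k / (k + ‖W x‖ ^ 2) ^ 2 * (2 * inner ℝ (W x) (Z x i)))) * inner ℝ (W x) (c * Z x i) +
        energyWeight k α ζ q x (W x) * inner ℝ (Z x i) (c * Z x i)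
    Integrable D ∧ Integrable (fun x => energyWeight k α ζ q x (W x) * inner ℝ (W x) (c * dZ i x)) ∧
      ∫ x, energyWeight k α ζ q x (W x) * inner ℝ (W x) (c * dZ i x) = -∫ x, D x := by
  intro D
  have hθ : Continuous fun x => energyWeight k α ζ q x (W x) :=
    (continuous_energyWeight hk hζ hq).comp (continuous_id.prodMk hW)
  have hZi : Continuous fun x => Z x i := by fun_prop
  have hne : ∀ x, k + ‖W x‖ ^ 2 ≠ 0 := fun x => by positivity
  have hne2 : ∀ x, (k + ‖W x‖ ^ 2) ^ 2 ≠ 0 := fun x => by positivity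
  set dθ : Rn n → ℝ := fun x => dζ i x * Real.exp (2 * α * q x) * (k / (k + ‖W x‖ ^ 2)) +
        ζ x * (2 * α * dq i x * Real.exp (2 * α * q x)) * (k / (k + ‖W x‖ ^ 2)) +
        ζ x * Real.exp (2 * α * q x) *
          (-k / (k + ‖W x‖ ^ 2) ^ 2 * (2 * inner ℝ (W x) (Z x i))) with hdθ
  have hdθc : Continuous dθ := by
    have := hdζ i; have := hdq i
    have : Continuous fun x => inner ℝ (W x) (Z x i) := hW.inner hZi
    fun_prop (disch := assumption)
  have hθz : ∀ x ∉ tsupport ζ, energyWeight k α ζ q x (W x) = 0 := fun x hx => by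
    simp [energyWeight, image_eq_zero_of_notMem_tsupport hx]
  -- `dζ` is a given function rather than `fderiv`, so its vanishing off the support comes from
  -- uniqueness of line derivatives.
  have hdζz : ∀ x ∉ tsupport ζ, dζ i x = 0 := fun x hx => by
    have h1 : ζ =ᶠ[𝓝 x] fun _ => 0 := notMem_tsupport_iff_eventuallyEq.1 hx
    have h2 : HasLineDerivAt ℝ ζ 0 x (EuclideanSpace.single i 1) :=
      ((hasFDerivAt_const (0 : ℝ) x).congr_of_eventuallyEq h1).hasLineDerivAt _
    exact (hζd i x).unique h2
  have hdθz : ∀ x ∉ tsupport ζ, dθ x = 0 := fun x hx => by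
    simp [hdθ, hdζz x hx, image_eq_zero_of_notMem_tsupport hx]
  have hint : ∀ F : Rn n → ℝ, Continuous F → (∀ x ∉ tsupport ζ, F x = 0) → Integrable F :=
    fun F hF hz => hF.integrable_of_hasCompactSupport (HasCompactSupport.intro hζs hz)
  have hD : D = fun x => inner ℝ (dθ x • W x + energyWeight k α ζ q x (W x) • Z x i)
      (c * Z x i) := by
    ext x
    rw [inner_add_left, real_inner_smul_left, real_inner_smul_left]
  have e1 : (fun x => energyWeight k α ζ q x (W x) * inner ℝ (W x) (c * dZ i x)) = fun x =>
      inner ℝ (energyWeight k α ζ q x (W x) • W x) (c * dZ i x) := by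
    ext x; rw [real_inner_smul_left]
  have j1 : Integrable D := by
    refine hint _ ?_ fun x hx => ?_
    · rw [hD]
      exact ((hdθc.smul hW).add (hθ.smul hZi)).inner (continuous_const.mul hZi)
    · rw [hD]; simp [hdθz x hx, hθz x hx]
  have j2 : Integrable (fun x => energyWeight k α ζ q x (W x) * inner ℝ (W x) (c * dZ i x)) :=
    hint _ (hθ.mul (hW.inner (continuous_const.mul (hdZ i)))) fun x hx => by simp [hθz x hx]
  have j3 : Integrable (fun x => inner ℝ (energyWeight k α ζ q x (W x) • W x) (c * Z x i)) :=
    hint _ ((hθ.smul hW).inner (continuous_const.mul hZi)) fun x hx => by simp [hθz x hx]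
  refine ⟨j1, j2, ?_⟩
  rw [e1, hD]
  have := integral_bilinear_hasLineDerivAt_right_eq_neg_left_of_integrable (μ := volume)
    (f := fun x => energyWeight k α ζ q x (W x) • W x)
    (f' := fun x => dθ x • W x + energyWeight k α ζ q x (W x) • Z x i)
    (g := fun x => c * Z x i) (g' := fun x => c * dZ i x) (v := EuclideanSpace.single i 1)
    (B := innerSL ℝ (E := ℂ)) (hD ▸ j1) (e1 ▸ j2) j3 ?_ ?_
  · exact this
  · intro x _
    have h1 : HasLineDerivAt ℝ (fun x => energyWeight k α ζ q x (W x)) (dθ x) x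
        (EuclideanSpace.single i 1) :=
      hasLineDerivAt_energyWeight hk (hζd i x) (hqd i x) (hWd i x)
    have h2 := hWd i x
    unfold HasLineDerivAt at *
    have h3 := h1.fun_smul h2
    simp only [zero_smul, add_zero] at h3
    refine h3.congr_deriv ?_
    rw [add_comm]
  · intro x _
    have h2 := hZd i x
    unfold HasLineDerivAt at *
    exact h2.const_mul c

/-- The spatial energy inequality at a fixed time. -/
theorem integral_energy_le (hk : 0 < k) {A P Q : ℝ} {c : ℂ} (hA : 0 < A) (hc : c.re = A)
    (hζ : Continuous ζ) (hζs : HasCompactSupport ζ) (hζ0 : ∀ x, 0 ≤ ζ x) (hζ1 : ∀ x, ζ x ≤ 1)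
    (hq : Continuous q) (hq0 : ∀ x, 0 ≤ q x)
    (hdζ : ∀ i, Continuous (dζ i)) (hdq : ∀ i, Continuous (dq i))
    (hζd : ∀ i x, HasLineDerivAt ℝ ζ (dζ i x) x (EuclideanSpace.single i 1))
    (hqd : ∀ i x, HasLineDerivAt ℝ q (dq i x) x (EuclideanSpace.single i 1))
    (hP : ∀ i x, |dζ i x| ≤ P) (hP0 : 0 ≤ P) (hdq4 : ∀ x, ∑ i, dq i x ^ 2 ≤ 4 * q x)
    (hQ : ∀ x, Real.exp (2 * α * q x) ≤ Q)
    (hW : Continuous W) (hZ : Continuous Z) (hdZ : ∀ i, Continuous (dZ i))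
    (hWd : ∀ i x, HasLineDerivAt ℝ W (Z x i) x (EuclideanSpace.single i 1))
    (hZd : ∀ i x, HasLineDerivAt ℝ (fun x => Z x i) (dZ i x) x (EuclideanSpace.single i 1))
    {h : Rn n → ℂ} (hh : Continuous h)
    (hint : Integrable fun x => ‖c‖ * P * Q * (n * ‖W x‖ ^ 2 + ‖Z x‖ ^ 2) +
      4 * ‖c‖ * Q * (‖W x‖ ^ 2 / (k + ‖W x‖ ^ 2)) * ‖Z x‖ ^ 2 +
      2 * (energyWeight k α ζ q x (W x) * inner ℝ (W x) (c * h x))) :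
    ∫ x, (2 * (-4 * ‖c‖ ^ 2 / A * α ^ 2) * q x * ζ x * Real.exp (2 * α * q x) *
        truncLog k (‖W x‖ ^ 2) +
        2 * (energyWeight k α ζ q x (W x) * inner ℝ (W x) (c * (∑ i, dZ i x + h x)))) ≤
      ∫ x, (‖c‖ * P * Q * (n * ‖W x‖ ^ 2 + ‖Z x‖ ^ 2) +
      4 * ‖c‖ * Q * (‖W x‖ ^ 2 / (k + ‖W x‖ ^ 2)) * ‖Z x‖ ^ 2 +
      2 * (energyWeight k α ζ q x (W x) * inner ℝ (W x) (c * h x))) := by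
  have hθ : Continuous fun x => energyWeight k α ζ q x (W x) :=
    (continuous_energyWeight hk hζ hq).comp (continuous_id.prodMk hW)
  have hcs : ∀ F : Rn n → ℝ, Continuous F → (∀ x ∉ tsupport ζ, F x = 0) → Integrable F :=
    fun F hF hz => hF.integrable_of_hasCompactSupport (HasCompactSupport.intro hζs hz)
  have hlog : Continuous fun x => truncLog k (‖W x‖ ^ 2) := by
    unfold truncLog
    have : ∀ x, 1 + ‖W x‖ ^ 2 / k ≠ 0 := fun x => by positivity
    fun_prop (disch := assumption)
  have hparts := fun i => integral_energyWeight_inner_divergence (α := α) hk c hζ hζs hq hdζ hdq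
    hζd hqd hW hZ hdZ hWd hZd i
  set D : Fin n → Rn n → ℝ := fun i x =>
      (dζ i x * Real.exp (2 * α * q x) * (k / (k + ‖W x‖ ^ 2)) +
        ζ x * (2 * α * dq i x * Real.exp (2 * α * q x)) * (k / (k + ‖W x‖ ^ 2)) +
        ζ x * Real.exp (2 * α * q x) *
          (-k / (k + ‖W x‖ ^ 2) ^ 2 * (2 * inner ℝ (W x) (Z x i)))) * inner ℝ (W x) (c * Z x i) +
        energyWeight k α ζ q x (W x) * inner ℝ (Z x i) (c * Z x i) with hD
  set G : Rn n → ℝ := fun x => 2 * (-4 * ‖c‖ ^ 2 / A * α ^ 2) * q x * ζ x *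
    Real.exp (2 * α * q x) * truncLog k (‖W x‖ ^ 2) with hG
  set H : Rn n → ℝ := fun x => 2 * (energyWeight k α ζ q x (W x) * inner ℝ (W x) (c * h x)) with hH
  have iG : Integrable G := hcs _ (by fun_prop) fun x hx => by
    simp [hG, image_eq_zero_of_notMem_tsupport hx]
  have iH : Integrable H := hcs _
    (continuous_const.mul (hθ.mul (hW.inner (continuous_const.mul hh)))) fun x hx => by
    simp [hH, energyWeight, image_eq_zero_of_notMem_tsupport hx]
  have iS : Integrable fun x => ∑ i, 2 *
      (energyWeight k α ζ q x (W x) * inner ℝ (W x) (c * dZ i x)) :=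
    integrable_finsetSum _ fun i _ => (hparts i).2.1.const_mul 2
  have iD : Integrable fun x => ∑ i, -2 * D i x :=
    integrable_finsetSum _ fun i _ => (hparts i).1.const_mul (-2)
  have e1 : ∫ x, (G x + 2 * (energyWeight k α ζ q x (W x) *
      inner ℝ (W x) (c * (∑ i, dZ i x + h x)))) = ∫ x, (G x + ∑ i, -2 * D i x + H x) := by
    have : (fun x => G x + 2 * (energyWeight k α ζ q x (W x) *
      inner ℝ (W x) (c * (∑ i, dZ i x + h x)))) = fun x => G x + (∑ i, 2 *
      (energyWeight k α ζ q x (W x) * inner ℝ (W x) (c * dZ i x))) + H x := by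
      ext x
      rw [mul_add, inner_add_right, Finset.mul_sum, inner_sum, mul_add, Finset.mul_sum, mul_add,
        Finset.mul_sum]
      ring
    rw [this, integral_add_three iG iS iH, integral_add_three iG iD iH]
    congr 2
    rw [integral_finsetSum _ fun i _ => (hparts i).2.1.const_mul 2,
      integral_finsetSum _ fun i _ => (hparts i).1.const_mul (-2)]
    refine Finset.sum_congr rfl fun i _ => ?_
    rw [integral_const_mul, integral_const_mul, (hparts i).2.2]
    ring
  rw [e1]
  refine integral_mono ((iG.add iD).add iH) hint fun x => ?_
  have hk2 : 0 < k + ‖W x‖ ^ 2 := by positivity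
  have key := energy_density_le (A := A) (b := k / (k + ‖W x‖ ^ 2))
    (b' := -k / (k + ‖W x‖ ^ 2) ^ 2) (β := truncLog k (‖W x‖ ^ 2))
    (κ := ‖W x‖ ^ 2 / (k + ‖W x‖ ^ 2)) (ζ := ζ x) (ψ := Real.exp (2 * α * q x)) (α := α) (P := P)
    (q := q x) (p := fun i => dζ i x) (r := fun i => dq i x) (c := c) (w := W x) (z := Z x)
    hA hc (hζ0 x) (hζ1 x) (Real.exp_pos _).le (by positivity)
    ((div_le_one hk2).2 (by linarith [sq_nonneg ‖W x‖])) ?_ (fun i => hP i x)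
    (le_truncLog hk (by positivity)) (hq0 x) (hdq4 x)
  · have b1 : ‖c‖ * P * Real.exp (2 * α * q x) * (n * ‖W x‖ ^ 2 + ‖Z x‖ ^ 2) +
        4 * ‖c‖ * Real.exp (2 * α * q x) * (‖W x‖ ^ 2 / (k + ‖W x‖ ^ 2)) * ‖Z x‖ ^ 2 ≤
        ‖c‖ * P * Q * (n * ‖W x‖ ^ 2 + ‖Z x‖ ^ 2) +
        4 * ‖c‖ * Q * (‖W x‖ ^ 2 / (k + ‖W x‖ ^ 2)) * ‖Z x‖ ^ 2 := by
      have := hQ x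
      gcongr
    exact add_le_add (key.trans b1) le_rfl
  -- The derivative of the truncation factor satisfies `|b'|‖W‖² = k‖W‖²/(k+‖W‖²)² ≤ ‖W‖²/(k+‖W‖²)`.
  -- This error factor is at most `1` and vanishes pointwise as `k → ∞`.
  · rw [abs_div, abs_neg, abs_of_pos hk, abs_of_pos (by positivity), div_mul_eq_mul_div,
      div_le_div_iff₀ (by positivity) hk2]
    have h1 : k ≤ k + ‖W x‖ ^ 2 := by linarith [sq_nonneg ‖W x‖]
    calc k * ‖W x‖ ^ 2 * (k + ‖W x‖ ^ 2) ≤ (k + ‖W x‖ ^ 2) * ‖W x‖ ^ 2 * (k + ‖W x‖ ^ 2) := by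
          gcongr
      _ = _ := by ring

end parts

/-- Chain rule for a primitive composed with a `C¹` function. -/
theorem sub_eq_integral_of_contDiff_comp_primitive {E : Type*} [NormedAddCommGroup E]
    [NormedSpace ℝ E] [CompleteSpace E] [ProperSpace E] {f : E → ℝ} (hf : ContDiff ℝ 1 f)
    {a b : ℝ} {h X : ℝ → E} (hh : IntervalIntegrable h volume a b)
    (hX : ∀ t ∈ uIcc a b, X t = X a + ∫ s in a..t, h s) :
    f (X b) - f (X a) = ∫ s in a..b, fderiv ℝ f (X s) (h s) := by
  have hc : ContinuousOn X (uIcc a b) :=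
    (continuousOn_const.add (intervalIntegral.continuousOn_primitive_interval' hh
      left_mem_uIcc)).congr hX
  obtain ⟨r, hr⟩ := (isCompact_uIcc.image_of_continuousOn hc).isBounded.subset_closedBall (0 : E)
  obtain ⟨K, hK⟩ := hf.contDiffOn.exists_lipschitzOnWith (by decide)
    (convex_closedBall (0 : E) r) (isCompact_closedBall _ _)
  exact sub_eq_integral_of_comp_primitive hK hh hX (fun t ht => hr (mem_image_of_mem X ht))
    fun t _ => (hf.differentiable (by decide) _).hasFDerivAt

/-! ### Measurable representatives and the mollified equation. -/

/-- A weak solution `U` of `∂ₜU = c (ΔU + H)`, together with jointly measurable representatives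
`u`, `g`, `H` of the solution, its gradient and the right-hand side. -/
structure MeasurableSolution {n : ℕ} (c : ℂ) (U u : ℝ → Rn n → ℂ)
    (g : ℝ → Rn n → EuclideanSpace ℂ (Fin n)) (H : ℝ → Rn n → ℂ) : Prop where
  meas_u : StronglyMeasurable fun p : ℝ × Rn n => u p.1 p.2
  meas_g : StronglyMeasurable fun p : ℝ × Rn n => g p.1 p.2
  meas_H : StronglyMeasurable fun p : ℝ × Rn n => H p.1 p.2
  memLp : ∀ t ∈ Icc (0 : ℝ) 1, MemLp (U t) 2
  ae_eq : ∀ᵐ s ∂volume.restrict (Icc (0 : ℝ) 1), U s =ᵐ[volume] u s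
  grad : ∀ᵐ s ∂volume.restrict (Icc (0 : ℝ) 1), HasWeakGradient (u s) (g s)
  sq_u : MemLp (fun p : ℝ × Rn n => u p.1 p.2) 2 ((volume.restrict (Icc (0 : ℝ) 1)).prod volume)
  sq_g : MemLp (fun p : ℝ × Rn n => g p.1 p.2) 2 ((volume.restrict (Icc (0 : ℝ) 1)).prod volume)
  int_H : ∀ R : ℝ, Integrable (fun p : ℝ × Rn n => H p.1 p.2)
    ((volume.restrict (Icc (0 : ℝ) 1)).prod (volume.restrict (Metric.closedBall 0 R)))
  equation : ∀ φ : Rn n → ℝ, IsTestFunction φ → ∀ t ∈ Icc (0 : ℝ) 1,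
    (∫ x, φ x • U t x) - ∫ x, φ x • U 0 x =
      c * ∫ s in (0 : ℝ)..t, ∫ x, (Δ φ x • u s x + φ x • H s x)

theorem exists_bound_mollifier (n j : ℕ) : ∃ C : ℝ, 0 ≤ C ∧ (∀ x, |mollifier n j x| ≤ C) ∧
    ∀ (i : Fin n) x, |fderiv ℝ (mollifier n j) x (EuclideanSpace.single i 1)| ≤ C := by
  have hd : Continuous (fderiv ℝ (mollifier n j)) :=
    (contDiff_mollifier n j).continuous_fderiv (by norm_num)
  obtain ⟨C₁, h₁⟩ := (contDiff_mollifier n j).continuous.bounded_above_of_compact_support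
    (hasCompactSupport_mollifier n j)
  obtain ⟨C₂, h₂⟩ := hd.bounded_above_of_compact_support ((hasCompactSupport_mollifier n j).fderiv
      ℝ)
  refine ⟨max C₁ C₂, ((norm_nonneg _).trans (h₁ 0)).trans (le_max_left _ _),
    fun x => (h₁ x).trans (le_max_left _ _), fun i x => ?_⟩
  refine ((fderiv ℝ (mollifier n j) x).le_opNorm _).trans ?_
  rw [PiLp.norm_single, norm_one, mul_one]
  exact (h₂ x).trans (le_max_right _ _)

theorem norm_mollify_le_setIntegral {n j : ℕ} {E : Type*} [NormedAddCommGroup E] [NormedSpace ℝ E]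
    {C R : ℝ} (hC : ∀ x, |mollifier n j x| ≤ C) {f : Rn n → E}
    (hf : IntegrableOn f (Metric.closedBall 0 (R + 1))) {x : Rn n} (hx : ‖x‖ ≤ R) :
    ‖mollify j f x‖ ≤ C * ∫ y in Metric.closedBall 0 (R + 1), ‖f y‖ :=
  norm_integral_kernel_le hC (fun _ h => mollifier_eq_zero h) hf hx

theorem norm_divMollify_le_setIntegral {n j : ℕ} {C R : ℝ}
    (hC : ∀ (i : Fin n) x, |fderiv ℝ (mollifier n j) x (EuclideanSpace.single i 1)| ≤ C)
    (hC0 : 0 ≤ C) {g : Rn n → EuclideanSpace ℂ (Fin n)}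
    (hg : IntegrableOn g (Metric.closedBall 0 (R + 1))) {x : Rn n} (hx : ‖x‖ ≤ R) :
    ‖divMollify j g x‖ ≤ n * (C * ∫ y in Metric.closedBall 0 (R + 1), ‖g y‖) := by
  -- A zero of a nonnegative function is a minimum, so the derivative vanishes there. This covers
  -- the boundary sphere as well as its exterior.
  have hz : ∀ (i : Fin n) (x : Rn n), 1 ≤ ‖x‖ →
      fderiv ℝ (mollifier n j) x (EuclideanSpace.single i 1) = 0 := fun i x hx => by
    have hmin : IsLocalMin (mollifier n j) x := Eventually.of_forall fun y => by
      rw [mollifier_eq_zero hx]; exact mollifier_nonneg n j y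
    rw [hmin.fderiv_eq_zero]; rfl
  unfold divMollify
  refine (norm_sum_le _ _).trans ((Finset.sum_le_card_nsmul _ _
    (C * ∫ y in Metric.closedBall 0 (R + 1), ‖g y‖) fun i _ => ?_).trans_eq (by simp))
  have hgi : IntegrableOn (fun y => g y i) (Metric.closedBall 0 (R + 1)) :=
    (EuclideanSpace.proj (𝕜 := ℂ) i : EuclideanSpace ℂ (Fin n) →L[ℂ] ℂ).integrable_comp hg
  refine (norm_integral_kernel_le (hC i) (hz i) hgi hx).trans ?_
  exact mul_le_mul_of_nonneg_left (integral_mono hgi.norm hg.norm fun y =>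
    PiLp.norm_apply_le (g y) i) hC0

namespace MeasurableSolution

variable {n : ℕ} {c : ℂ} {U u : ℝ → Rn n → ℂ} {g : ℝ → Rn n → EuclideanSpace ℂ (Fin n)}
  {H : ℝ → Rn n → ℂ}

theorem stronglyMeasurable_section {E : Type*} [TopologicalSpace E]
    {f : ℝ → Rn n → E} (hf : StronglyMeasurable fun p : ℝ × Rn n => f p.1 p.2) (s : ℝ) :
    StronglyMeasurable (f s) :=
  hf.comp_measurable (measurable_prodMk_left (x := s))

theorem ae_memLp {E : Type*} [NormedAddCommGroup E] {f : ℝ → Rn n → E}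
    (hf : StronglyMeasurable fun p : ℝ × Rn n => f p.1 p.2) {ν : Measure ℝ} [SFinite ν]
    (h2 : MemLp (fun p : ℝ × Rn n => f p.1 p.2) 2 (ν.prod volume)) :
    ∀ᵐ s ∂ν, MemLp (f s) 2 := by
  filter_upwards [((memLp_two_iff_integrable_sq_norm h2.1).1 h2).prod_right_ae] with s hs
  exact (memLp_two_iff_integrable_sq_norm
    (stronglyMeasurable_section hf s).aestronglyMeasurable).2 hs

theorem integrable_integral_sq {E : Type*} [NormedAddCommGroup E] {f : ℝ → Rn n → E}
    {ν : Measure ℝ} [SFinite ν]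
    (h2 : MemLp (fun p : ℝ × Rn n => f p.1 p.2) 2 (ν.prod volume)) :
    Integrable (fun s => ∫ x, ‖f s x‖ ^ 2) ν :=
  ((memLp_two_iff_integrable_sq_norm h2.1).1 h2).integral_prod_left

theorem integrable_prod_closedBall {E : Type*} [NormedAddCommGroup E] {f : ℝ → Rn n → E}
    {ν : Measure ℝ} [IsFiniteMeasure ν]
    (h2 : MemLp (fun p : ℝ × Rn n => f p.1 p.2) 2 (ν.prod volume)) (R : ℝ) :
    Integrable (fun p : ℝ × Rn n => f p.1 p.2)
      (ν.prod (volume.restrict (Metric.closedBall 0 R))) := by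
  have : IsFiniteMeasure (volume.restrict (Metric.closedBall (0 : Rn n) R)) :=
    ⟨by simpa using measure_closedBall_lt_top⟩
  refine (h2.mono_measure ?_).integrable (by norm_num)
  exact Measure.prod_mono le_rfl Measure.restrict_le_self

theorem ae_locallyIntegrable (S : MeasurableSolution c U u g H) :
    ∀ᵐ s ∂volume.restrict (Icc (0 : ℝ) 1), LocallyIntegrable (H s) := by
  have : ∀ᵐ s ∂volume.restrict (Icc (0 : ℝ) 1), ∀ N : ℕ,
      IntegrableOn (H s) (Metric.closedBall 0 (N : ℝ)) :=
    ae_all_iff.2 fun N => (S.int_H N).prod_right_ae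
  filter_upwards [this] with s hs x
  obtain ⟨N, hN⟩ := exists_nat_gt ‖x‖
  refine ⟨Metric.closedBall 0 (N : ℝ), ?_, hs N⟩
  exact Filter.mem_of_superset (Metric.isOpen_ball.mem_nhds (by simpa using hN))
    Metric.ball_subset_closedBall

theorem stronglyMeasurable_mollify {E : Type*} [NormedAddCommGroup E] [NormedSpace ℝ E]
    {f : ℝ → Rn n → E} (hf : StronglyMeasurable fun p : ℝ × Rn n => f p.1 p.2) (j : ℕ) :
    StronglyMeasurable fun p : ℝ × Rn n => mollify j (f p.1) p.2 :=
  stronglyMeasurable_integral_kernel (contDiff_mollifier n j).continuous hf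

theorem stronglyMeasurable_divMollify
    (hg : StronglyMeasurable fun p : ℝ × Rn n => g p.1 p.2) (j : ℕ) :
    StronglyMeasurable fun p : ℝ × Rn n => divMollify j (g p.1) p.2 := by
  unfold divMollify
  refine Finset.stronglyMeasurable_fun_sum _ fun i _ => ?_
  refine stronglyMeasurable_integral_kernel
    (k := fun z => fderiv ℝ (mollifier n j) z (EuclideanSpace.single i 1))
    (f := fun s y => g s y i) ?_ ?_
  · exact ((contDiff_mollifier n j).continuous_fderiv (by norm_num)).clm_apply continuous_const
  · exact (EuclideanSpace.proj (𝕜 := ℂ) i :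
      EuclideanSpace ℂ (Fin n) →L[ℂ] ℂ).continuous.comp_stronglyMeasurable hg

/-- The right-hand side of the mollified equation. -/
theorem exists_bound_rhs (S : MeasurableSolution c U u g H) (j : ℕ) (R : ℝ) :
    ∃ b : ℝ → ℝ, Integrable b (volume.restrict (Icc (0 : ℝ) 1)) ∧
      (∀ᵐ s ∂volume.restrict (Icc (0 : ℝ) 1), ∀ x, ‖x‖ ≤ R →
        ‖divMollify j (g s) x + mollify j (H s) x‖ ≤ b s ∧ ‖mollify j (u s) x‖ ^ 2 ≤ b s) ∧
      ∀ s, 0 ≤ b s := by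
  obtain ⟨C, hC0, hC1, hC2⟩ := exists_bound_mollifier n j
  have ig := integrable_prod_closedBall S.sq_g (R + 1)
  refine ⟨fun s => n * (C * ∫ y in Metric.closedBall 0 (R + 1), ‖g s y‖) +
    C * (∫ y in Metric.closedBall 0 (R + 1), ‖H s y‖) + C * ∫ y, ‖u s y‖ ^ 2, ?_, ?_, ?_⟩
  · exact (((ig.norm.integral_prod_left.const_mul C).const_mul (n : ℝ)).add
      ((S.int_H (R + 1)).norm.integral_prod_left.const_mul C)).add
      ((integrable_integral_sq S.sq_u).const_mul C)
  · filter_upwards [ig.prod_right_ae, (S.int_H (R + 1)).prod_right_ae, ae_memLp S.meas_u S.sq_u]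
      with s h1 h2 h3 x hx
    have e1 := norm_divMollify_le_setIntegral hC2 hC0 h1 hx
    have e2 := norm_mollify_le_setIntegral hC1 h2 hx
    have p1 : 0 ≤ n * (C * ∫ y in Metric.closedBall 0 (R + 1), ‖g s y‖) := (norm_nonneg _).trans e1
    have p2 : 0 ≤ C * ∫ y in Metric.closedBall 0 (R + 1), ‖H s y‖ := (norm_nonneg _).trans e2
    have p3 : 0 ≤ C * ∫ y, ‖u s y‖ ^ 2 :=
      mul_nonneg hC0 (integral_nonneg fun y => sq_nonneg _)
    refine ⟨(norm_add_le _ _).trans (by linarith), ?_⟩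
    have i3 := h3.integrable_norm_sq
    have e3 := norm_mollify_sq_le j (h3.locallyIntegrable (by norm_num)) i3.locallyIntegrable x
    have e4 : mollify j (fun y => ‖u s y‖ ^ 2) x ≤ C * ∫ y, ‖u s y‖ ^ 2 := by
      rw [← integral_const_mul]
      refine integral_mono (i3.locallyIntegrable.integrable_mollifier_smul j x)
        (i3.const_mul C) fun y => ?_
      exact mul_le_mul_of_nonneg_right ((le_abs_self _).trans (hC1 _)) (sq_nonneg _)
    linarith
  · intro s
    have p1 : 0 ≤ ∫ y in Metric.closedBall 0 (R + 1), ‖g s y‖ :=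
      integral_nonneg fun y => norm_nonneg _
    have p2 : 0 ≤ ∫ y in Metric.closedBall 0 (R + 1), ‖H s y‖ :=
      integral_nonneg fun y => norm_nonneg _
    have p3 : 0 ≤ ∫ y, ‖u s y‖ ^ 2 := integral_nonneg fun y => sq_nonneg _
    positivity

theorem stronglyMeasurable_rhs (S : MeasurableSolution c U u g H) (j : ℕ) :
    StronglyMeasurable fun p : ℝ × Rn n => divMollify j (g p.1) p.2 + mollify j (H p.1) p.2 :=
  (stronglyMeasurable_divMollify S.meas_g j).add (stronglyMeasurable_mollify S.meas_H j)

theorem intervalIntegrable_rhs (S : MeasurableSolution c U u g H) (j : ℕ) (x : Rn n) :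
    IntervalIntegrable (fun s => divMollify j (g s) x + mollify j (H s) x) volume 0 1 := by
  rw [intervalIntegrable_iff_integrableOn_Icc_of_le zero_le_one]
  obtain ⟨b, hb, hle, -⟩ := S.exists_bound_rhs j ‖x‖
  refine hb.mono' ?_ ?_
  · exact ((S.stronglyMeasurable_rhs j).comp_measurable
      (measurable_prodMk_right (y := x))).aestronglyMeasurable
  · filter_upwards [hle] with s hs using (hs x le_rfl).1

theorem continuous_laplacian {φ : Rn n → ℝ} (hφ : IsTestFunction φ) : Continuous (Δ φ) := by
  rw [show Δ φ = _ from funext (laplacian_eq_sum_fderiv hφ)]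
  exact continuous_finsetSum _ fun i _ => ((hφ.fderiv_apply _).fderiv_apply _).1.continuous

theorem hasCompactSupport_laplacian {φ : Rn n → ℝ} (hφ : IsTestFunction φ) :
    HasCompactSupport (Δ φ) := by
  refine HasCompactSupport.intro hφ.2 fun y hy => ?_
  rw [laplacian_eq_sum_fderiv hφ]
  refine Finset.sum_eq_zero fun i _ => image_eq_zero_of_notMem_tsupport
    (f := fun y => fderiv ℝ (fun z => fderiv ℝ φ z (EuclideanSpace.single i 1)) y
      (EuclideanSpace.single i 1)) fun hy2 => hy ?_
  exact (tsupport_fderiv_apply_subset ℝ _).trans (tsupport_fderiv_apply_subset ℝ _) hy2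

/-- Testing the equation with the mollifier centred at `x` makes the mollified solution, at each
fixed `x`, a primitive in time of an integrable function. The chain rule can then be used pointwise.
-/
theorem mollify_eq_add_integral (S : MeasurableSolution c U u g H) (j : ℕ) (x : Rn n) {t : ℝ}
    (ht : t ∈ Icc (0 : ℝ) 1) :
    mollify j (U t) x = mollify j (U 0) x +
      ∫ s in (0 : ℝ)..t, c * (divMollify j (g s) x + mollify j (H s) x) := by
  have h := S.equation _ (isTestFunction_mollifier_sub j x) t ht
  rw [sub_eq_iff_eq_add'] at h
  refine h.trans ?_
  rw [intervalIntegral.integral_const_mul]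
  congr 2
  rw [intervalIntegral.integral_of_le ht.1, intervalIntegral.integral_of_le ht.1]
  refine integral_congr_ae ?_
  refine ae_mono (Measure.restrict_mono (Ioc_subset_Icc_self.trans (Icc_subset_Icc_right ht.2))
    le_rfl) ?_
  filter_upwards [S.grad, S.ae_locallyIntegrable] with s h1 h2
  have hφ := isTestFunction_mollifier_sub j x
  have i1 : Integrable fun y => (Δ fun y => mollifier n j (x - y)) y • u s y :=
    h1.1.integrable_smul_left_of_hasCompactSupport (continuous_laplacian hφ)
      (hasCompactSupport_laplacian hφ)
  have i2 := h2.integrable_mollifier_smul j x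
  exact (integral_add i1 i2).trans (congrArg₂ _ (h1.integral_laplacian j x) rfl)

end MeasurableSolution

/-! ### Cutoffs, weights and bounds for the energy density. -/

/-- A spatial cutoff supported in the ball of radius `R`, with partial derivatives bounded by
`P`. -/
structure IsCutoff {n : ℕ} (R P : ℝ) (ζ : Rn n → ℝ) (dζ : Fin n → Rn n → ℝ) : Prop where
  cont : Continuous ζ
  eq_zero : ∀ x, R < ‖x‖ → ζ x = 0
  nonneg : ∀ x, 0 ≤ ζ x
  le_one : ∀ x, ζ x ≤ 1
  dcont : ∀ i, Continuous (dζ i)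
  deriv : ∀ i x, HasLineDerivAt ℝ ζ (dζ i x) x (EuclideanSpace.single i 1)
  dle : ∀ i x, |dζ i x| ≤ P
  bound_nonneg : 0 ≤ P

/-- A bounded substitute `q` for `|x|²` which still satisfies `|∇q|² ≤ 4 q`. -/
structure IsBoundedQuadratic {n : ℕ} (M : ℝ) (q : Rn n → ℝ) (dq : Fin n → Rn n → ℝ) : Prop where
  cont : Continuous q
  nonneg : ∀ x, 0 ≤ q x
  le : ∀ x, q x ≤ M
  dcont : ∀ i, Continuous (dq i)
  deriv : ∀ i x, HasLineDerivAt ℝ q (dq i x) x (EuclideanSpace.single i 1)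
  sum_sq_le : ∀ x, ∑ i, dq i x ^ 2 ≤ 4 * q x

/-- A solution of the Riccati equation `a' = -4 |c|² a² / A` with values in `[0, γ]`. -/
structure IsRiccati (c : ℂ) (A γ : ℝ) (a : ℝ → ℝ) : Prop where
  meas : Measurable a
  deriv : ∀ t ∈ Icc (0 : ℝ) 1, HasDerivAt a (-4 * ‖c‖ ^ 2 / A * a t ^ 2) t
  nonneg : ∀ t ∈ Icc (0 : ℝ) 1, 0 ≤ a t
  le : ∀ t ∈ Icc (0 : ℝ) 1, a t ≤ γ

theorem contDiff_truncLog_norm_sq {k : ℝ} (hk : 0 < k) :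
    ContDiff ℝ 1 fun w : ℂ => truncLog k (‖w‖ ^ 2) := by
  unfold truncLog
  refine contDiff_const.mul (ContDiff.log ?_ fun w => by positivity)
  exact contDiff_const.add ((contDiff_norm_sq ℝ).div_const k)

theorem fderiv_weighted_truncLog {k : ℝ} (hk : 0 < k) (z r α α' : ℝ) (w w' : ℂ) :
    fderiv ℝ (fun p : ℝ × ℂ => z * Real.exp (2 * p.1 * r) * truncLog k (‖p.2‖ ^ 2)) (α, w)
      (α', w') = 2 * α' * r * z * Real.exp (2 * α * r) * truncLog k (‖w‖ ^ 2) +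
        2 * (z * Real.exp (2 * α * r) * (k / (k + ‖w‖ ^ 2)) * inner ℝ w w') := by
  have h1 : HasFDerivAt (fun p : ℝ × ℂ => 2 * p.1 * r)
      (r • ((2 : ℝ) • ContinuousLinearMap.fst ℝ ℝ ℂ)) (α, w) :=
    (hasFDerivAt_fst.const_mul 2).mul_const r
  have h2 : HasFDerivAt (fun p : ℝ × ℂ => ‖p.2‖ ^ 2)
      (2 • (innerSL ℝ w).comp (ContinuousLinearMap.snd ℝ ℝ ℂ)) (α, w) :=
    (hasFDerivAt_snd (p := (α, w))).norm_sq
  have h3 : HasFDerivAt (truncLog k ∘ fun p : ℝ × ℂ => ‖p.2‖ ^ 2) _ (α, w) :=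
    HasDerivAt.comp_hasFDerivAt (h₂ := truncLog k) (α, w)
      (hasDerivAt_truncLog hk (sq_nonneg ‖w‖)) h2
  replace h3 : HasFDerivAt (fun p : ℝ × ℂ => truncLog k (‖p.2‖ ^ 2)) _ (α, w) := h3
  rw [((h1.exp.const_mul z).fun_mul h3).fderiv]
  simp
  ring

/-- The reason for the logarithm: its multiplier of `u` is bounded, so its product with a merely
integrable source is integrable. -/
theorem norm_mul_div_le_sqrt {k : ℝ} (hk : 0 < k) (r : ℝ) : k / (k + r ^ 2) * r ≤ √k := by
  have h2 : 0 < k + r ^ 2 := by positivity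
  rw [div_mul_eq_mul_div, div_le_iff₀ h2]
  have e := Real.mul_self_sqrt hk.le
  have h3 : √k * r ≤ k + r ^ 2 := by nlinarith [sq_nonneg (√k - r), sq_nonneg (√k + r)]
  calc k * r = √k * (√k * r) := by rw [← mul_assoc, e]
    _ ≤ √k * (k + r ^ 2) := mul_le_mul_of_nonneg_left h3 (Real.sqrt_nonneg _)

theorem abs_energyWeight_mul_inner_le {n : ℕ} {k α Q : ℝ} {ζ q : Rn n → ℝ} {x : Rn n} (hk : 0 < k)
    (hζ0 : 0 ≤ ζ x) (hζ1 : ζ x ≤ 1) (hQ : Real.exp (2 * α * q x) ≤ Q) (c w h : ℂ) :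
    |energyWeight k α ζ q x w * inner ℝ w (c * h)| ≤ Q * √k * ‖c‖ * ‖h‖ := by
  have h1 : 0 ≤ energyWeight k α ζ q x w := by unfold energyWeight; positivity
  have hQ0 : 0 ≤ Q := (Real.exp_pos _).le.trans hQ
  rw [abs_mul, abs_of_nonneg h1]
  calc _ ≤ energyWeight k α ζ q x w * (‖c‖ * ‖w‖ * ‖h‖) := by
        gcongr; exact abs_real_inner_mul_le c w h
    _ = ζ x * Real.exp (2 * α * q x) * (k / (k + ‖w‖ ^ 2) * ‖w‖) * ‖c‖ * ‖h‖ := by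
        unfold energyWeight; ring
    _ ≤ 1 * Q * √k * ‖c‖ * ‖h‖ := by gcongr; exact norm_mul_div_le_sqrt hk _
    _ = _ := by ring

/-- The time derivative of the truncated, localized and weighted energy density. -/
noncomputable def energyRate {n : ℕ} (c : ℂ) (A k : ℝ) (ζ q : Rn n → ℝ) (α : ℝ) (x : Rn n)
    (w h : ℂ) : ℝ :=
  2 * (-4 * ‖c‖ ^ 2 / A * α ^ 2) * q x * ζ x * Real.exp (2 * α * q x) * truncLog k (‖w‖ ^ 2) +
    2 * (energyWeight k α ζ q x w * inner ℝ w (c * h))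

/-- The upper bound for the energy rate that remains after integration by parts. -/
noncomputable def energyBound {n : ℕ} (c : ℂ) (P Q k : ℝ) (ζ q : Rn n → ℝ) (α : ℝ) (x : Rn n)
    (p : ℂ × EuclideanSpace ℂ (Fin n) × ℂ) : ℝ :=
  ‖c‖ * P * Q * (n * ‖p.1‖ ^ 2 + ‖p.2.1‖ ^ 2) +
    4 * ‖c‖ * Q * (‖p.1‖ ^ 2 / (k + ‖p.1‖ ^ 2)) * ‖p.2.1‖ ^ 2 +
      2 * (energyWeight k α ζ q x p.1 * inner ℝ p.1 (c * p.2.2))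

section bounds

variable {n : ℕ} {c : ℂ} {A k P Q α : ℝ} {ζ q : Rn n → ℝ}

theorem continuous_energyWeight_joint (hk : 0 < k) (hζ : Continuous ζ) (hq : Continuous q) :
    Continuous fun y : ℝ × Rn n × ℂ => energyWeight k y.1 ζ q y.2.1 y.2.2 := by
  unfold energyWeight
  have : ∀ y : ℝ × Rn n × ℂ, k + ‖y.2.2‖ ^ 2 ≠ 0 := fun y => by positivity
  fun_prop (disch := assumption)

theorem continuous_energyRate (hk : 0 < k) (hζ : Continuous ζ) (hq : Continuous q) :
    Continuous fun y : ℝ × Rn n × ℂ × ℂ => energyRate c A k ζ q y.1 y.2.1 y.2.2.1 y.2.2.2 := by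
  unfold energyRate
  have h1 := (contDiff_truncLog_norm_sq hk).continuous
  have h2 : Continuous fun y : ℝ × Rn n × ℂ × ℂ => energyWeight k y.1 ζ q y.2.1 y.2.2.1 :=
    (continuous_energyWeight_joint hk hζ hq).comp (by fun_prop :
      Continuous fun y : ℝ × Rn n × ℂ × ℂ => (y.1, y.2.1, y.2.2.1))
  have h3 : Continuous fun y : ℝ × Rn n × ℂ × ℂ => truncLog k (‖y.2.2.1‖ ^ 2) :=
    h1.comp (by fun_prop : Continuous fun y : ℝ × Rn n × ℂ × ℂ => y.2.2.1)
  have h4 : Continuous fun y : ℝ × Rn n × ℂ × ℂ => inner ℝ y.2.2.1 (c * y.2.2.2) :=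
    Continuous.inner (by fun_prop) (by fun_prop)
  fun_prop

theorem continuous_energyBound (hk : 0 < k) (hζ : Continuous ζ) (hq : Continuous q) :
    Continuous fun y : ℝ × Rn n × (ℂ × EuclideanSpace ℂ (Fin n) × ℂ) =>
      energyBound c P Q k ζ q y.1 y.2.1 y.2.2 := by
  unfold energyBound
  have h2 : Continuous fun y : ℝ × Rn n × (ℂ × EuclideanSpace ℂ (Fin n) × ℂ) =>
      energyWeight k y.1 ζ q y.2.1 y.2.2.1 :=
    (continuous_energyWeight_joint hk hζ hq).comp (by fun_prop :
      Continuous fun y : ℝ × Rn n × (ℂ × EuclideanSpace ℂ (Fin n) × ℂ) => (y.1, y.2.1, y.2.2.1))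
  have h4 : Continuous fun y : ℝ × Rn n × (ℂ × EuclideanSpace ℂ (Fin n) × ℂ) =>
      inner ℝ y.2.2.1 (c * y.2.2.2.2) :=
    Continuous.inner (by fun_prop) (by fun_prop)
  have : ∀ y : ℝ × Rn n × (ℂ × EuclideanSpace ℂ (Fin n) × ℂ), k + ‖y.2.2.1‖ ^ 2 ≠ 0 :=
    fun y => by positivity
  fun_prop (disch := assumption)

theorem continuous_energyBound_right (hk : 0 < k) (hζ : Continuous ζ) (hq : Continuous q) :
    Continuous fun y : Rn n × (ℂ × EuclideanSpace ℂ (Fin n) × ℂ) =>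
      energyBound c P Q k ζ q α y.1 y.2 := by
  have h1 := continuous_energyBound (n := n) (c := c) (P := P) (Q := Q) hk hζ hq
  have h2 : Continuous fun y : Rn n × (ℂ × EuclideanSpace ℂ (Fin n) × ℂ) => (α, y) :=
    Continuous.prodMk_right α
  refine (h1.comp h2).congr fun y => ?_
  simp only [Function.comp]

/-- Exactly the growth condition under which the mollification can be removed. -/
theorem abs_energyBound_le (hk : 0 < k) (hP : 0 ≤ P) (hζ0 : ∀ x, 0 ≤ ζ x) (hζ1 : ∀ x, ζ x ≤ 1)
    (hQ : ∀ x, Real.exp (2 * α * q x) ≤ Q) (x : Rn n)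
    (p : ℂ × EuclideanSpace ℂ (Fin n) × ℂ) :
    |energyBound c P Q k ζ q α x p| ≤ (‖c‖ * P * Q * (n + 1) + 4 * ‖c‖ * Q + 2 * (Q * √k * ‖c‖)) *
      (‖p.1‖ ^ 2 + ‖p.2.1‖ ^ 2 + ‖p.2.2‖) := by
  have hQ0 : 0 ≤ Q := (Real.exp_pos _).le.trans (hQ x)
  have h1 := abs_energyWeight_mul_inner_le hk (hζ0 x) (hζ1 x) (hQ x) c p.1 p.2.2
  have h2 : ‖p.1‖ ^ 2 / (k + ‖p.1‖ ^ 2) ≤ 1 := (div_le_one (by positivity)).2 (by linarith)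
  unfold energyBound
  set e := energyWeight k α ζ q x p.1 * inner ℝ p.1 (c * p.2.2)
  have h3 : |‖c‖ * P * Q * (n * ‖p.1‖ ^ 2 + ‖p.2.1‖ ^ 2)| ≤
      ‖c‖ * P * Q * (n + 1) * (‖p.1‖ ^ 2 + ‖p.2.1‖ ^ 2 + ‖p.2.2‖) := by
    rw [abs_of_nonneg (by positivity), mul_assoc (‖c‖ * P * Q)]
    refine mul_le_mul_of_nonneg_left ?_ (by positivity)
    have : 0 ≤ (n : ℝ) * ‖p.2.1‖ ^ 2 + ‖p.1‖ ^ 2 + n * ‖p.2.2‖ + ‖p.2.2‖ := by positivity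
    linarith
  have h4 : |4 * ‖c‖ * Q * (‖p.1‖ ^ 2 / (k + ‖p.1‖ ^ 2)) * ‖p.2.1‖ ^ 2| ≤
      4 * ‖c‖ * Q * (‖p.1‖ ^ 2 + ‖p.2.1‖ ^ 2 + ‖p.2.2‖) := by
    rw [abs_of_nonneg (by positivity)]
    calc _ ≤ 4 * ‖c‖ * Q * 1 * ‖p.2.1‖ ^ 2 := by gcongr
      _ = 4 * ‖c‖ * Q * (0 + ‖p.2.1‖ ^ 2 + 0) := by ring
      _ ≤ _ := by gcongr <;> positivity
  have h5 : |2 * e| ≤ 2 * (Q * √k * ‖c‖) * (‖p.1‖ ^ 2 + ‖p.2.1‖ ^ 2 + ‖p.2.2‖) := by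
    rw [abs_mul, abs_two]
    calc 2 * |e| ≤ 2 * (Q * √k * ‖c‖ * ‖p.2.2‖) := by gcongr
      _ = 2 * (Q * √k * ‖c‖) * (0 + 0 + ‖p.2.2‖) := by ring
      _ ≤ _ := by gcongr <;> positivity
  calc _ ≤ _ := abs_add_three _ _ _
    _ ≤ _ := add_le_add (add_le_add h3 h4) h5
    _ = _ := by ring

end bounds

/-! ### The truncated energy inequality. -/

namespace MeasurableSolution

variable {n : ℕ} {c : ℂ} {U u : ℝ → Rn n → ℂ} {g : ℝ → Rn n → EuclideanSpace ℂ (Fin n)}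
  {H : ℝ → Rn n → ℂ} {A k P R M γ : ℝ} {ζ q : Rn n → ℝ} {dζ dq : Fin n → Rn n → ℝ} {a : ℝ → ℝ}

/-- The chain rule at fixed `x` along the path `s ↦ (a s, mollify j (U s) x)`, both components of
which are primitives. -/
theorem weighted_truncLog_sub_eq (S : MeasurableSolution c U u g H) (ha : IsRiccati c A γ a)
    (hk : 0 < k) (ζ q : Rn n → ℝ) (j : ℕ) (x : Rn n) {t : ℝ} (ht : t ∈ Icc (0 : ℝ) 1) :
    ζ x * Real.exp (2 * a t * q x) * truncLog k (‖mollify j (U t) x‖ ^ 2) -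
      ζ x * Real.exp (2 * a 0 * q x) * truncLog k (‖mollify j (U 0) x‖ ^ 2) =
    ∫ s in (0 : ℝ)..t, energyRate c A k ζ q (a s) x (mollify j (u s) x)
      (divMollify j (g s) x + mollify j (H s) x) := by
  have hu : uIcc 0 t = Icc 0 t := uIcc_of_le ht.1
  have hsub : Icc 0 t ⊆ Icc (0 : ℝ) 1 := Icc_subset_Icc_right ht.2
  set f : ℝ × ℂ → ℝ := fun p => ζ x * Real.exp (2 * p.1 * q x) * truncLog k (‖p.2‖ ^ 2) with hf
  have hfC : ContDiff ℝ 1 f := by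
    have h1 : ContDiff ℝ 1 fun p : ℝ × ℂ => truncLog k (‖p.2‖ ^ 2) :=
      (contDiff_truncLog_norm_sq hk).comp contDiff_snd
    exact (contDiff_const.mul (((contDiff_const.mul contDiff_fst).mul contDiff_const).exp)).mul h1
  have hac : ContinuousOn a (uIcc 0 t) := fun s hs =>
    (ha.deriv s (hsub (hu ▸ hs))).continuousAt.continuousWithinAt
  have hai : IntervalIntegrable (fun s => -4 * ‖c‖ ^ 2 / A * a s ^ 2) volume 0 t :=
    (continuousOn_const.mul (hac.pow 2)).intervalIntegrable
  have hri := (S.intervalIntegrable_rhs j x).mono_set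
    (uIcc_subset_uIcc left_mem_uIcc (by rw [uIcc_of_le zero_le_one]; exact ht))
  have hrc := hri.const_mul c
  have key := sub_eq_integral_of_contDiff_comp_primitive hfC (a := 0) (b := t)
    (h := fun s => (-4 * ‖c‖ ^ 2 / A * a s ^ 2, c * (divMollify j (g s) x + mollify j (H s) x)))
    (X := fun s => (a s, mollify j (U s) x)) ⟨hai.1.prodMk hrc.1, hai.2.prodMk hrc.2⟩ ?_
  · refine key.trans ?_
    rw [intervalIntegral.integral_of_le ht.1, intervalIntegral.integral_of_le ht.1]
    refine integral_congr_ae (ae_mono (Measure.restrict_mono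
      (Ioc_subset_Icc_self.trans hsub) le_rfl) ?_)
    filter_upwards [S.ae_eq] with s hs
    have e : mollify j (U s) x = mollify j (u s) x :=
      integral_congr_ae (hs.mono fun y hy => by simp only [hy])
    rw [hf, fderiv_weighted_truncLog hk, e]
    rfl
  · intro s hs
    have hs1 : s ∈ Icc (0 : ℝ) 1 := hsub (hu ▸ hs)
    have hss : uIcc 0 s ⊆ uIcc 0 t := uIcc_subset_uIcc left_mem_uIcc hs
    have e1 : ∫ τ in (0 : ℝ)..s, -4 * ‖c‖ ^ 2 / A * a τ ^ 2 = a s - a 0 :=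
      intervalIntegral.integral_eq_sub_of_hasDerivAt
        (fun τ hτ => ha.deriv τ (hsub (hu ▸ hss hτ))) (hai.mono_set hss)
    have e2 : ∫ τ in (0 : ℝ)..s, (-4 * ‖c‖ ^ 2 / A * a τ ^ 2,
        c * (divMollify j (g τ) x + mollify j (H τ) x)) =
        (∫ τ in (0 : ℝ)..s, -4 * ‖c‖ ^ 2 / A * a τ ^ 2,
          ∫ τ in (0 : ℝ)..s, c * (divMollify j (g τ) x + mollify j (H τ) x)) := by
      rw [intervalIntegral.integral_of_le hs1.1, intervalIntegral.integral_of_le hs1.1,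
        intervalIntegral.integral_of_le hs1.1]
      exact integral_pair (hai.mono_set hss).1 (hrc.mono_set hss).1
    simp only [e2, e1, S.mollify_eq_add_integral j x hs1, Prod.mk_add_mk, add_sub_cancel]

theorem exp_le_of_riccati (ha : IsRiccati c A γ a) (hq : IsBoundedQuadratic M q dq)
    {t : ℝ} (ht : t ∈ Icc (0 : ℝ) 1) (x : Rn n) :
    Real.exp (2 * a t * q x) ≤ Real.exp (2 * γ * M) := by
  have h1 := ha.nonneg t ht
  have h2 := ha.le t ht
  have h3 := hq.nonneg x
  have h4 := hq.le x
  apply Real.exp_le_exp.2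
  gcongr
  linarith

/-- Needed for exchanging time and space integrals. The majorant is a product of an integrable
function of time and the indicator of the ball carrying the cutoff. -/
theorem integrable_energyRate (S : MeasurableSolution c U u g H) (ha : IsRiccati c A γ a)
    (hA : 0 < A) (hk : 0 < k) (hζ : IsCutoff R P ζ dζ) (hq : IsBoundedQuadratic M q dq) (j : ℕ) :
    Integrable (fun p : ℝ × Rn n => energyRate c A k ζ q (a p.1) p.2 (mollify j (u p.1) p.2)
      (divMollify j (g p.1) p.2 + mollify j (H p.1) p.2))
      ((volume.restrict (Icc (0 : ℝ) 1)).prod volume) := by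
  obtain ⟨b, hb, hle, hb0⟩ := S.exists_bound_rhs j R
  set Q := Real.exp (2 * γ * M)
  set C := 8 * ‖c‖ ^ 2 / A * γ ^ 2 * M * Q + 2 * (Q * √k * ‖c‖)
  have hball : Integrable ((Metric.closedBall (0 : Rn n) R).indicator fun _ => (1 : ℝ)) :=
    (integrable_indicator_iff measurableSet_closedBall).2
      (integrableOn_const measure_closedBall_lt_top.ne)
  refine ((hb.const_mul C).mul_prod hball).mono' ?_ ?_
  · have hm : StronglyMeasurable fun p : ℝ × Rn n => (a p.1, p.2, mollify j (u p.1) p.2,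
        divMollify j (g p.1) p.2 + mollify j (H p.1) p.2) :=
      (ha.meas.comp measurable_fst).stronglyMeasurable.prodMk
        (measurable_snd.stronglyMeasurable.prodMk
          ((stronglyMeasurable_mollify S.meas_u j).prodMk (S.stronglyMeasurable_rhs j)))
    exact ((continuous_energyRate hk hζ.cont hq.cont).comp_stronglyMeasurable
      hm).aestronglyMeasurable
  · have hae : ∀ᵐ p : ℝ × Rn n ∂(volume.restrict (Icc (0 : ℝ) 1)).prod volume,
        p.1 ∈ Icc (0 : ℝ) 1 ∧ ∀ x, ‖x‖ ≤ R →
        ‖divMollify j (g p.1) x + mollify j (H p.1) x‖ ≤ b p.1 ∧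
          ‖mollify j (u p.1) x‖ ^ 2 ≤ b p.1 :=
      Measure.quasiMeasurePreserving_fst.ae ((ae_restrict_mem measurableSet_Icc).and hle)
    filter_upwards [hae] with p hp
    by_cases hx : ‖p.2‖ ≤ R
    · obtain ⟨h1, h2⟩ := hp.2 p.2 hx
      rw [indicator_of_mem (by simpa using hx), mul_one]
      have hQ := exp_le_of_riccati ha hq hp.1 p.2
      have g1 := abs_energyWeight_mul_inner_le hk (hζ.nonneg p.2) (hζ.le_one p.2) hQ c
        (mollify j (u p.1) p.2) (divMollify j (g p.1) p.2 + mollify j (H p.1) p.2)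
      have a0 := ha.nonneg p.1 hp.1
      have a1 := ha.le p.1 hp.1
      have q0 := hq.nonneg p.2
      have q1 := hq.le p.2
      have z0 := hζ.nonneg p.2
      have z1 := hζ.le_one p.2
      have M0 : 0 ≤ M := q0.trans q1
      have t0 := truncLog_nonneg hk (sq_nonneg ‖mollify j (u p.1) p.2‖)
      have t1 := (truncLog_le hk (sq_nonneg ‖mollify j (u p.1) p.2‖)).trans h2
      unfold energyRate
      refine (abs_add_le _ _).trans ?_
      rw [add_mul]
      refine add_le_add ?_ ?_
      · rw [show ∀ τ : ℝ, 2 * (-4 * ‖c‖ ^ 2 / A * a p.1 ^ 2) * q p.2 * ζ p.2 *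
          Real.exp (2 * a p.1 * q p.2) * τ = -(8 * ‖c‖ ^ 2 / A * a p.1 ^ 2 * q p.2 *
          Real.exp (2 * a p.1 * q p.2) * (ζ p.2 * τ)) from fun τ => by ring, abs_neg,
          abs_of_nonneg (by positivity)]
        gcongr
        exact (mul_le_of_le_one_left t0 z1).trans t1
      · rw [abs_mul, abs_two, mul_assoc 2]
        gcongr
        exact g1.trans (by gcongr)
    · have hz := hζ.eq_zero p.2 (not_le.1 hx)
      rw [indicator_of_notMem (by simpa using hx), mul_zero]
      simp [energyRate, energyWeight, hz]

/-- The cutoff lives in the ball of radius `R` and mollifiers reach distance at most `1`, so only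
values of `h` within `R + 1` matter. A locally integrable source thereby becomes integrable. -/
theorem energyRate_congr_indicator (hk : IsCutoff R P ζ dζ) (j : ℕ) (h : Rn n → ℂ) (x : Rn n)
    (α : ℝ) (w d : ℂ) : energyRate c A k ζ q α x w (d + mollify j h x) =
      energyRate c A k ζ q α x w
        (d + mollify j ((Metric.closedBall 0 (R + 1)).indicator h) x) := by
  by_cases hx : ‖x‖ ≤ R
  · have : mollify j h x = mollify j ((Metric.closedBall 0 (R + 1)).indicator h) x := by
      refine integral_congr_ae (Eventually.of_forall fun y => ?_)
      simp only
      by_cases hy : y ∈ Metric.closedBall (0 : Rn n) (R + 1)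
      · rw [indicator_of_mem hy]
      · rw [Metric.mem_closedBall, dist_zero_right, not_le] at hy
        have := norm_sub_norm_le y x
        rw [norm_sub_rev] at this
        rw [mollifier_eq_zero (by linarith), zero_smul, zero_smul]
    rw [this]
  · simp [energyRate, energyWeight, hk.eq_zero x (not_le.1 hx)]

/-- Integration by parts at a fixed time, applied to the mollified functions. It eliminates
`divMollify`, a second derivative of `f` that has no limit as a function, leaving only quantities
stable under removal of the mollification. -/
theorem integral_energyRate_le (ha : IsRiccati c A γ a)
    (hA : 0 < A) (hc : c.re = A) (hk : 0 < k) (hζ : IsCutoff R P ζ dζ)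
    (hq : IsBoundedQuadratic M q dq) (j : ℕ) {s : ℝ} (hs : s ∈ Icc (0 : ℝ) 1)
    {f h : Rn n → ℂ} {G : Rn n → EuclideanSpace ℂ (Fin n)} (hG : HasWeakGradient f G)
    (hf2 : MemLp f 2) (hG2 : MemLp G 2)
    (hh : Integrable ((Metric.closedBall 0 (R + 1)).indicator h)) :
    ∫ x, energyRate c A k ζ q (a s) x (mollify j f x) (divMollify j G x + mollify j h x) ≤
      ∫ x, energyBound c P (Real.exp (2 * γ * M)) k ζ q (a s) x (mollify j f x, mollify j G x,
        mollify j ((Metric.closedBall 0 (R + 1)).indicator h) x) := by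
  have hQ := exp_le_of_riccati ha hq hs
  have hcpt : HasCompactSupport ζ :=
    HasCompactSupport.intro (isCompact_closedBall (0 : Rn n) R) fun x hx =>
      hζ.eq_zero x (by simpa using hx)
  have cW := contDiff_mollify hG.1 j
  have cZ := contDiff_mollify hG.2.1 j
  have cZi : ∀ i, ContDiff ℝ ∞ fun x => mollify j G x i := fun i =>
    ((EuclideanSpace.proj (𝕜 := ℂ) i : EuclideanSpace ℂ (Fin n) →L[ℂ] ℂ).restrictScalars
      ℝ).contDiff.comp cZ
  set dZ : Fin n → Rn n → ℂ := fun i x =>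
    fderiv ℝ (fun z => mollify j G z i) x (EuclideanSpace.single i 1) with hdZ
  have hdiv : ∀ x, divMollify j G x = ∑ i, dZ i x := fun x => by
    obtain ⟨L, hL, hsum⟩ := hasFDerivAt_mollify_apply hG.2.1 j x
    rw [← hsum]
    exact Finset.sum_congr rfl fun i _ => by rw [← (hL i).fderiv]
  simp_rw [energyRate_congr_indicator hζ j h, hdiv]
  refine integral_energy_le (α := a s) (Q := Real.exp (2 * γ * M)) hk hA hc hζ.cont hcpt hζ.nonneg
    hζ.le_one hq.cont hq.nonneg
    hζ.dcont hq.dcont hζ.deriv hq.deriv hζ.dle hζ.bound_nonneg hq.sum_sq_le hQ cW.continuous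
    cZ.continuous (fun i => ?_) (fun i x => ?_) (fun i x => ?_)
    (contDiff_mollify hh.locallyIntegrable j).continuous ?_
  · exact ((cZi i).continuous_fderiv (by norm_num)).clm_apply continuous_const
  · obtain ⟨L, hL, hLi⟩ := hG.hasFDerivAt_mollify j x
    rw [← hLi i]
    exact hL.hasLineDerivAt _
  · exact ((cZi i).differentiable (by norm_num) x).hasFDerivAt.hasLineDerivAt _
  · have hP := hζ.bound_nonneg
    exact integrable_comp_mollify (continuous_energyBound_right hk hζ.cont hq.cont)
      (abs_energyBound_le hk hP hζ.nonneg hζ.le_one hQ) (by positivity) hf2 hG2 hh j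

end MeasurableSolution

namespace MeasurableSolution

variable {n : ℕ} {c : ℂ} {U u : ℝ → Rn n → ℂ} {g : ℝ → Rn n → EuclideanSpace ℂ (Fin n)}
  {H : ℝ → Rn n → ℂ} {A k P R M γ : ℝ} {ζ q : Rn n → ℝ} {dζ dq : Fin n → Rn n → ℝ} {a : ℝ → ℝ}

theorem stronglyMeasurable_indicator {E : Type*} [NormedAddCommGroup E] {f : ℝ → Rn n → E}
    (hf : StronglyMeasurable fun p : ℝ × Rn n => f p.1 p.2) {B : Set (Rn n)}
    (hB : MeasurableSet B) :
    StronglyMeasurable fun p : ℝ × Rn n => B.indicator (f p.1) p.2 :=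
  hf.indicator (measurable_snd hB)

theorem continuous_weighted_truncLog (hk : 0 < k) (α : ℝ) (hζ : Continuous ζ) (hq : Continuous q) :
    Continuous fun y : Rn n × (ℂ × ℂ × ℂ) =>
      ζ y.1 * Real.exp (2 * α * q y.1) * truncLog k (‖y.2.1‖ ^ 2) := by
  have h1 : Continuous fun y : Rn n × (ℂ × ℂ × ℂ) => truncLog k (‖y.2.1‖ ^ 2) :=
    (contDiff_truncLog_norm_sq hk).continuous.comp (by fun_prop :
      Continuous fun y : Rn n × (ℂ × ℂ × ℂ) => y.2.1)
  fun_prop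

theorem abs_weighted_truncLog_le (hk : 0 < k) {α Q : ℝ} (hζ : IsCutoff R P ζ dζ)
    (hQ : ∀ x, Real.exp (2 * α * q x) ≤ Q) (x : Rn n) (p : ℂ × ℂ × ℂ) :
    |ζ x * Real.exp (2 * α * q x) * truncLog k (‖p.1‖ ^ 2)| ≤
      Q * (‖p.1‖ ^ 2 + ‖p.2.1‖ ^ 2 + ‖p.2.2‖) := by
  have t0 := truncLog_nonneg hk (sq_nonneg ‖p.1‖)
  have t1 := truncLog_le hk (sq_nonneg ‖p.1‖)
  have z0 := hζ.nonneg x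
  have z1 := hζ.le_one x
  have hQ0 : 0 ≤ Q := (Real.exp_pos _).le.trans (hQ x)
  rw [abs_of_nonneg (by positivity)]
  calc _ ≤ 1 * Q * (‖p.1‖ ^ 2 + 0 + 0) := by
        rw [add_zero, add_zero]; gcongr; exact hQ x
    _ ≤ 1 * Q * (‖p.1‖ ^ 2 + ‖p.2.1‖ ^ 2 + ‖p.2.2‖) := by gcongr <;> positivity
    _ = _ := by rw [one_mul]

theorem tendsto_integral_weighted_truncLog (hk : 0 < k) {α Q : ℝ} (hζ : IsCutoff R P ζ dζ)
    (hq : Continuous q) (hQ : ∀ x, Real.exp (2 * α * q x) ≤ Q) {f : Rn n → ℂ} (hf : MemLp f 2) :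
    Tendsto (fun j => ∫ x, ζ x * Real.exp (2 * α * q x) * truncLog k (‖mollify j f x‖ ^ 2)) atTop
      (𝓝 (∫ x, ζ x * Real.exp (2 * α * q x) * truncLog k (‖f x‖ ^ 2))) :=
  tendsto_integral_comp_mollify (E₂ := ℂ) (E₃ := ℂ) (g := 0) (h := 0)
    (continuous_weighted_truncLog hk α hζ.cont hq)
    (abs_weighted_truncLog_le hk hζ hQ) ((Real.exp_pos _).le.trans (hQ 0)) hf MemLp.zero
    (integrable_zero _ _ _)

theorem integrable_weighted_truncLog_mollify (hk : 0 < k) {α Q : ℝ} (hζ : IsCutoff R P ζ dζ)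
    (hq : Continuous q) (hQ : ∀ x, Real.exp (2 * α * q x) ≤ Q) {f : Rn n → ℂ} (hf : MemLp f 2)
    (j : ℕ) :
    Integrable fun x => ζ x * Real.exp (2 * α * q x) * truncLog k (‖mollify j f x‖ ^ 2) :=
  integrable_comp_mollify (E₂ := ℂ) (E₃ := ℂ) (g := 0) (h := 0)
    (continuous_weighted_truncLog hk α hζ.cont hq)
    (abs_weighted_truncLog_le hk hζ hQ) ((Real.exp_pos _).le.trans (hQ 0)) hf MemLp.zero
    (integrable_zero _ _ _) j

/-- The truncated energy inequality for the mollified solution. -/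
theorem mollified_energy_le (S : MeasurableSolution c U u g H) (ha : IsRiccati c A γ a)
    (hA : 0 < A) (hc : c.re = A) (hk : 0 < k) (hζ : IsCutoff R P ζ dζ)
    (hq : IsBoundedQuadratic M q dq) (j : ℕ) {t : ℝ} (ht : t ∈ Icc (0 : ℝ) 1)
    (hK : Integrable (fun s => ∫ x, energyBound c P (Real.exp (2 * γ * M)) k ζ q (a s) x
      (mollify j (u s) x, mollify j (g s) x,
        mollify j ((Metric.closedBall 0 (R + 1)).indicator (H s)) x))
      (volume.restrict (Ioc 0 t))) :
    ∫ x, ζ x * Real.exp (2 * a t * q x) * truncLog k (‖mollify j (U t) x‖ ^ 2) ≤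
      (∫ x, ζ x * Real.exp (2 * a 0 * q x) * truncLog k (‖mollify j (U 0) x‖ ^ 2)) +
      ∫ s in Ioc 0 t, ∫ x, energyBound c P (Real.exp (2 * γ * M)) k ζ q (a s) x
      (mollify j (u s) x, mollify j (g s) x,
        mollify j ((Metric.closedBall 0 (R + 1)).indicator (H s)) x) := by
  have h0 : (0 : ℝ) ∈ Icc (0 : ℝ) 1 := ⟨le_rfl, zero_le_one⟩
  have hsub : Ioc 0 t ⊆ Icc (0 : ℝ) 1 := Ioc_subset_Icc_self.trans (Icc_subset_Icc_right ht.2)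
  have hν : volume.restrict (Ioc 0 t) ≤ volume.restrict (Icc (0 : ℝ) 1) :=
    Measure.restrict_mono hsub le_rfl
  have hr : Integrable (fun p : ℝ × Rn n => energyRate c A k ζ q (a p.1) p.2
      (mollify j (u p.1) p.2) (divMollify j (g p.1) p.2 + mollify j (H p.1) p.2))
      ((volume.restrict (Ioc 0 t)).prod volume) :=
    (S.integrable_energyRate ha hA hk hζ hq j).mono_measure (Measure.prod_mono hν le_rfl)
  rw [← sub_le_iff_le_add', ← integral_sub
    (integrable_weighted_truncLog_mollify hk hζ hq.cont (exp_le_of_riccati ha hq ht)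
      (S.memLp t ht) j)
    (integrable_weighted_truncLog_mollify hk hζ hq.cont (exp_le_of_riccati ha hq h0)
      (S.memLp 0 h0) j)]
  simp_rw [S.weighted_truncLog_sub_eq ha hk ζ q j _ ht, intervalIntegral.integral_of_le ht.1]
  -- The chain rule gave a time integral at each `x`. Fubini puts the space integral inside, where
  -- integration by parts is available at almost every time.
  rw [← integral_integral_swap hr]
  refine integral_mono_ae hr.integral_prod_left hK ?_
  have hae := (ae_restrict_mem measurableSet_Icc).and (S.grad.and ((ae_memLp S.meas_u S.sq_u).and
    ((ae_memLp S.meas_g S.sq_g).and (S.int_H (R + 1)).prod_right_ae)))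
  filter_upwards [ae_mono hν hae] with s hs
  exact integral_energyRate_le ha hA hc hk hζ hq j hs.1 hs.2.1 hs.2.2.1 hs.2.2.2.1
    ((integrable_indicator_iff measurableSet_closedBall).2 hs.2.2.2.2)

/-- The truncated energy inequality. -/
theorem energy_le (S : MeasurableSolution c U u g H) (ha : IsRiccati c A γ a)
    (hA : 0 < A) (hc : c.re = A) (hk : 0 < k) (hζ : IsCutoff R P ζ dζ)
    (hq : IsBoundedQuadratic M q dq) {t : ℝ} (ht : t ∈ Icc (0 : ℝ) 1) :
    ∫ x, ζ x * Real.exp (2 * a t * q x) * truncLog k (‖U t x‖ ^ 2) ≤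
      (∫ x, ζ x * Real.exp (2 * a 0 * q x) * truncLog k (‖U 0 x‖ ^ 2)) +
      ∫ s in Ioc 0 t, ∫ x, energyBound c P (Real.exp (2 * γ * M)) k ζ q (a s) x
      (u s x, g s x, (Metric.closedBall 0 (R + 1)).indicator (H s) x) := by
  have h0 : (0 : ℝ) ∈ Icc (0 : ℝ) 1 := ⟨le_rfl, zero_le_one⟩
  have hsub : Ioc 0 t ⊆ Icc (0 : ℝ) 1 := Ioc_subset_Icc_self.trans (Icc_subset_Icc_right ht.2)
  have hν : volume.restrict (Ioc 0 t) ≤ volume.restrict (Icc (0 : ℝ) 1) :=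
    Measure.restrict_mono hsub le_rfl
  set B : Set (Rn n) := Metric.closedBall 0 (R + 1) with hB
  set Q := Real.exp (2 * γ * M) with hQdef
  have hP := hζ.bound_nonneg
  set C := ‖c‖ * P * Q * (n + 1) + 4 * ‖c‖ * Q + 2 * (Q * √k * ‖c‖) with hCdef
  have hC : 0 ≤ C := by positivity
  have hae := ae_mono hν ((ae_restrict_mem measurableSet_Icc).and
    ((ae_memLp S.meas_u S.sq_u).and
    ((ae_memLp S.meas_g S.sq_g).and (S.int_H (R + 1)).prod_right_ae)))
  set bd : ℝ → ℝ := fun s => C * ((∫ x, ‖u s x‖ ^ 2) + (∫ x, ‖g s x‖ ^ 2) +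
    ∫ x, ‖B.indicator (H s) x‖) with hbd
  have hbdi : Integrable bd (volume.restrict (Ioc 0 t)) := by
    refine Integrable.mono_measure ?_ hν
    refine ((integrable_integral_sq S.sq_u).add (integrable_integral_sq S.sq_g)).add ?_
        |>.const_mul C
    refine (S.int_H (R + 1)).norm.integral_prod_left.congr (Eventually.of_forall fun s => ?_)
    simp_rw [norm_indicator_eq_indicator_norm]
    exact (integral_indicator measurableSet_closedBall).symm
  have hmeas : ∀ j, AEStronglyMeasurable (fun s => ∫ x, energyBound c P Q k ζ q (a s) x
      (mollify j (u s) x, mollify j (g s) x, mollify j (B.indicator (H s)) x))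
      (volume.restrict (Ioc 0 t)) := fun j => by
    have hm : StronglyMeasurable fun p : ℝ × Rn n => (a p.1, p.2, mollify j (u p.1) p.2,
        mollify j (g p.1) p.2, mollify j (B.indicator (H p.1)) p.2) :=
      (ha.meas.comp measurable_fst).stronglyMeasurable.prodMk
        (measurable_snd.stronglyMeasurable.prodMk
          ((stronglyMeasurable_mollify S.meas_u j).prodMk
            ((stronglyMeasurable_mollify S.meas_g j).prodMk
              (stronglyMeasurable_mollify (f := fun s => B.indicator (H s))
                (stronglyMeasurable_indicator S.meas_H measurableSet_closedBall) j))))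
    exact (((continuous_energyBound hk hζ.cont hq.cont).comp_stronglyMeasurable
      hm).integral_prod_right').aestronglyMeasurable
  have hle : ∀ j, ∀ᵐ s ∂volume.restrict (Ioc 0 t), ‖∫ x, energyBound c P Q k ζ q (a s) x
      (mollify j (u s) x, mollify j (g s) x, mollify j (B.indicator (H s)) x)‖ ≤ bd s := fun j => by
    filter_upwards [hae] with s hs
    exact abs_integral_comp_mollify_le
      (abs_energyBound_le hk hP hζ.nonneg hζ.le_one (exp_le_of_riccati ha hq hs.1)) hC
      hs.2.1 hs.2.2.1 ((integrable_indicator_iff measurableSet_closedBall).2 hs.2.2.2) j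
  refine le_of_tendsto_of_tendsto'
    (tendsto_integral_weighted_truncLog hk hζ hq.cont (exp_le_of_riccati ha hq ht) (S.memLp t ht))
    ((tendsto_integral_weighted_truncLog hk hζ hq.cont (exp_le_of_riccati ha hq h0)
      (S.memLp 0 h0)).add
      (tendsto_integral_of_dominated_convergence bd hmeas hbdi hle ?_))
    fun j => S.mollified_energy_le ha hA hc hk hζ hq j ht (hbdi.mono' (hmeas j) (hle j))
  filter_upwards [hae] with s hs
  exact tendsto_integral_comp_mollify (continuous_energyBound_right hk hζ.cont hq.cont)
    (abs_energyBound_le hk hP hζ.nonneg hζ.le_one (exp_le_of_riccati ha hq hs.1)) hC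
    hs.2.1 hs.2.2.1 ((integrable_indicator_iff measurableSet_closedBall).2 hs.2.2.2)

end MeasurableSolution

/-! ### Construction of cutoffs and bounded weights. -/

/-- Dilates of one bump function, so that the constant `C` in the gradient bound does not depend on
`N`. -/
theorem exists_isCutoff (n : ℕ) : ∃ C : ℝ, 0 ≤ C ∧ ∀ N : ℕ, ∃ (ζ : Rn n → ℝ)
    (dζ : Fin n → Rn n → ℝ), IsCutoff (2 * (N + 1 : ℝ)) (C / (N + 1)) ζ dζ ∧
      ∀ x, ‖x‖ ≤ N + 1 → ζ x = 1 := by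
  let χ : ContDiffBump (0 : Rn n) := ⟨1, 2, one_pos, one_lt_two⟩
  have hχ : ContDiff ℝ 1 χ := χ.contDiff
  have hd : Continuous (fderiv ℝ χ) := hχ.continuous_fderiv one_ne_zero
  obtain ⟨C, hC⟩ := hd.bounded_above_of_compact_support (χ.hasCompactSupport.fderiv ℝ)
  refine ⟨C, (norm_nonneg _).trans (hC 0), fun N => ?_⟩
  have hN : (0 : ℝ) < N + 1 := by positivity
  have hnorm : ∀ x : Rn n, ‖((N : ℝ) + 1)⁻¹ • x‖ = ‖x‖ / (N + 1) := fun x => by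
    rw [norm_smul, norm_inv, Real.norm_of_nonneg hN.le]; ring
  refine ⟨fun x => χ (((N : ℝ) + 1)⁻¹ • x), fun i x =>
    fderiv ℝ χ (((N : ℝ) + 1)⁻¹ • x) (((N : ℝ) + 1)⁻¹ • EuclideanSpace.single i 1),
    ⟨?_, ?_, fun x => χ.nonneg, fun x => χ.le_one, ?_, ?_, ?_, ?_⟩, ?_⟩
  · exact χ.continuous.comp (continuous_const_smul _)
  · intro x hx
    refine χ.zero_of_le_dist ?_
    rw [dist_zero_right, hnorm, le_div_iff₀ hN]
    exact hx.le
  · exact fun i => (hd.comp (continuous_const_smul _)).clm_apply continuous_const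
  · intro i x
    have h1 := (hχ.differentiable one_ne_zero (((N : ℝ) + 1)⁻¹ • x)).hasFDerivAt
    have h2 : HasFDerivAt (fun x : Rn n => ((N : ℝ) + 1)⁻¹ • x)
        (((N : ℝ) + 1)⁻¹ • ContinuousLinearMap.id ℝ (Rn n)) x := (hasFDerivAt_id x).fun_const_smul _
    exact (h1.comp x h2).hasLineDerivAt _
  · intro i x
    refine ((fderiv ℝ χ (((N : ℝ) + 1)⁻¹ • x)).le_opNorm _).trans ?_
    rw [hnorm, PiLp.norm_single, norm_one, mul_one_div]
    exact div_le_div_of_nonneg_right (hC _) hN.le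
  · exact div_nonneg ((norm_nonneg _).trans (hC 0)) hN.le
  · intro x hx
    refine χ.one_of_mem_closedBall ?_
    rw [Metric.mem_closedBall, dist_zero_right, hnorm, div_le_iff₀ hN]
    simpa [χ] using hx

/-- The bounded approximation `|x|² / (1 + δ|x|²)` of `|x|²`. -/
noncomputable def boundedQuadratic (n : ℕ) (δ : ℝ) (x : Rn n) : ℝ := ‖x‖ ^ 2 / (1 + δ * ‖x‖ ^ 2)

/-- Here `|∇q|² = 4|x|²/(1+δ|x|²)⁴`, and lowering the exponent to `1` only increases it, giving
`4q`. -/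
theorem isBoundedQuadratic {n : ℕ} {δ : ℝ} (hδ : 0 < δ) :
    IsBoundedQuadratic (1 / δ) (boundedQuadratic n δ)
      fun i x => 2 * x i / (1 + δ * ‖x‖ ^ 2) ^ 2 := by
  have hpos : ∀ x : Rn n, 0 < 1 + δ * ‖x‖ ^ 2 := fun x => by positivity
  have hne : ∀ x : Rn n, 1 + δ * ‖x‖ ^ 2 ≠ 0 := fun x => (hpos x).ne'
  have hne2 : ∀ x : Rn n, (1 + δ * ‖x‖ ^ 2) ^ 2 ≠ 0 := fun x => pow_ne_zero 2 (hne x)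
  refine ⟨?_, fun x => ?_, fun x => ?_, fun i => ?_, fun i x => ?_, fun x => ?_⟩
  · unfold boundedQuadratic
    fun_prop (disch := assumption)
  · unfold boundedQuadratic
    have := hpos x
    positivity
  · unfold boundedQuadratic
    rw [div_le_div_iff₀ (hpos x) hδ]
    nlinarith [sq_nonneg ‖x‖]
  · fun_prop (disch := assumption)
  · have h1 : HasFDerivAt (fun y : Rn n => ‖y‖ ^ 2) (2 • innerSL ℝ x) x :=
      (hasStrictFDerivAt_norm_sq x).hasFDerivAt
    have h2 := h1.hasLineDerivAt (EuclideanSpace.single i 1)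
    have h3 : ((2 • innerSL ℝ x : Rn n →L[ℝ] ℝ)) (EuclideanSpace.single i (1 : ℝ)) = 2 * x i := by
      simp [EuclideanSpace.inner_single_right]
    rw [h3] at h2
    unfold HasLineDerivAt at *
    have h4 := h2.fun_div ((h2.const_mul δ).const_add 1) (by simpa using hne x)
    simp only [zero_smul, add_zero] at h4
    refine h4.congr_deriv ?_
    congr 1
    ring
  · unfold boundedQuadratic
    have e : ∑ i : Fin n, (2 * x i / (1 + δ * ‖x‖ ^ 2) ^ 2) ^ 2 =
        4 * (‖x‖ ^ 2 / (1 + δ * ‖x‖ ^ 2) ^ 4) := by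
      calc _ = ∑ i : Fin n, 4 / (1 + δ * ‖x‖ ^ 2) ^ 4 * ‖x i‖ ^ 2 := by
            refine Finset.sum_congr rfl fun i _ => ?_
            rw [div_pow, mul_pow, Real.norm_eq_abs, sq_abs]
            ring
        _ = 4 / (1 + δ * ‖x‖ ^ 2) ^ 4 * ∑ i : Fin n, ‖x i‖ ^ 2 := (Finset.mul_sum _ _ _).symm
        _ = _ := by rw [← EuclideanSpace.norm_sq_eq]; ring
    rw [e]
    have h1 : 1 ≤ 1 + δ * ‖x‖ ^ 2 := by have := sq_nonneg ‖x‖; nlinarith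
    gcongr
    exact le_self_pow₀ h1 (by norm_num)

theorem tendsto_truncLog (s : ℝ) (hs : 0 ≤ s) :
    Tendsto (fun N : ℕ => truncLog (N + 1) s) atTop (𝓝 s) := by
  have h1 : Tendsto (fun N : ℕ => (N : ℝ) + 1) atTop atTop :=
    tendsto_natCast_atTop_atTop.atTop_add tendsto_const_nhds
  have h2 : Tendsto (fun N : ℕ => s / ((N : ℝ) + 1 + s)) atTop (𝓝 0) :=
    tendsto_const_nhds.div_atTop (h1.atTop_add tendsto_const_nhds)
  have h3 : Tendsto (fun N : ℕ => (1 - s / ((N : ℝ) + 1 + s)) * s) atTop (𝓝 ((1 - 0) * s)) :=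
    (tendsto_const_nhds.sub h2).mul_const s
  rw [sub_zero, one_mul] at h3
  refine tendsto_of_tendsto_of_tendsto_of_le_of_le h3 tendsto_const_nhds (fun N => ?_) fun N =>
    truncLog_le (by positivity) hs
  refine le_trans (le_of_eq ?_) (le_truncLog (by positivity) hs)
  have : (N : ℝ) + 1 + s ≠ 0 := by positivity
  field_simp
  ring

/-- Cauchy–Schwarz for a weighted integral. -/
theorem integral_mul_norm_mul_norm_le {n : ℕ} {w : Rn n → ℝ} {Q : ℝ} (hw : Continuous w)
    (hw0 : ∀ x, 0 ≤ w x) (hwQ : ∀ x, w x ≤ Q) {f h : Rn n → ℂ} (hf : MemLp f 2)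
    (hh : MemLp h 2) :
    Integrable (fun x => w x * (‖f x‖ * ‖h x‖)) ∧ ∫ x, w x * (‖f x‖ * ‖h x‖) ≤
      √(∫ x, w x * ‖f x‖ ^ 2) * √(∫ x, w x * ‖h x‖ ^ 2) := by
  have hm : ∀ {f : Rn n → ℂ}, MemLp f 2 → MemLp (fun x => √(w x) * ‖f x‖) 2 := fun {f} hf => by
    refine MemLp.of_le_mul (c := √Q) hf
      (hw.sqrt.aestronglyMeasurable.mul hf.1.norm) (Eventually.of_forall fun x => ?_)
    rw [Real.norm_of_nonneg (by positivity)]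
    gcongr
    exact hwQ x
  have e : (fun x => w x * (‖f x‖ * ‖h x‖)) = fun x => (√(w x) * ‖f x‖) * (√(w x) * ‖h x‖) := by
    ext x
    have := Real.mul_self_sqrt (hw0 x)
    calc _ = (√(w x) * √(w x)) * (‖f x‖ * ‖h x‖) := by rw [this]
      _ = _ := by ring
  have e2 : ∀ f : Rn n → ℂ, ∫ x, (√(w x) * ‖f x‖) ^ (2 : ℝ) = ∫ x, w x * ‖f x‖ ^ 2 := fun f => by
    refine integral_congr_ae (Eventually.of_forall fun x => ?_)
    simp only [Real.rpow_two, mul_pow, Real.sq_sqrt (hw0 x)]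
  refine ⟨e ▸ (hm hf).integrable_mul (hm hh), ?_⟩
  rw [e, Real.sqrt_eq_rpow, Real.sqrt_eq_rpow, ← e2, ← e2]
  refine integral_mul_le_Lp_mul_Lq_of_nonneg Real.HolderConjugate.two_two
    (Eventually.of_forall fun x => by positivity) (Eventually.of_forall fun x => by positivity)
    ?_ ?_
  · simpa using hm hf
  · simpa using hm hh

/-! ### Removing the cutoff and the logarithmic truncation. -/

namespace MeasurableSolution

variable {n : ℕ} {c : ℂ} {U u : ℝ → Rn n → ℂ} {g : ℝ → Rn n → EuclideanSpace ℂ (Fin n)}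
  {H : ℝ → Rn n → ℂ} {A k P R M γ : ℝ} {ζ q : Rn n → ℝ} {dζ dq : Fin n → Rn n → ℝ} {a : ℝ → ℝ}

/-- The part of `energyBound` that vanishes when the truncation is removed. -/
noncomputable def energyError (c : ℂ) (P Q k : ℝ) (w : ℂ) (z : EuclideanSpace ℂ (Fin n)) : ℝ :=
  ‖c‖ * P * Q * (n * ‖w‖ ^ 2 + ‖z‖ ^ 2) + 4 * ‖c‖ * Q * (‖w‖ ^ 2 / (k + ‖w‖ ^ 2)) * ‖z‖ ^ 2

theorem continuous_energyError (hk : 0 < k) (Q : ℝ) :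
    Continuous fun p : ℂ × EuclideanSpace ℂ (Fin n) => energyError c P Q k p.1 p.2 := by
  unfold energyError
  have : ∀ p : ℂ × EuclideanSpace ℂ (Fin n), k + ‖p.1‖ ^ 2 ≠ 0 := fun p => by positivity
  fun_prop (disch := assumption)

theorem energyError_nonneg (hk : 0 < k) (hP : 0 ≤ P) {Q : ℝ} (hQ : 0 ≤ Q) (w : ℂ)
    (z : EuclideanSpace ℂ (Fin n)) : 0 ≤ energyError c P Q k w z := by
  unfold energyError; positivity

theorem energyError_le (hk : 0 < k) (hP : 0 ≤ P) {P' Q : ℝ} (hPP : P ≤ P') (hQ : 0 ≤ Q) (w : ℂ)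
    (z : EuclideanSpace ℂ (Fin n)) : energyError c P Q k w z ≤
      (‖c‖ * P' * Q * (n + 1) + 4 * ‖c‖ * Q) * (‖w‖ ^ 2 + ‖z‖ ^ 2) := by
  have h2 : ‖w‖ ^ 2 / (k + ‖w‖ ^ 2) ≤ 1 := (div_le_one (by positivity)).2 (by linarith)
  have hP' := hP.trans hPP
  unfold energyError
  rw [add_mul]
  refine add_le_add ?_ ?_
  · rw [mul_assoc (‖c‖ * P' * Q)]
    gcongr
    have : 0 ≤ ‖w‖ ^ 2 + n * ‖z‖ ^ 2 := by positivity
    linarith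
  · calc _ ≤ 4 * ‖c‖ * Q * 1 * ‖z‖ ^ 2 := by gcongr
      _ = 4 * ‖c‖ * Q * (0 + ‖z‖ ^ 2) := by ring
      _ ≤ _ := by gcongr; positivity

theorem integrable_sq_add_sq (S : MeasurableSolution c U u g H) :
    Integrable (fun p : ℝ × Rn n => ‖u p.1 p.2‖ ^ 2 + ‖g p.1 p.2‖ ^ 2)
      ((volume.restrict (Icc (0 : ℝ) 1)).prod volume) :=
  ((memLp_two_iff_integrable_sq_norm S.sq_u.1).1 S.sq_u).add
    ((memLp_two_iff_integrable_sq_norm S.sq_g.1).1 S.sq_g)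

theorem integrable_energyError (S : MeasurableSolution c U u g H) (hk : 0 < k) (hP : 0 ≤ P)
    {Q : ℝ} (hQ : 0 ≤ Q) :
    Integrable (fun p : ℝ × Rn n => energyError c P Q k (u p.1 p.2) (g p.1 p.2))
      ((volume.restrict (Icc (0 : ℝ) 1)).prod volume) := by
  refine (S.integrable_sq_add_sq.const_mul (‖c‖ * P * Q * (n + 1) + 4 * ‖c‖ * Q)).mono'
    ((continuous_energyError hk Q).comp_stronglyMeasurable
      (S.meas_u.prodMk S.meas_g)).aestronglyMeasurable (Eventually.of_forall fun p => ?_)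
  rw [Real.norm_of_nonneg (energyError_nonneg hk hP hQ _ _)]
  exact energyError_le hk hP le_rfl hQ _ _

/-- Cutoff radius and truncation level grow together with `N`. The error tends to zero pointwise and
stays below a fixed multiple of `|u|² + |∇u|²`, which is integrable over the slab. -/
theorem tendsto_integral_energyError (S : MeasurableSolution c U u g H) {C Q : ℝ} (hC : 0 ≤ C)
    (hQ : 0 ≤ Q) {ν : Measure ℝ} [SFinite ν] (hν : ν ≤ volume.restrict (Icc (0 : ℝ) 1)) :
    Tendsto (fun N : ℕ => ∫ s, (∫ x, energyError c (C / (N + 1)) Q (N + 1) (u s x) (g s x)) ∂ν)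
      atTop (𝓝 0) := by
  have hpn : ∀ N : ℕ, 0 ≤ C / ((N : ℝ) + 1) := fun N => by positivity
  have hkn : ∀ N : ℕ, (0 : ℝ) < N + 1 := fun N => by positivity
  have hint := fun N : ℕ => (S.integrable_energyError (hkn N) (hpn N) hQ).mono_measure
    (Measure.prod_mono hν le_rfl)
  have key : Tendsto (fun N : ℕ => ∫ p : ℝ × Rn n,
      energyError c (C / (N + 1)) Q (N + 1) (u p.1 p.2) (g p.1 p.2) ∂ν.prod volume)
      atTop (𝓝 (∫ _ : ℝ × Rn n, (0 : ℝ) ∂ν.prod volume)) := by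
    refine tendsto_integral_of_dominated_convergence _ (fun N => (hint N).1)
      ((S.integrable_sq_add_sq.mono_measure (Measure.prod_mono hν le_rfl)).const_mul
        (‖c‖ * C * Q * (n + 1) + 4 * ‖c‖ * Q)) (fun N => Eventually.of_forall fun p => ?_)
      (Eventually.of_forall fun p => ?_)
    · rw [Real.norm_of_nonneg (energyError_nonneg (hkn N) (hpn N) hQ _ _)]
      exact energyError_le (hkn N) (hpn N) (div_le_self hC (by simp)) hQ _ _
    · have h1 : Tendsto (fun N : ℕ => (N : ℝ) + 1) atTop atTop :=
        tendsto_natCast_atTop_atTop.atTop_add tendsto_const_nhds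
      have h2 : Tendsto (fun N : ℕ => C / ((N : ℝ) + 1)) atTop (𝓝 0) :=
        tendsto_const_nhds.div_atTop h1
      have h3 : Tendsto (fun N : ℕ => ‖u p.1 p.2‖ ^ 2 / ((N : ℝ) + 1 + ‖u p.1 p.2‖ ^ 2)) atTop
        (𝓝 0) := tendsto_const_nhds.div_atTop (h1.atTop_add tendsto_const_nhds)
      have h4 := (((h2.const_mul ‖c‖).mul_const Q).mul_const
        (n * ‖u p.1 p.2‖ ^ 2 + ‖g p.1 p.2‖ ^ 2)).add
        ((h3.const_mul (4 * ‖c‖ * Q)).mul_const (‖g p.1 p.2‖ ^ 2))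
      simp only [mul_zero, zero_mul, add_zero] at h4
      exact h4
  rw [integral_zero] at key
  exact key.congr fun N => integral_prod _ (hint N)

end MeasurableSolution

namespace MeasurableSolution

variable {n : ℕ} {c : ℂ} {U u : ℝ → Rn n → ℂ} {g : ℝ → Rn n → EuclideanSpace ℂ (Fin n)}
  {H : ℝ → Rn n → ℂ} {A k P R M γ : ℝ} {ζ q : Rn n → ℝ} {dζ dq : Fin n → Rn n → ℝ} {a : ℝ → ℝ}

theorem integrable_exp_mul_norm_sq {α Q : ℝ} (hq : Continuous q)
    (hQ : ∀ x, Real.exp (2 * α * q x) ≤ Q) {f : Rn n → ℂ} (hf : MemLp f 2) :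
    Integrable fun x => Real.exp (2 * α * q x) * ‖f x‖ ^ 2 := by
  refine (hf.integrable_norm_sq.const_mul Q).mono' ?_ (Eventually.of_forall fun x => ?_)
  · exact (by fun_prop : Continuous fun x => Real.exp (2 * α * q x)).aestronglyMeasurable.mul
      (hf.1.norm.pow 2)
  · rw [Real.norm_of_nonneg (by positivity)]
    gcongr
    exact hQ x

/-- Since the upper bound for the source term is nonnegative, the truncated weight may be enlarged
to the full exponential weight. Cauchy–Schwarz with that weight then separates `f` from `F`. -/
theorem integral_energyBound_le {Q α m : ℝ} (hk : 0 < k) (hζ : IsCutoff R P ζ dζ)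
    (hq : Continuous q)
    (hQ : ∀ x, Real.exp (2 * α * q x) ≤ Q) (hm : 0 ≤ m) {f h F : Rn n → ℂ}
    {G : Rn n → EuclideanSpace ℂ (Fin n)} (hf : MemLp f 2) (hF : MemLp F 2)
    (hi : Integrable fun x => energyBound c P Q k ζ q α x
      (f x, G x, (Metric.closedBall 0 (R + 1)).indicator h x))
    (he : Integrable fun x => energyError c P Q k (f x) (G x))
    (hle : ∀ᵐ x, inner ℝ (f x) (c * h x) ≤ m * ‖f x‖ ^ 2 + ‖c‖ * (‖f x‖ * ‖F x‖)) :
    ∫ x, energyBound c P Q k ζ q α x (f x, G x, (Metric.closedBall 0 (R + 1)).indicator h x) ≤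
      (∫ x, energyError c P Q k (f x) (G x)) +
        (2 * m * (∫ x, Real.exp (2 * α * q x) * ‖f x‖ ^ 2) + 2 * ‖c‖ *
          (√(∫ x, Real.exp (2 * α * q x) * ‖f x‖ ^ 2) *
            √(∫ x, Real.exp (2 * α * q x) * ‖F x‖ ^ 2))) := by
  have i1 := integrable_exp_mul_norm_sq hq hQ hf
  obtain ⟨i2, hCS⟩ := integral_mul_norm_mul_norm_le (w := fun x => Real.exp (2 * α * q x))
    (by fun_prop) (fun x => (Real.exp_pos _).le) hQ hf hF
  calc _ ≤ ∫ x, (energyError c P Q k (f x) (G x) +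
        2 * m * (Real.exp (2 * α * q x) * ‖f x‖ ^ 2) +
        2 * ‖c‖ * (Real.exp (2 * α * q x) * (‖f x‖ * ‖F x‖))) := by
        refine integral_mono_ae hi ((he.add (i1.const_mul _)).add (i2.const_mul _)) ?_
        filter_upwards [hle] with x hx
        unfold energyBound energyError
        rw [add_assoc (_ + _)]
        refine add_le_add le_rfl ?_
        have hr : 0 ≤ m * ‖f x‖ ^ 2 + ‖c‖ * (‖f x‖ * ‖F x‖) := by positivity
        have hw0 : 0 ≤ energyWeight k α ζ q x (f x) := by
          have := hζ.nonneg x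
          unfold energyWeight; positivity
        have hw1 : energyWeight k α ζ q x (f x) ≤ Real.exp (2 * α * q x) := by
          have z0 := hζ.nonneg x
          have z1 := hζ.le_one x
          have b1 : k / (k + ‖f x‖ ^ 2) ≤ 1 :=
            (div_le_one (by positivity)).2 (by linarith [sq_nonneg ‖f x‖])
          unfold energyWeight
          calc _ ≤ 1 * Real.exp (2 * α * q x) * 1 := by gcongr
            _ = _ := by ring
        have h1 : energyWeight k α ζ q x (f x) *
            inner ℝ (f x) (c * (Metric.closedBall 0 (R + 1)).indicator h x) ≤
            Real.exp (2 * α * q x) * (m * ‖f x‖ ^ 2 + ‖c‖ * (‖f x‖ * ‖F x‖)) := by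
          by_cases hxR : ‖x‖ ≤ R
          · rw [indicator_of_mem (by simpa using hxR.trans (by linarith))]
            calc _ ≤ energyWeight k α ζ q x (f x) * (m * ‖f x‖ ^ 2 + ‖c‖ * (‖f x‖ * ‖F x‖)) :=
                  mul_le_mul_of_nonneg_left hx hw0
              _ ≤ _ := mul_le_mul_of_nonneg_right hw1 hr
          · have : energyWeight k α ζ q x (f x) = 0 := by
              simp [energyWeight, hζ.eq_zero x (not_le.1 hxR)]
            rw [this, zero_mul]
            positivity
        calc _ ≤ 2 * (Real.exp (2 * α * q x) * (m * ‖f x‖ ^ 2 + ‖c‖ * (‖f x‖ * ‖F x‖))) := by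
              gcongr
          _ = _ := by ring
    _ = (∫ x, energyError c P Q k (f x) (G x)) +
        2 * m * (∫ x, Real.exp (2 * α * q x) * ‖f x‖ ^ 2) +
        2 * ‖c‖ * (∫ x, Real.exp (2 * α * q x) * (‖f x‖ * ‖F x‖)) := by
        rw [integral_add_three he (i1.const_mul _) (i2.const_mul _), integral_const_mul,
          integral_const_mul]
    _ ≤ _ := by
        rw [add_assoc]
        gcongr

theorem integrable_integral_energyBound (S : MeasurableSolution c U u g H) (ha : IsRiccati c A γ a)
    (hk : 0 < k) (hζ : IsCutoff R P ζ dζ) (hq : IsBoundedQuadratic M q dq) :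
    Integrable (fun p : ℝ × Rn n => energyBound c P (Real.exp (2 * γ * M)) k ζ q (a p.1) p.2
      (u p.1 p.2, g p.1 p.2, (Metric.closedBall 0 (R + 1)).indicator (H p.1) p.2))
      ((volume.restrict (Icc (0 : ℝ) 1)).prod volume) := by
  have hH : Integrable (fun p : ℝ × Rn n => (Metric.closedBall 0 (R + 1)).indicator (H p.1) p.2)
      ((volume.restrict (Icc (0 : ℝ) 1)).prod volume) := by
    have h1 := S.int_H (R + 1)
    rw [← Measure.restrict_univ (μ := volume.restrict (Icc (0 : ℝ) 1)),
      Measure.prod_restrict] at h1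
    have h2 := (integrable_indicator_iff
      (MeasurableSet.univ.prod measurableSet_closedBall)).2 h1
    refine h2.congr (Eventually.of_forall fun p => ?_)
    beta_reduce
    by_cases hp : p.2 ∈ Metric.closedBall (0 : Rn n) (R + 1)
    · rw [indicator_of_mem hp, indicator_of_mem (by simpa using hp)]
    · rw [indicator_of_notMem hp, indicator_of_notMem (by simpa using hp)]
  have hm : StronglyMeasurable fun p : ℝ × Rn n => (a p.1, p.2, u p.1 p.2, g p.1 p.2,
      (Metric.closedBall 0 (R + 1)).indicator (H p.1) p.2) :=
    (ha.meas.comp measurable_fst).stronglyMeasurable.prodMk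
      (measurable_snd.stronglyMeasurable.prodMk (S.meas_u.prodMk (S.meas_g.prodMk
        (stronglyMeasurable_indicator S.meas_H measurableSet_closedBall))))
  refine ((S.integrable_sq_add_sq.add hH.norm).const_mul (‖c‖ * P * Real.exp (2 * γ * M) * (n + 1) +
    4 * ‖c‖ * Real.exp (2 * γ * M) + 2 * (Real.exp (2 * γ * M) * √k * ‖c‖))).mono'
    ((continuous_energyBound hk hζ.cont hq.cont).comp_stronglyMeasurable hm).aestronglyMeasurable ?_
  have hae : ∀ᵐ p : ℝ × Rn n ∂(volume.restrict (Icc (0 : ℝ) 1)).prod volume,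
      p.1 ∈ Icc (0 : ℝ) 1 :=
    Measure.quasiMeasurePreserving_fst.ae (ae_restrict_mem measurableSet_Icc)
  filter_upwards [hae] with p hp
  exact abs_energyBound_le hk hζ.bound_nonneg hζ.nonneg hζ.le_one (exp_le_of_riccati ha hq hp) p.2
    (u p.1 p.2, g p.1 p.2, (Metric.closedBall 0 (R + 1)).indicator (H p.1) p.2)

/-- The weighted energy inequality. -/
theorem weighted_energy_le (S : MeasurableSolution c U u g H) (ha : IsRiccati c A γ a)
    (hA : 0 < A) (hc : c.re = A) (hq : IsBoundedQuadratic M q dq) {t : ℝ}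
    (ht : t ∈ Icc (0 : ℝ) 1) {m : ℝ → ℝ} {F : ℝ → Rn n → ℂ} (hm : ∀ s, 0 ≤ m s)
    (hF : ∀ᵐ s ∂volume.restrict (Ioc 0 t), MemLp (F s) 2)
    (hle : ∀ᵐ s ∂volume.restrict (Ioc 0 t), ∀ᵐ x,
      inner ℝ (u s x) (c * H s x) ≤ m s * ‖u s x‖ ^ 2 + ‖c‖ * (‖u s x‖ * ‖F s x‖))
    (hr : Integrable (fun s => 2 * m s * (∫ x, Real.exp (2 * a s * q x) * ‖u s x‖ ^ 2) + 2 * ‖c‖ *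
          (√(∫ x, Real.exp (2 * a s * q x) * ‖u s x‖ ^ 2) *
            √(∫ x, Real.exp (2 * a s * q x) * ‖F s x‖ ^ 2))) (volume.restrict (Ioc 0 t))) :
    ∫ x, Real.exp (2 * a t * q x) * ‖U t x‖ ^ 2 ≤
      (∫ x, Real.exp (2 * a 0 * q x) * ‖U 0 x‖ ^ 2) +
        ∫ s in Ioc 0 t, (2 * m s * (∫ x, Real.exp (2 * a s * q x) * ‖u s x‖ ^ 2) + 2 * ‖c‖ *
          (√(∫ x, Real.exp (2 * a s * q x) * ‖u s x‖ ^ 2) *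
            √(∫ x, Real.exp (2 * a s * q x) * ‖F s x‖ ^ 2))) := by
  have h0 : (0 : ℝ) ∈ Icc (0 : ℝ) 1 := ⟨le_rfl, zero_le_one⟩
  have hsub : Ioc 0 t ⊆ Icc (0 : ℝ) 1 := Ioc_subset_Icc_self.trans (Icc_subset_Icc_right ht.2)
  have hν : volume.restrict (Ioc 0 t) ≤ volume.restrict (Icc (0 : ℝ) 1) :=
    Measure.restrict_mono hsub le_rfl
  obtain ⟨C, hC, hcut⟩ := exists_isCutoff n
  choose ζ dζ hζ hζ1 using hcut
  set Q := Real.exp (2 * γ * M) with hQdef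
  have hQ0 : 0 ≤ Q := (Real.exp_pos _).le
  have hkn : ∀ N : ℕ, (0 : ℝ) < N + 1 := fun N => by positivity
  set r : ℝ → ℝ := fun s => 2 * m s * (∫ x, Real.exp (2 * a s * q x) * ‖u s x‖ ^ 2) + 2 * ‖c‖ *
          (√(∫ x, Real.exp (2 * a s * q x) * ‖u s x‖ ^ 2) *
            √(∫ x, Real.exp (2 * a s * q x) * ‖F s x‖ ^ 2)) with hrdef
  have hN : ∀ N : ℕ, ∫ x, ζ N x * Real.exp (2 * a t * q x) * truncLog (N + 1) (‖U t x‖ ^ 2) ≤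
      (∫ x, Real.exp (2 * a 0 * q x) * ‖U 0 x‖ ^ 2) +
        ((∫ s in Ioc 0 t, ∫ x, energyError c (C / (N + 1)) Q (N + 1) (u s x) (g s x)) +
        ∫ s in Ioc 0 t, r s) := fun N => by
    have iB := (S.integrable_integral_energyBound ha (hkn N) (hζ N) hq).mono_measure
      (Measure.prod_mono hν le_rfl)
    have iE := (S.integrable_energyError (hkn N) (hζ N).bound_nonneg hQ0).mono_measure
      (Measure.prod_mono hν le_rfl)
    refine (S.energy_le ha hA hc (hkn N) (hζ N) hq ht).trans (add_le_add ?_ ?_)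
    · have hQ := exp_le_of_riccati ha hq h0
      refine integral_mono_of_nonneg (Eventually.of_forall fun x => ?_)
        (integrable_exp_mul_norm_sq hq.cont hQ (S.memLp 0 h0)) (Eventually.of_forall fun x => ?_)
      · exact mul_nonneg (mul_nonneg ((hζ N).nonneg x) (Real.exp_pos _).le)
          (truncLog_nonneg (hkn N) (sq_nonneg _))
      · refine mul_le_mul ?_ (truncLog_le (hkn N) (sq_nonneg _))
          (truncLog_nonneg (hkn N) (sq_nonneg _)) (Real.exp_pos _).le
        exact mul_le_of_le_one_left (Real.exp_pos _).le ((hζ N).le_one x)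
    · rw [← integral_add iE.integral_prod_left hr]
      refine integral_mono_ae iB.integral_prod_left (iE.integral_prod_left.add hr) ?_
      filter_upwards [iB.prod_right_ae, iE.prod_right_ae, hF, hle,
        ae_mono hν (ae_memLp S.meas_u S.sq_u), ae_mono hν (ae_restrict_mem measurableSet_Icc)]
        with s h1 h2 h3 h4 h5 h6
      exact integral_energyBound_le (hkn N) (hζ N) hq.cont (exp_le_of_riccati ha hq h6) (hm s) h5 h3
        h1 h2 h4
  have hlim := (tendsto_const_nhds (x := ∫ x, Real.exp (2 * a 0 * q x) * ‖U 0 x‖ ^ 2)).add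
    ((S.tendsto_integral_energyError hC hQ0 hν).add
      (tendsto_const_nhds (x := ∫ s in Ioc 0 t, r s)))
  rw [zero_add] at hlim
  -- On the left the weighted truncated densities increase to the full one only in the sense of
  -- dominated convergence: they lie below `exp(2aq)‖U t‖²`, integrable because `q` is bounded.
  refine le_of_tendsto_of_tendsto' ?_ hlim hN
  have hQ := exp_le_of_riccati ha hq ht
  have hUt := S.memLp t ht
  refine tendsto_integral_of_dominated_convergence _ (fun N => ?_)
    (integrable_exp_mul_norm_sq hq.cont hQ hUt)
    (fun N => Eventually.of_forall fun x => ?_) (Eventually.of_forall fun x => ?_)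
  · have c1 : Continuous fun x => ζ N x * Real.exp (2 * a t * q x) := by
      have := (hζ N).cont
      have := hq.cont
      fun_prop
    exact c1.aestronglyMeasurable.mul
      ((contDiff_truncLog_norm_sq (hkn N)).continuous.comp_aestronglyMeasurable hUt.1)
  · have t0 := truncLog_nonneg (hkn N) (sq_nonneg ‖U t x‖)
    rw [Real.norm_of_nonneg (mul_nonneg (mul_nonneg ((hζ N).nonneg x) (Real.exp_pos _).le) t0)]
    refine mul_le_mul ?_ (truncLog_le (hkn N) (sq_nonneg _)) t0 (Real.exp_pos _).le
    exact mul_le_of_le_one_left (Real.exp_pos _).le ((hζ N).le_one x)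
  · refine ((tendsto_truncLog (‖U t x‖ ^ 2) (sq_nonneg _)).const_mul
      (Real.exp (2 * a t * q x))).congr' ?_
    obtain ⟨N₀, hN₀⟩ := exists_nat_gt ‖x‖
    filter_upwards [eventually_ge_atTop N₀] with N hNN
    have : (N₀ : ℝ) ≤ N := by exact_mod_cast hNN
    rw [hζ1 N x (by linarith), one_mul]

end MeasurableSolution

/-! ### Representatives, the Riccati solution and weighted norms. -/

theorem slabMeasure_eq_prod (n : ℕ) :
    slabMeasure n = (volume.restrict (Icc (0 : ℝ) 1)).prod volume := by
  rw [slabMeasure, Measure.volume_eq_prod, ← Measure.prod_restrict, Measure.restrict_univ]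

theorem HasWeakGradient.congr {n : ℕ} {f f' : Rn n → ℂ} {g g' : Rn n → EuclideanSpace ℂ (Fin n)}
    (h : HasWeakGradient f g) (hf : f =ᵐ[volume] f') (hg : g =ᵐ[volume] g') :
    HasWeakGradient f' g' := by
  refine ⟨h.1.congr hf, h.2.1.congr hg, fun φ hφ i => ?_⟩
  have e1 : ∫ x, fderiv ℝ φ x (EuclideanSpace.single i 1) • f' x =
      ∫ x, fderiv ℝ φ x (EuclideanSpace.single i 1) • f x :=
    integral_congr_ae (hf.mono fun x hx => by simp only [hx])
  have e2 : ∫ x, φ x • g' x i = ∫ x, φ x • g x i :=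
    integral_congr_ae (hg.mono fun x hx => by simp only [hx])
  rw [e1, e2, h.2.2 φ hφ i]

/-- A jointly a.e. strongly measurable function on the slab has a strongly measurable
representative, almost everywhere equal to it on almost every time slice. -/
theorem exists_stronglyMeasurable_slab {n : ℕ} {E : Type*} [NormedAddCommGroup E]
    {f : ℝ → Rn n → E}
    (hf : AEStronglyMeasurable (fun p : ℝ × Rn n => f p.1 p.2)
      ((volume.restrict (Icc (0 : ℝ) 1)).prod volume)) :
    ∃ f' : ℝ → Rn n → E, (StronglyMeasurable fun p : ℝ × Rn n => f' p.1 p.2) ∧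
      ((fun p : ℝ × Rn n => f p.1 p.2) =ᵐ[(volume.restrict (Icc (0 : ℝ) 1)).prod volume]
        fun p => f' p.1 p.2) ∧
      ∀ᵐ s ∂volume.restrict (Icc (0 : ℝ) 1), f s =ᵐ[volume] f' s :=
  ⟨fun s x => hf.mk _ (s, x), hf.stronglyMeasurable_mk, hf.ae_eq_mk,
    Measure.ae_ae_of_ae_prod hf.ae_eq_mk⟩

/-- The original `u` is kept for its values at every time, while the representatives agree with the
data on almost every slice. That suffices, because they enter the equation only under time
integrals. -/
theorem exists_measurableSolution {n : ℕ} {A B : ℝ} {V F u : ℝ → Rn n → ℂ}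
    (hV : AEStronglyMeasurable (fun p : ℝ × Rn n => V p.1 p.2) (slabMeasure n))
    (hF : AEStronglyMeasurable (fun p : ℝ × Rn n => F p.1 p.2) (slabMeasure n))
    (hu' : MemL2H1 u) (hsol : IsWeakSolution A B V F u) :
    ∃ (u' : ℝ → Rn n → ℂ) (g' : ℝ → Rn n → EuclideanSpace ℂ (Fin n)) (H' : ℝ → Rn n → ℂ),
      MeasurableSolution ((A : ℂ) + (B : ℂ) * Complex.I) u u' g' H' ∧
      ∀ᵐ s ∂volume.restrict (Icc (0 : ℝ) 1),
        (fun x => V s x * u s x + F s x) =ᵐ[volume] H' s := by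
  obtain ⟨h2u, G, h2G, hgrad⟩ := hu'
  rw [slabMeasure_eq_prod] at hV hF h2u h2G
  have hum := h2u.1
  obtain ⟨u', hu'm, hu'p, hu'e⟩ := exists_stronglyMeasurable_slab hum
  obtain ⟨g', hg'm, hg'p, hg'e⟩ := exists_stronglyMeasurable_slab h2G.1
  obtain ⟨H', hH'm, hH'p, hH'e⟩ := exists_stronglyMeasurable_slab
    (f := fun s x => V s x * u s x + F s x) ((hV.mul hum).add hF)
  refine ⟨u', g', H', ⟨hu'm, hg'm, hH'm, hsol.memLp, hu'e, ?_, h2u.ae_eq hu'p, h2G.ae_eq hg'p,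
    fun R => ?_, fun φ hφ t ht => ?_⟩, hH'e⟩
  · filter_upwards [hgrad, hu'e, hg'e] with s h1 h2 h3 using h1.congr h2 h3
  · have h1 := hsol.locallyIntegrableOn.integrableOn_compact_subset
      (t := Icc (0 : ℝ) 1 ×ˢ Metric.closedBall (0 : Rn n) R)
      (prod_mono le_rfl (subset_univ _)) (isCompact_Icc.prod (isCompact_closedBall _ _))
    rw [IntegrableOn, Measure.volume_eq_prod, ← Measure.prod_restrict] at h1
    refine h1.congr (ae_mono (Measure.prod_mono le_rfl Measure.restrict_le_self) hH'p)
  · rw [hsol.equation φ hφ t ht]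
    congr 1
    rw [intervalIntegral.integral_of_le ht.1, intervalIntegral.integral_of_le ht.1]
    refine integral_congr_ae (ae_mono (Measure.restrict_mono
      (Ioc_subset_Icc_self.trans (Icc_subset_Icc_right ht.2)) le_rfl) ?_)
    filter_upwards [hu'e, hH'e] with s h1 h2
    refine integral_congr_ae ?_
    filter_upwards [h1, h2] with x h1 h2
    rw [← h1, ← h2]

/-- For `γ > 0` the equation says that `1/a` grows linearly, `1/a = 1/γ + 4‖c‖²t/A`. The closed form
also covers `γ = 0`. -/
theorem isRiccati_decayRate {A B γ : ℝ} (hA : 0 < A) (hγ : 0 ≤ γ) {c : ℂ}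
    (hc : ‖c‖ ^ 2 = A ^ 2 + B ^ 2) : IsRiccati c A γ (decayRate A B γ) := by
  have hD : ∀ t ∈ Icc (0 : ℝ) 1, 0 < A + 4 * γ * (A ^ 2 + B ^ 2) * t := fun t ht => by
    have := ht.1
    positivity
  refine ⟨?_, fun t ht => ?_, fun t ht => ?_, fun t ht => ?_⟩
  · unfold decayRate
    fun_prop
  · have h1 : HasDerivAt (fun t => A + 4 * γ * (A ^ 2 + B ^ 2) * t)
        (4 * γ * (A ^ 2 + B ^ 2) * 1) t := ((hasDerivAt_id t).const_mul _).const_add A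
    have h2 := (hasDerivAt_const t (γ * A)).fun_div h1 (hD t ht).ne'
    refine h2.congr_deriv ?_
    have := (hD t ht).ne'
    unfold decayRate
    rw [hc]
    field_simp
    ring
  · exact div_nonneg (by positivity) (hD t ht).le
  · unfold decayRate
    rw [div_le_iff₀ (hD t ht)]
    have h1 : 0 ≤ 4 * γ * (A ^ 2 + B ^ 2) * t := by have := ht.1; positivity
    nlinarith

theorem decayRate_zero {A B γ : ℝ} (hA : 0 < A) : decayRate A B γ 0 = γ := by
  unfold decayRate
  simp [hA.ne']

section norms

variable {n : ℕ}

theorem ofReal_sqrt_integral_norm_sq {E : Type*} [NormedAddCommGroup E] {f : Rn n → E}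
    (hf : MemLp f 2) : ENNReal.ofReal √(∫ x, ‖f x‖ ^ 2) = eLpNorm f 2 volume := by
  rw [hf.eLpNorm_eq_integral_rpow_norm (by norm_num) (by norm_num), Real.sqrt_eq_rpow]
  simp

theorem norm_exp_smul_sq (α r : ℝ) (z : ℂ) :
    ‖Real.exp (α * r) • z‖ ^ 2 = Real.exp (2 * α * r) * ‖z‖ ^ 2 := by
  rw [norm_smul, Real.norm_of_nonneg (Real.exp_pos _).le, mul_pow, ← Real.exp_nat_mul]
  congr 2
  push_cast
  ring

theorem memLp_exp_smul {q : Rn n → ℝ} {α M : ℝ} (hq : Continuous q) (hM : ∀ x, α * q x ≤ M)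
    {f : Rn n → ℂ} (hf : MemLp f 2) : MemLp (fun x => Real.exp (α * q x) • f x) 2 := by
  refine MemLp.of_le_mul (c := Real.exp M) hf ?_ (Eventually.of_forall fun x => ?_)
  · exact (by fun_prop : Continuous fun x => Real.exp (α * q x)).aestronglyMeasurable.smul hf.1
  · rw [norm_smul, Real.norm_of_nonneg (Real.exp_pos _).le]
    gcongr
    exact hM x

theorem ofReal_sqrt_weighted {q : Rn n → ℝ} {α M : ℝ} (hq : Continuous q)
    (hM : ∀ x, α * q x ≤ M) {f : Rn n → ℂ} (hf : MemLp f 2) :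
    ENNReal.ofReal √(∫ x, Real.exp (2 * α * q x) * ‖f x‖ ^ 2) =
      eLpNorm (fun x => Real.exp (α * q x) • f x) 2 volume := by
  rw [← ofReal_sqrt_integral_norm_sq (memLp_exp_smul hq hM hf)]
  simp_rw [norm_exp_smul_sq]

theorem eLpNorm_exp_smul_le_gaussianNorm {q : Rn n → ℝ} {α : ℝ} (hα : 0 ≤ α)
    (hq : ∀ x, q x ≤ ‖x‖ ^ 2) (f : Rn n → ℂ) :
    eLpNorm (fun x => Real.exp (α * q x) • f x) 2 volume ≤ gaussianNorm α f := by
  refine eLpNorm_mono fun x => ?_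
  rw [norm_smul, norm_smul, Real.norm_of_nonneg (Real.exp_pos _).le,
    Real.norm_of_nonneg (Real.exp_pos _).le]
  gcongr
  exact hq x

theorem memLp_of_gaussianNorm_lt_top {α : ℝ} (hα : 0 ≤ α) {f : Rn n → ℂ}
    (hf : AEStronglyMeasurable f) (h : gaussianNorm α f < ⊤) : MemLp f 2 := by
  refine ⟨hf, lt_of_le_of_lt ?_ h⟩
  have := eLpNorm_exp_smul_le_gaussianNorm (q := fun _ => 0) hα (fun x => sq_nonneg ‖x‖) f
  simpa using this

theorem measurable_gaussianNorm {f : ℝ → Rn n → ℂ}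
    (hf : StronglyMeasurable fun p : ℝ × Rn n => f p.1 p.2) {a : ℝ → ℝ} (ha : Measurable a) :
    Measurable fun s => gaussianNorm (a s) (f s) := by
  unfold gaussianNorm
  simp_rw [eLpNorm_eq_lintegral_rpow_enorm_toReal two_ne_zero ENNReal.ofNat_ne_top]
  refine Measurable.pow_const ?_ _
  refine Measurable.lintegral_prod_right' (f := fun p : ℝ × Rn n =>
    ‖Real.exp (a p.1 * ‖p.2‖ ^ 2) • f p.1 p.2‖ₑ ^ (2 : ℝ≥0∞).toReal) ?_
  refine Measurable.pow_const (Measurable.enorm ?_) _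
  exact Measurable.smul (by fun_prop : Measurable fun p : ℝ × Rn n =>
    Real.exp (a p.1 * ‖p.2‖ ^ 2)) hf.measurable

/-- The essential supremum is at most `r` exactly when the section of `{r < ‖f‖}` is null, and the
measure of a section is measurable in the parameter. -/
theorem measurable_eLpNorm_top {f : ℝ → Rn n → ℝ}
    (hf : StronglyMeasurable fun p : ℝ × Rn n => f p.1 p.2) :
    Measurable fun s => eLpNorm (f s) ⊤ volume := by
  refine measurable_of_Iic fun r => ?_
  have e : (fun s => eLpNorm (f s) ⊤ volume) ⁻¹' Iic r =
      {s | volume (Prod.mk s ⁻¹' {p : ℝ × Rn n | r < ‖f p.1 p.2‖ₑ}) = 0} := by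
    ext s
    simp only [mem_preimage, mem_Iic, mem_ofPred_eq, eLpNorm_exponent_top, eLpNormEssSup]
    have h1 : (essSup (fun x => ‖f s x‖ₑ) volume ≤ r) ↔ ∀ᵐ x, ‖f s x‖ₑ ≤ r :=
      ⟨fun h => (ENNReal.ae_le_essSup _).mono fun x hx => hx.trans h,
        fun h => essSup_le_of_ae_le _ h⟩
    rw [h1, ae_iff]
    simp only [not_le]
    rfl
  rw [e]
  exact measurable_measure_prodMk_left (measurableSet_lt measurable_const hf.measurable.enorm)
    (measurableSet_singleton 0)

end norms

/-! ### Gronwall's inequality with a bounded weight. -/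

namespace MeasurableSolution

variable {n : ℕ} {c : ℂ} {U u : ℝ → Rn n → ℂ} {g : ℝ → Rn n → EuclideanSpace ℂ (Fin n)}
  {H : ℝ → Rn n → ℂ} {A M γ : ℝ} {q : Rn n → ℝ} {dq : Fin n → Rn n → ℝ} {a : ℝ → ℝ}

theorem measurable_integral_weighted {f : ℝ → Rn n → ℂ}
    (hf : StronglyMeasurable fun p : ℝ × Rn n => f p.1 p.2) (ha : Measurable a)
    (hq : Continuous q) :
    StronglyMeasurable fun s => ∫ x, Real.exp (2 * a s * q x) * ‖f s x‖ ^ 2 := by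
  refine StronglyMeasurable.integral_prod_right' (f := fun p : ℝ × Rn n =>
    Real.exp (2 * a p.1 * q p.2) * ‖f p.1 p.2‖ ^ 2) ?_
  have h1 : Measurable fun p : ℝ × Rn n => Real.exp (2 * a p.1 * q p.2) := by
    have := hq.measurable
    fun_prop
  exact h1.stronglyMeasurable.mul (hf.norm.pow 2)

/-- The weighted `L²` bound with a bounded weight. -/
theorem sqrt_weighted_energy_le (S : MeasurableSolution c U u g H) (ha : IsRiccati c A γ a)
    (hA : 0 < A) (hc : c.re = A) (hq : IsBoundedQuadratic M q dq) {T : ℝ}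
    (hT : T ∈ Icc (0 : ℝ) 1) {m : ℝ → ℝ} {F : ℝ → Rn n → ℂ} (hm : ∀ s, 0 ≤ m s)
    (hmi : IntervalIntegrable m volume 0 T)
    (hF : ∀ᵐ s ∂volume.restrict (Ioc 0 T), MemLp (F s) 2)
    (hle : ∀ᵐ s ∂volume.restrict (Ioc 0 T), ∀ᵐ x,
      inner ℝ (u s x) (c * H s x) ≤ m s * ‖u s x‖ ^ 2 + ‖c‖ * (‖u s x‖ * ‖F s x‖))
    (hfi : IntervalIntegrable (fun s => √(∫ x, Real.exp (2 * a s * q x) * ‖F s x‖ ^ 2))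
      volume 0 T) {K : ℝ}
    (hK : ∀ᵐ s ∂volume.restrict (Icc (0 : ℝ) 1), ∫ x, ‖u s x‖ ^ 2 ≤ K) :
    Real.exp (-∫ s in (0 : ℝ)..T, m s) * √(∫ x, Real.exp (2 * a T * q x) * ‖U T x‖ ^ 2) ≤
      √(∫ x, Real.exp (2 * a 0 * q x) * ‖U 0 x‖ ^ 2) +
        ‖c‖ * ∫ s in (0 : ℝ)..T, √(∫ x, Real.exp (2 * a s * q x) * ‖F s x‖ ^ 2) := by
  set f : ℝ → ℝ := fun s => √(∫ x, Real.exp (2 * a s * q x) * ‖F s x‖ ^ 2) with hf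
  -- `y` is meaningful at every time, including the endpoint `T`. Its twin `y'`, built from the
  -- jointly measurable representative, agrees with it at almost every time and provides
  -- measurability in `s`.
  set y : ℝ → ℝ := fun s => ∫ x, Real.exp (2 * a s * q x) * ‖U s x‖ ^ 2 with hy
  set y' : ℝ → ℝ := fun s => ∫ x, Real.exp (2 * a s * q x) * ‖u s x‖ ^ 2 with hy'
  set Q := Real.exp (2 * γ * M)
  have hsubT : ∀ t ∈ Icc 0 T, Ioc 0 t ⊆ Icc (0 : ℝ) 1 := fun t ht =>
    Ioc_subset_Icc_self.trans (Icc_subset_Icc_right (ht.2.trans hT.2))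
  have hνT : volume.restrict (Ioc 0 T) ≤ volume.restrict (Icc (0 : ℝ) 1) :=
    Measure.restrict_mono (hsubT T ⟨hT.1, le_rfl⟩) le_rfl
  have hyy : ∀ᵐ s ∂volume.restrict (Icc (0 : ℝ) 1), y s = y' s := by
    filter_upwards [S.ae_eq] with s hs
    exact integral_congr_ae (hs.mono fun x hx => by simp only [hx])
  have hy0 : ∀ s, 0 ≤ y s := fun s => integral_nonneg fun x => by positivity
  -- The `L^∞` in time bound enters here: multiplied by the merely integrable `m` and `f`, a bounded
  -- `y'` still gives an integrable right-hand side.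
  have hyb : ∀ᵐ s ∂volume.restrict (Icc (0 : ℝ) 1), y' s ≤ Q * K := by
    filter_upwards [ae_restrict_mem measurableSet_Icc, hK, ae_memLp S.meas_u S.sq_u]
      with s hs h1 h2
    have hQ := exp_le_of_riccati ha hq hs
    calc y' s ≤ ∫ x, Q * ‖u s x‖ ^ 2 := by
          refine integral_mono (integrable_exp_mul_norm_sq hq.cont hQ h2)
            (h2.integrable_norm_sq.const_mul Q) fun x => ?_
          exact mul_le_mul_of_nonneg_right (hQ x) (sq_nonneg _)
      _ = Q * ∫ x, ‖u s x‖ ^ 2 := integral_const_mul _ _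
      _ ≤ Q * K := mul_le_mul_of_nonneg_left h1 (Real.exp_pos _).le
  have hy's : StronglyMeasurable y' := measurable_integral_weighted S.meas_u ha.meas hq.cont
  have hr' : Integrable (fun s => 2 * m s * y' s + 2 * ‖c‖ * (√(y' s) * f s))
      (volume.restrict (Ioc 0 T)) := by
    have hb := ae_mono hνT hyb
    refine Integrable.add ?_ (Integrable.const_mul ?_ _)
    · refine (hmi.1.const_mul 2).mul_bdd (c := Q * K) hy's.aestronglyMeasurable ?_
      filter_upwards [hb] with s hs
      rwa [Real.norm_of_nonneg (integral_nonneg fun x => by positivity)]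
    · refine hfi.1.bdd_mul (c := √(Q * K))
        hy's.measurable.sqrt.aestronglyMeasurable ?_
      filter_upwards [hb] with s hs
      rw [Real.norm_of_nonneg (Real.sqrt_nonneg _)]
      exact Real.sqrt_le_sqrt hs
  have hrr : ∀ᵐ s ∂volume.restrict (Icc (0 : ℝ) 1),
      2 * m s * y' s + 2 * ‖c‖ * (√(y' s) * f s) = 2 * m s * y s + 2 * ‖c‖ * (√(y s) * f s) := by
    filter_upwards [hyy] with s hs
    rw [hs]
  refine sqrt_le_of_le_integral (y := y) hT.1 (norm_nonneg c) (hy0 0) hm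
    (fun s => Real.sqrt_nonneg _) hy0 hmi hfi ?_ fun t ht => ?_
  · rw [intervalIntegrable_iff_integrableOn_Ioc_of_le hT.1]
    exact hr'.congr (ae_mono hνT hrr)
  · have hsub2 : volume.restrict (Ioc 0 t) ≤ volume.restrict (Ioc 0 T) :=
      Measure.restrict_mono (Ioc_subset_Ioc_right ht.2) le_rfl
    refine (S.weighted_energy_le ha hA hc hq ⟨ht.1, ht.2.trans hT.2⟩ hm (ae_mono hsub2 hF)
      (ae_mono hsub2 hle) (hr'.mono_measure hsub2)).trans_eq ?_
    rw [intervalIntegral.integral_of_le ht.1]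
    congr 1
    exact integral_congr_ae (ae_mono (hsub2.trans hνT) hrr)

end MeasurableSolution

/-! ### The potential, the limit of the weights and the conclusion. -/

theorem potential_inner_le {A B m : ℝ} (hA : 0 < A) {V w F : ℂ}
    (hm : ‖A * max V.re 0 - B * V.im‖ ≤ m) :
    inner ℝ w (((A : ℂ) + (B : ℂ) * Complex.I) * (V * w + F)) ≤
      m * ‖w‖ ^ 2 + ‖(A : ℂ) + (B : ℂ) * Complex.I‖ * (‖w‖ * ‖F‖) := by
  rw [mul_add, inner_add_right, ← mul_assoc, real_inner_mul_self]
  refine add_le_add (mul_le_mul_of_nonneg_right ?_ (sq_nonneg _)) ?_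
  · have h1 : (((A : ℂ) + (B : ℂ) * Complex.I) * V).re = A * V.re - B * V.im := by
      simp [Complex.mul_re]
    rw [h1]
    have h2 := (le_abs_self _).trans hm
    have h3 : A * V.re ≤ A * max V.re 0 := mul_le_mul_of_nonneg_left (le_max_left _ _) hA.le
    linarith
  · refine (le_abs_self _).trans ((abs_real_inner_mul_le _ _ _).trans_eq ?_)
    ring

theorem aemeasurable_potential {n : ℕ} {A B : ℝ} {V : ℝ → Rn n → ℂ}
    (hV : AEStronglyMeasurable (fun p : ℝ × Rn n => V p.1 p.2) (slabMeasure n)) :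
    AEMeasurable (fun s => eLpNorm (fun x => A * max (V s x).re 0 - B * (V s x).im) ⊤ volume)
      (volume.restrict (Icc (0 : ℝ) 1)) := by
  rw [slabMeasure_eq_prod] at hV
  obtain ⟨V', hm, -, he⟩ := exists_stronglyMeasurable_slab hV
  have hc : Continuous fun z : ℂ => A * max z.re 0 - B * z.im := by fun_prop
  refine ⟨_, measurable_eLpNorm_top
    (f := fun s x => A * max (V' s x).re 0 - B * (V' s x).im) (hc.comp_stronglyMeasurable hm), ?_⟩
  filter_upwards [he] with s hs
  exact eLpNorm_congr_ae (hs.mono fun x hx => by simp only [hx])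

theorem exists_integral_sq_le {n : ℕ} {u u' : ℝ → Rn n → ℂ} (hu : MemLinftyL2 u)
    (hum : ∀ᵐ s ∂volume.restrict (Icc (0 : ℝ) 1), MemLp (u' s) 2)
    (he : ∀ᵐ s ∂volume.restrict (Icc (0 : ℝ) 1), u s =ᵐ[volume] u' s) :
    ∃ K : ℝ, ∀ᵐ s ∂volume.restrict (Icc (0 : ℝ) 1), ∫ x, ‖u' s x‖ ^ 2 ≤ K := by
  obtain ⟨-, C, hC, hle⟩ := hu
  refine ⟨C.toReal ^ 2, ?_⟩
  filter_upwards [hum, he, hle] with s h1 h2 h3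
  rw [eLpNorm_congr_ae h2, ← ofReal_sqrt_integral_norm_sq h1] at h3
  have h4 := (ENNReal.ofReal_le_iff_le_toReal hC.ne).1 h3
  exact (Real.sqrt_le_left ENNReal.toReal_nonneg).1 h4

theorem ereal_exp_neg_coe {M : ℝ≥0∞} (hM : M ≠ ⊤) :
    EReal.exp (-(M : EReal)) = ENNReal.ofReal (Real.exp (-M.toReal)) := by
  lift M to NNReal using hM
  rw [← EReal.exp_coe]
  rfl

theorem tendsto_boundedQuadratic {n : ℕ} (x : Rn n) :
    Tendsto (fun j : ℕ => boundedQuadratic n (1 / (j + 1)) x) atTop (𝓝 (‖x‖ ^ 2)) := by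
  have h1 : Tendsto (fun j : ℕ => 1 + 1 / ((j : ℝ) + 1) * ‖x‖ ^ 2) atTop
      (𝓝 (1 + 0 * ‖x‖ ^ 2)) :=
    tendsto_const_nhds.add (tendsto_one_div_add_atTop_nhds_zero_nat.mul_const _)
  have h2 := (tendsto_const_nhds (x := ‖x‖ ^ 2)).div h1 (by simp)
  rw [zero_mul, add_zero, div_one] at h2
  exact h2

theorem boundedQuadratic_le {n : ℕ} {δ : ℝ} (hδ : 0 < δ) (x : Rn n) :
    boundedQuadratic n δ x ≤ ‖x‖ ^ 2 :=
  div_le_self (sq_nonneg _) (by have := sq_nonneg ‖x‖; nlinarith)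

/-- Fatou's lemma along bounded weights converging pointwise to the Gaussian one. Finiteness of the
Gaussian norm is a consequence when `b` is finite, not an assumption. -/
theorem gaussianNorm_le_of_boundedQuadratic {n : ℕ} {α : ℝ} {f : Rn n → ℂ}
    (hf : AEStronglyMeasurable f) {b : ℝ≥0∞}
    (h : ∀ j : ℕ, eLpNorm (fun x => Real.exp (α * boundedQuadratic n (1 / (j + 1)) x) • f x) 2
      volume ≤ b) : gaussianNorm α f ≤ b := by
  refine (Lp.eLpNorm_lim_le_liminf_eLpNorm (f := fun j : ℕ => fun x =>
    Real.exp (α * boundedQuadratic n (1 / (j + 1)) x) • f x) (fun j => ?_) _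
    (Eventually.of_forall fun x => ?_)).trans ?_
  · have := (isBoundedQuadratic (n := n) (δ := 1 / ((j : ℝ) + 1)) (by positivity)).cont
    exact (by fun_prop : Continuous fun x =>
      Real.exp (α * boundedQuadratic n (1 / (j + 1)) x)).aestronglyMeasurable.smul hf
  · exact (((tendsto_boundedQuadratic x).const_mul α).rexp).smul_const _
  · exact (liminf_le_liminf (Eventually.of_forall h)).trans (by simp)

theorem aemeasurable_gaussianNorm {n : ℕ} {F F' : ℝ → Rn n → ℂ} {a : ℝ → ℝ} (ha : Measurable a)
    {ν : Measure ℝ} (hF' : StronglyMeasurable fun p : ℝ × Rn n => F' p.1 p.2)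
    (he : ∀ᵐ s ∂ν, F s =ᵐ[volume] F' s) :
    AEMeasurable (fun s => gaussianNorm (a s) (F s)) ν := by
  refine ⟨_, measurable_gaussianNorm hF' ha, ?_⟩
  filter_upwards [he] with s hs
  exact eLpNorm_congr_ae (hs.mono fun x hx => by simp only [hx])

theorem mainTheorem9 (n : ℕ) (A B : ℝ) (hA : 0 < A)
    (V F u : ℝ → Rn n → ℂ)
    (hV : AEStronglyMeasurable (fun p : ℝ × Rn n => V p.1 p.2) (slabMeasure n))
    (hF : AEStronglyMeasurable (fun p : ℝ × Rn n => F p.1 p.2) (slabMeasure n))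
    (hu : MemLinftyL2 u) (hu' : MemL2H1 u)
    (hsol : IsWeakSolution A B V F u)
    (γ : ℝ) (hγ : 0 ≤ γ) (T : ℝ) (hT : T ∈ Icc (0 : ℝ) 1) :
    EReal.exp (-(potentialNorm A B V T : EReal)) * gaussianNorm (decayRate A B γ T) (u T) ≤
      gaussianNorm γ (u 0) +
        ENNReal.ofReal (Real.sqrt (A ^ 2 + B ^ 2)) *
          ∫⁻ t in Icc (0 : ℝ) T, gaussianNorm (decayRate A B γ t) (F t) := by
  -- The infinite cases are settled by the conventions `e^{-∞} = 0` and `0 · ∞ = 0`, or by an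
  -- infinite right-hand side. Afterwards all three quantities are finite and real-valued estimates
  -- apply.
  rcases eq_or_ne (potentialNorm A B V T) ⊤ with hM | hM
  · simp [hM]
  rcases eq_or_ne (gaussianNorm γ (u 0)) ⊤ with hI | hI
  · simp [hI]
  set c : ℂ := (A : ℂ) + (B : ℂ) * Complex.I with hcdef
  have hcn : ‖c‖ = √(A ^ 2 + B ^ 2) := Complex.norm_add_mul_I A B
  have hcn2 : ‖c‖ ^ 2 = A ^ 2 + B ^ 2 := by rw [hcn, Real.sq_sqrt (by positivity)]
  have hc : c.re = A := by simp [hcdef]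
  have hcpos : 0 < √(A ^ 2 + B ^ 2) := by positivity
  rcases eq_or_ne (∫⁻ t in Icc (0 : ℝ) T, gaussianNorm (decayRate A B γ t) (F t)) ⊤ with hFi | hFi
  · rw [hFi, ENNReal.mul_top (by simpa using hcpos), add_top]
    exact le_top
  set a := decayRate A B γ with hadef
  have ha : IsRiccati c A γ a := isRiccati_decayRate hA hγ hcn2
  obtain ⟨u', g', H', S, hH'⟩ := exists_measurableSolution hV hF hu' hsol
  have hFm := hF
  rw [slabMeasure_eq_prod] at hFm
  obtain ⟨F', hF'm, -, hF'e⟩ := exists_stronglyMeasurable_slab hFm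
  have h0 : (0 : ℝ) ∈ Icc (0 : ℝ) 1 := ⟨le_rfl, zero_le_one⟩
  have hν1 : volume.restrict (Icc 0 T) ≤ volume.restrict (Icc (0 : ℝ) 1) :=
    Measure.restrict_mono (Icc_subset_Icc_right hT.2) le_rfl
  have hν0 : volume.restrict (Ioc 0 T) = volume.restrict (Icc 0 T) :=
    Measure.restrict_congr_set Ioc_ae_eq_Icc
  set mE : ℝ → ℝ≥0∞ := fun s =>
    eLpNorm (fun x => A * max (V s x).re 0 - B * (V s x).im) ⊤ volume with hmE
  have hmEm : AEMeasurable mE (volume.restrict (Icc 0 T)) :=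
    (aemeasurable_potential hV).mono_measure hν1
  have hmlt : ∀ᵐ s ∂volume.restrict (Icc 0 T), mE s < ⊤ := ae_lt_top' hmEm hM
  set m : ℝ → ℝ := fun s => (mE s).toReal with hm
  have hmi : IntervalIntegrable m volume 0 T := by
    rw [intervalIntegrable_iff_integrableOn_Ioc_of_le hT.1, IntegrableOn, hν0]
    exact integrable_toReal_of_lintegral_ne_top hmEm hM
  have hmint : ∫ s in (0 : ℝ)..T, m s = (potentialNorm A B V T).toReal := by
    rw [intervalIntegral.integral_of_le hT.1, hν0]
    exact integral_toReal hmEm hmlt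
  set fE : ℝ → ℝ≥0∞ := fun s => gaussianNorm (a s) (F s) with hfE
  have hfEm : AEMeasurable fE (volume.restrict (Icc 0 T)) :=
    aemeasurable_gaussianNorm ha.meas hF'm (ae_mono hν1 hF'e)
  have hflt : ∀ᵐ s ∂volume.restrict (Icc 0 T), fE s < ⊤ := ae_lt_top' hfEm hFi
  -- The Gaussian weight is at least `1`, so finiteness of the weighted norm at almost every time
  -- puts the source in `L²`.
  have hF'2 : ∀ᵐ s ∂volume.restrict (Icc 0 T), MemLp (F' s) 2 := by
    filter_upwards [hflt, ae_mono hν1 hF'e, ae_mono hν1 (ae_restrict_mem measurableSet_Icc)]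
      with s h1 h2 h3
    have h4 := (MeasurableSolution.stronglyMeasurable_section hF'm s).aestronglyMeasurable
      (μ := volume)
    refine memLp_of_gaussianNorm_lt_top (ha.nonneg s h3) h4 ?_
    convert! h1 using 1
    exact eLpNorm_congr_ae (h2.mono fun x hx => by simp only [hx])
  have hle : ∀ᵐ s ∂volume.restrict (Icc 0 T), ∀ᵐ x,
      inner ℝ (u' s x) (c * H' s x) ≤ m s * ‖u' s x‖ ^ 2 + ‖c‖ * (‖u' s x‖ * ‖F' s x‖) := by
    filter_upwards [ae_mono hν1 hH', ae_mono hν1 hF'e, ae_mono hν1 S.ae_eq, hmlt]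
      with s h1 h2 h3 h4
    have h5 : ∀ᵐ x, ‖A * max (V s x).re 0 - B * (V s x).im‖ₑ ≤ mE s := by
      simp only [hmE, eLpNorm_exponent_top]
      exact ae_le_eLpNormEssSup
    filter_upwards [h1, h2, h3, h5] with x h1 h2 h3 h5
    rw [← h1, ← h2, ← h3]
    refine potential_inner_le hA ?_
    rw [← toReal_enorm]
    exact ENNReal.toReal_mono h4.ne h5
  obtain ⟨K, hK⟩ := exists_integral_sq_le hu
    (MeasurableSolution.ae_memLp S.meas_u S.sq_u) S.ae_eq
  -- The factor `exp(-M_T)` is moved to the right and the right-hand side uses the full Gaussian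
  -- weights, so the bound does not depend on `j`, as Fatou's lemma requires.
  have hmain : ∀ j : ℕ, eLpNorm (fun x => Real.exp (a T * boundedQuadratic n (1 / (j + 1)) x) •
      u T x) 2 volume ≤ ENNReal.ofReal (Real.exp (∫ s in (0 : ℝ)..T, m s)) *
      (gaussianNorm γ (u 0) + ENNReal.ofReal √(A ^ 2 + B ^ 2) * ∫⁻ t in Icc 0 T, fE t) := by
    intro j
    have hδ : (0 : ℝ) < 1 / (j + 1) := by positivity
    have hq := isBoundedQuadratic (n := n) hδ
    set q := boundedQuadratic n (1 / (j + 1))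
    have hqM : ∀ t ∈ Icc (0 : ℝ) 1, ∀ x, a t * q x ≤ γ * (1 / (1 / (j + 1))) := fun t ht x =>
      mul_le_mul (ha.le t ht) (hq.le x) (hq.nonneg x) hγ
    have hfle : ∀ᵐ s ∂volume.restrict (Icc 0 T),
        ENNReal.ofReal √(∫ x, Real.exp (2 * a s * q x) * ‖F' s x‖ ^ 2) ≤ fE s := by
      filter_upwards [hF'2, ae_mono hν1 hF'e, ae_mono hν1 (ae_restrict_mem measurableSet_Icc)]
        with s h1 h2 h3
      rw [ofReal_sqrt_weighted hq.cont (hqM s h3) h1]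
      refine (eLpNorm_exp_smul_le_gaussianNorm (ha.nonneg s h3) (boundedQuadratic_le hδ)
        (F' s)).trans_eq ?_
      exact eLpNorm_congr_ae (h2.mono fun x hx => by simp only [hx])
    have hfm := (MeasurableSolution.measurable_integral_weighted hF'm ha.meas
      hq.cont).measurable.sqrt
    have hfi0 : Integrable (fun s => √(∫ x, Real.exp (2 * a s * q x) * ‖F' s x‖ ^ 2))
        (volume.restrict (Icc 0 T)) := by
      refine ⟨hfm.aestronglyMeasurable, ?_⟩
      rw [hasFiniteIntegral_iff_ofReal (Eventually.of_forall fun s => Real.sqrt_nonneg _)]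
      exact (lintegral_mono_ae hfle).trans_lt hFi.lt_top
    have hfi : IntervalIntegrable (fun s => √(∫ x, Real.exp (2 * a s * q x) * ‖F' s x‖ ^ 2))
        volume 0 T := by
      rw [intervalIntegrable_iff_integrableOn_Ioc_of_le hT.1, IntegrableOn, hν0]
      exact hfi0
    have key := S.sqrt_weighted_energy_le ha hA hc hq hT (fun s => ENNReal.toReal_nonneg) hmi
      (hν0 ▸ hF'2) (hν0 ▸ hle) hfi hK
    rw [Real.exp_neg, inv_mul_le_iff₀ (Real.exp_pos _)] at key
    have hFint : ENNReal.ofReal (∫ s in (0 : ℝ)..T,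
        √(∫ x, Real.exp (2 * a s * q x) * ‖F' s x‖ ^ 2)) = ∫⁻ s in Icc 0 T,
        ENNReal.ofReal √(∫ x, Real.exp (2 * a s * q x) * ‖F' s x‖ ^ 2) := by
      rw [intervalIntegral.integral_of_le hT.1, hν0, ofReal_integral_eq_lintegral_ofReal hfi0
        (Eventually.of_forall fun s => Real.sqrt_nonneg _)]
    rw [← ofReal_sqrt_weighted hq.cont (hqM T hT) (S.memLp T hT)]
    refine (ENNReal.ofReal_le_ofReal key).trans ?_
    rw [ENNReal.ofReal_mul (Real.exp_pos _).le,
      ENNReal.ofReal_add (Real.sqrt_nonneg _) (mul_nonneg (norm_nonneg _)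
        (intervalIntegral.integral_nonneg hT.1 fun s _ => Real.sqrt_nonneg _)),
      ENNReal.ofReal_mul (norm_nonneg _), hcn, ofReal_sqrt_weighted hq.cont (hqM 0 h0)
      (S.memLp 0 h0), hFint]
    refine mul_le_mul' le_rfl (add_le_add ?_ (mul_le_mul' le_rfl (lintegral_mono_ae hfle)))
    have h1 := eLpNorm_exp_smul_le_gaussianNorm (ha.nonneg 0 h0) (boundedQuadratic_le hδ) (u 0)
    rwa [hadef, decayRate_zero hA] at h1 ⊢
  have hfin := gaussianNorm_le_of_boundedQuadratic (S.memLp T hT).1 hmain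
  rw [ereal_exp_neg_coe hM, ← hmint]
  refine (mul_le_mul_right hfin _).trans ?_
  rw [← mul_assoc, ← ENNReal.ofReal_mul (Real.exp_pos _).le, ← Real.exp_add, neg_add_cancel,
    Real.exp_zero, ENNReal.ofReal_one, one_mul]
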